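/- Let $F$ be a nonarchimedean local field with ring of integers $\mathcal O$, residue field $\kappa$ of characteristic $p$, and normalized valuation $\mathrm{val}$. Let $G$ be the group of $F$-points of an $F$-split connected reductive group, with split maximal torus $T$, character lattice $X^*(T)$, roots $\Phi$, a choice of positive roots $\Phi^+$, and Borel subgroup $B=TU$, where $U$ is generated by the root subgroups $U_\alpha$, $\alpha\in\Phi^+$. Let $K$ be the corresponding hyperspecial maximal compact subgroup (the $\mathcal O$-points of the split reductive $\mathcal O$-model of $G$ in which $T$ extends to a split torus), and let $I\subset K$ be the pro-$p$ Iwahori subgroup, i.e. the preimage in $K$ of $\overline U(\kappa)$, where $\overline U$ is the unipotent radical of the Borel subgroup of the special fibre given by $\Phi^+$. Put $T^1=T\cap I$. (Concretely, $G$ is given by Chevalley's construction from a root datum and an admissible lattice in a faithful representation.) Let $k$ be a field, let $H=k[I\backslash G/I]$ be the convolution algebra of compactly supported $I$-biinvariant functions $G\to k$, and let $\mathbf X=k[I\backslash G]$ be the space of finitely supported functions on $I\backslash G$, a left $H$-module by convolution, on which $G$ acts by right translations. For $t\in T$ let $\tau_t\in H$ be the characteristic function of $ItI$. Call $t\in T$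 antidominant if $\mathrm{val}(\alpha(t))\ge 0$ for all $\alpha\in\Phi^+$, and let $\mathcal A_{anti}\subset H$ be the $k$-subalgebra generated by the $\tau_t$ with $t$ antidominant. Let $R$ be a commutative $k$-algebra and $\xi:\mathcal A_{anti}\to R$ a homomorphism of $k$-algebras that is regular, i.e. $\xi(\tau_t)\in R^\times$ for every antidominant $t$. Then there is a unique homomorphism $\underline\xi:T\to R^\times$, trivial on $T^1$, such that $\xi(\tau_t)=\underline\xi(t^{-1})$ for all antidominant $t\in T$. Inflate $\underline\xi$ to $B$ and let $\mathrm{Ind}_B^G(\underline\xi)$ be the $R$-module of all functions $f:G\to R$ with $f(bg)=\underline\xi(b)f(g)$ for all $b\in B$, $g\in G$, whose stabilizer under right translation by $G$ is open. Then there is a $G$-equivariant isomorphism of $R$-modules $$\xi\otimes_{\mathcal A_{anti}}\mathbf X\;\cong\;\mathrm{Ind}_B^G(\underline\xi),$$ and these $R$-modules are free. -/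

import Mathlib

/-! ## Hecke algebras -/

namespace Hecke

variable (k : Type*) [CommRing k] {Γ : Type*} [Group Γ] (I : Subgroup Γ)

/-- The support of `f` is contained in a finite union of right cosets `I s`. -/
def FiniteRight {k : Type*} [CommRing k] {Γ : Type*} [Group Γ] (I : Subgroup Γ) (f : Γ → k) :
    Prop :=
  ∃ S : Finset Γ, ∀ x, f x ≠ 0 → ∃ s ∈ S, ∃ i ∈ I, x = i * s

/-- The support of `f` is contained in a finite union of left cosets `s I`. -/
def FiniteLeft {k : Type*} [CommRing k] {Γ : Type*} [Group Γ] (I : Subgroup Γ) (f : Γ → k) :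
    Prop :=
  ∃ S : Finset Γ, ∀ x, f x ≠ 0 → ∃ s ∈ S, ∃ i ∈ I, x = s * i

/-- The module `X = k[I \ Γ]` of `k`-valued functions on `Γ` that are left `I`-invariant and
have finite support in `I \ Γ`. -/
def universalModule : Submodule k (Γ → k) where
  carrier := {f | (∀ i ∈ I, ∀ x, f (i * x) = f x) ∧ FiniteRight I f}
  zero_mem' := ⟨by simp, ∅, by simp⟩
  add_mem' := by
    classical
    rintro f g ⟨hf, S, hS⟩ ⟨hg, S', hS'⟩
    refine ⟨fun i hi x => by simp [hf i hi, hg i hi], S ∪ S', fun x hx => ?_⟩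
    by_cases h : f x = 0
    · obtain ⟨s, hs, h⟩ := hS' x (by simpa [h] using hx)
      exact ⟨s, by simp [hs], h⟩
    · obtain ⟨s, hs, h⟩ := hS x h
      exact ⟨s, by simp [hs], h⟩
  smul_mem' := by
    rintro c f ⟨hf, S, hS⟩
    refine ⟨fun i hi x => by simp [hf i hi], S, fun x hx => hS x fun h => hx (by simp [h])⟩

/-- The `k`-valued functions on `Γ` that are `I`-invariant on both sides and whose support is a
finite union of left cosets, and also a finite union of right cosets, of `I`. When `I` is a compact
open subgroup of a topological group `Γ`, these are the `I`-biinvariant functions with compact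
support. -/
def biinvariant : Submodule k (Γ → k) where
  carrier := {f | (∀ i ∈ I, ∀ x, f (i * x) = f x) ∧ (∀ i ∈ I, ∀ x, f (x * i) = f x) ∧
    FiniteRight I f ∧ FiniteLeft I f}
  zero_mem' := ⟨by simp, by simp, ⟨∅, by simp⟩, ∅, by simp⟩
  add_mem' := by
    classical
    rintro f g ⟨hf, hf', ⟨S, hS⟩, T, hT⟩ ⟨hg, hg', ⟨S', hS'⟩, T', hT'⟩
    refine ⟨fun i hi x => by simp [hf i hi, hg i hi], fun i hi x => by simp [hf' i hi, hg' i hi],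
      ⟨S ∪ S', fun x hx => ?_⟩, T ∪ T', fun x hx => ?_⟩
    · by_cases h : f x = 0
      · obtain ⟨s, hs, h⟩ := hS' x (by simpa [h] using hx)
        exact ⟨s, by simp [hs], h⟩
      · obtain ⟨s, hs, h⟩ := hS x h
        exact ⟨s, by simp [hs], h⟩
    · by_cases h : f x = 0
      · obtain ⟨s, hs, h⟩ := hT' x (by simpa [h] using hx)
        exact ⟨s, by simp [hs], h⟩
      · obtain ⟨s, hs, h⟩ := hT x h
        exact ⟨s, by simp [hs], h⟩
  smul_mem' := by
    rintro c f ⟨hf, hf', ⟨S, hS⟩, T, hT⟩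
    exact ⟨fun i hi x => by simp [hf i hi], fun i hi x => by simp [hf' i hi],
      ⟨S, fun x hx => hS x fun h => hx (by simp [h])⟩,
      T, fun x hx => hT x fun h => hx (by simp [h])⟩

variable {k}

/-- Convolution: `(h ⋆ f)(x) = ∑ h(y) f(y⁻¹ x)`, the sum being over `y ∈ Γ / I`. -/
noncomputable def conv (h f : Γ → k) (x : Γ) : k :=
  ∑ᶠ y : Γ ⧸ I, h y.out * f (y.out⁻¹ * x)

variable {I}

lemma out_eq (g : Γ) : ∃ i ∈ I, (g : Γ ⧸ I).out = g * i := by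
  obtain ⟨i, hi⟩ := QuotientGroup.mk_out_eq_mul I g
  exact ⟨i, i.2, hi⟩

/-- A right `I`-invariant function is determined by its values on representatives. -/
lemma apply_out {A : Type*} {F : Γ → A} (hF : ∀ i ∈ I, ∀ x, F (x * i) = F x) (g : Γ) :
    F (g : Γ ⧸ I).out = F g := by
  obtain ⟨i, hi, h⟩ := out_eq (I := I) g
  rw [h, hF i hi]

lemma finite_of_finiteLeft {h : Γ → k} (hh : FiniteLeft I h) :
    ∃ A : Finset (Γ ⧸ I), ∀ g : Γ, h g ≠ 0 → (g : Γ ⧸ I) ∈ A := by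
  classical
  obtain ⟨S, hS⟩ := hh
  refine ⟨S.image (QuotientGroup.mk : Γ → Γ ⧸ I), fun g hg => ?_⟩
  obtain ⟨s, hs, i, hi, rfl⟩ := hS g hg
  refine Finset.mem_image.2 ⟨s, hs, ?_⟩
  rw [QuotientGroup.eq]
  simpa using hi

lemma sum_translate {F : Γ → k} (hF : ∀ i ∈ I, ∀ x, F (x * i) = F x) (g : Γ) :
    ∑ᶠ y : Γ ⧸ I, F (g * y.out) = ∑ᶠ y : Γ ⧸ I, F y.out := by
  rw [← finsum_comp_equiv (MulAction.toPerm g : Equiv.Perm (Γ ⧸ I)) (f := fun y => F y.out)]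
  refine finsum_congr fun y => ?_
  have h : (MulAction.toPerm g : Equiv.Perm (Γ ⧸ I)) y = ((g * y.out : Γ) : Γ ⧸ I) := by
    rw [MulAction.toPerm_apply]
    nth_rewrite 1 [← QuotientGroup.out_eq' y]
    rfl
  rw [h]
  exact (apply_out hF _).symm

lemma term_inv {h f : Γ → k} (hh : ∀ i ∈ I, ∀ x, h (x * i) = h x)
    (hf : ∀ i ∈ I, ∀ x, f (i * x) = f x) (x : Γ) :
    ∀ i ∈ I, ∀ y, h (y * i) * f ((y * i)⁻¹ * x) = h y * f (y⁻¹ * x) := by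
  intro i hi y
  rw [hh i hi, mul_inv_rev, mul_assoc, hf _ (I.inv_mem hi)]

lemma conv_eq_sum {h : Γ → k} (f : Γ → k) {A : Finset (Γ ⧸ I)}
    (hA : ∀ g : Γ, h g ≠ 0 → (g : Γ ⧸ I) ∈ A) (x : Γ) :
    conv I h f x = ∑ y ∈ A, h y.out * f (y.out⁻¹ * x) := by
  refine finsum_eq_sum_of_support_subset _ fun y hy => ?_
  have : h y.out ≠ 0 := fun h0 => hy (by simp [h0])
  simpa using hA _ this

lemma conv_ne_zero {h f : Γ → k} {x : Γ} (hx : conv I h f x ≠ 0) :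
    ∃ y, h y ≠ 0 ∧ f (y⁻¹ * x) ≠ 0 := by
  by_contra! hc
  refine hx (finsum_eq_zero_of_forall_eq_zero fun y => ?_)
  by_cases h0 : h y.out = 0
  · simp [h0]
  · simp [hc _ h0]

lemma conv_left_inv {h f : Γ → k} (hl : ∀ i ∈ I, ∀ x, h (i * x) = h x)
    (hr : ∀ i ∈ I, ∀ x, h (x * i) = h x) (hf : ∀ i ∈ I, ∀ x, f (i * x) = f x) :
    ∀ i ∈ I, ∀ x, conv I h f (i * x) = conv I h f x := by
  intro i hi x
  unfold conv
  rw [← sum_translate (F := fun y => h y * f (y⁻¹ * (i * x))) (term_inv hr hf _) i]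
  refine finsum_congr fun y => ?_
  rw [hl i hi]
  congr 2
  group

lemma conv_finiteRight {h f : Γ → k} (hr : ∀ i ∈ I, ∀ x, h (x * i) = h x)
    (hh : FiniteRight I h) (hf : FiniteRight I f) : FiniteRight I (conv I h f) := by
  classical
  obtain ⟨S, hS⟩ := hh
  obtain ⟨T, hT⟩ := hf
  refine ⟨(S ×ˢ T).image fun p => p.1 * p.2, fun x hx => ?_⟩
  obtain ⟨y, hy, hy'⟩ := conv_ne_zero hx
  obtain ⟨t, ht, j, hj, hjt⟩ := hT _ hy'
  obtain ⟨s, hs, i, hi, his⟩ := hS (y * j) (by rwa [hr j hj])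
  refine ⟨s * t, Finset.mem_image.2 ⟨(s, t), by simp [hs, ht], rfl⟩, i, hi, ?_⟩
  rw [← mul_assoc, ← his, mul_assoc, ← hjt]
  group

lemma conv_finiteLeft {h f : Γ → k} (hl : ∀ i ∈ I, ∀ x, f (i * x) = f x)
    (hh : FiniteLeft I h) (hf : FiniteLeft I f) : FiniteLeft I (conv I h f) := by
  classical
  obtain ⟨S, hS⟩ := hh
  obtain ⟨T, hT⟩ := hf
  refine ⟨(S ×ˢ T).image fun p => p.1 * p.2, fun x hx => ?_⟩
  obtain ⟨y, hy, hy'⟩ := conv_ne_zero hx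
  obtain ⟨s, hs, i, hi, rfl⟩ := hS y hy
  obtain ⟨t, ht, j, hj, hjt⟩ := hT (s⁻¹ * x) (by
    rw [mul_inv_rev, mul_assoc, hl _ (I.inv_mem hi)] at hy'
    exact hy')
  refine ⟨s * t, Finset.mem_image.2 ⟨(s, t), by simp [hs, ht], rfl⟩, j, hj, ?_⟩
  rw [mul_assoc, ← hjt]
  group

lemma conv_mem_universalModule {h f : Γ → k} (hh : h ∈ biinvariant k I)
    (hf : f ∈ universalModule k I) : conv I h f ∈ universalModule k I :=
  ⟨conv_left_inv hh.1 hh.2.1 hf.1, conv_finiteRight hh.2.1 hh.2.2.1 hf.2⟩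

lemma conv_mem_biinvariant {h f : Γ → k} (hh : h ∈ biinvariant k I)
    (hf : f ∈ biinvariant k I) : conv I h f ∈ biinvariant k I := by
  refine ⟨conv_left_inv hh.1 hh.2.1 hf.1, fun i hi x => ?_, conv_finiteRight hh.2.1 hh.2.2.1 hf.2.2.1,
    conv_finiteLeft hf.1 hh.2.2.2 hf.2.2.2⟩
  unfold conv
  refine finsum_congr fun y => ?_
  rw [← mul_assoc, hf.2.1 i hi]

lemma conv_assoc {h h' f : Γ → k} (hh : h ∈ biinvariant k I) (hh' : h' ∈ biinvariant k I)
    (hf : ∀ i ∈ I, ∀ x, f (i * x) = f x) :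
    conv I (conv I h h') f = conv I h (conv I h' f) := by
  classical
  funext x
  obtain ⟨A, hA⟩ := finite_of_finiteLeft hh.2.2.2
  obtain ⟨B, hB⟩ := finite_of_finiteLeft (conv_mem_biinvariant hh hh').2.2.2
  obtain ⟨C, hC⟩ := finite_of_finiteLeft hh'.2.2.2
  let D : Finset (Γ ⧸ I) := B ∪ (A ×ˢ C).image fun p => p.1.out • p.2
  rw [conv_eq_sum (A := D) f (fun g hg => Finset.mem_union_left _ (hB g hg)), conv_eq_sum _ hA]
  simp_rw [conv_eq_sum h' hA, Finset.sum_mul]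
  rw [Finset.sum_comm]
  refine Finset.sum_congr rfl fun y hy => ?_
  have key : conv I h' f (y.out⁻¹ * x)
      = ∑ w ∈ D, h' (y.out⁻¹ * w.out) * f (w.out⁻¹ * x) := by
    unfold conv
    rw [← sum_translate (F := fun z => h' z * f (z⁻¹ * (y.out⁻¹ * x))) (term_inv hh'.2.1 hf _)
      y.out⁻¹]
    have : ∀ w : Γ ⧸ I, h' (y.out⁻¹ * w.out) * f ((y.out⁻¹ * w.out)⁻¹ * (y.out⁻¹ * x))
        = h' (y.out⁻¹ * w.out) * f (w.out⁻¹ * x) := by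
      intro w
      congr 2
      group
    simp_rw [this]
    refine finsum_eq_sum_of_support_subset _ fun w hw => ?_
    have h1 : h' (y.out⁻¹ * w.out) ≠ 0 := fun h0 => hw (by simp [h0])
    refine Finset.mem_coe.2 (Finset.mem_union_right _ (Finset.mem_image.2
      ⟨(y, ((y.out⁻¹ * w.out : Γ) : Γ ⧸ I)), Finset.mem_product.2 ⟨hy, hC _ h1⟩, ?_⟩))
    change ((y.out * (y.out⁻¹ * w.out) : Γ) : Γ ⧸ I) = w
    rw [mul_inv_cancel_left]
    exact QuotientGroup.out_eq' w
  rw [key, Finset.mul_sum]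
  exact Finset.sum_congr rfl fun w _ => by rw [mul_assoc]

open Classical in
/-- The characteristic function of the subgroup `I`. -/
lemma charFun_mem : (fun x => if x ∈ I then 1 else 0 : Γ → k) ∈ biinvariant k I := by
  refine ⟨fun i hi x => ?_, fun i hi x => ?_, ⟨{1}, fun x hx => ?_⟩, {1}, fun x hx => ?_⟩
  · simp [I.mul_mem_cancel_left hi]
  · simp [I.mul_mem_cancel_right hi]
  · have : x ∈ I := by by_contra h; simp [h] at hx
    exact ⟨1, by simp, x, this, by simp⟩
  · have : x ∈ I := by by_contra h; simp [h] at hx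
    exact ⟨1, by simp, x, this, by simp⟩

open Classical in
lemma char_conv {f : Γ → k} (hf : ∀ i ∈ I, ∀ x, f (i * x) = f x) :
    conv I (fun x => if x ∈ I then 1 else 0) f = f := by
  funext x
  rw [conv_eq_sum (A := {((1 : Γ) : Γ ⧸ I)})]
  · obtain ⟨i, hi, h⟩ := out_eq (I := I) 1
    rw [Finset.sum_singleton, h]
    simp [hi, hf _ (I.inv_mem hi)]
  · intro g hg
    have : g ∈ I := by by_contra h; simp [h] at hg
    rw [Finset.mem_singleton, QuotientGroup.eq]
    simpa using this

open Classical in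
lemma conv_char {h : Γ → k} (hh : ∀ i ∈ I, ∀ x, h (x * i) = h x) :
    conv I h (fun x => if x ∈ I then 1 else 0) = h := by
  funext x
  unfold conv
  rw [finsum_eq_single _ (x : Γ ⧸ I)]
  · obtain ⟨i, hi, h'⟩ := out_eq (I := I) x
    rw [h', hh i hi]
    simp [hi]
  · intro y hy
    have : ¬ (y.out⁻¹ * x ∈ I) := by
      intro hm
      apply hy
      rw [← QuotientGroup.out_eq' y]
      exact QuotientGroup.eq.2 hm
    simp [this]

lemma conv_add_left {h h' : Γ → k} (f : Γ → k) (hh : FiniteLeft I h) (hh' : FiniteLeft I h') :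
    conv I (h + h') f = conv I h f + conv I h' f := by
  classical
  obtain ⟨A, hA⟩ := finite_of_finiteLeft hh
  obtain ⟨B, hB⟩ := finite_of_finiteLeft hh'
  funext x
  rw [Pi.add_apply, conv_eq_sum (A := A ∪ B) f fun g hg => Finset.mem_union_left _ (hA g hg),
    conv_eq_sum (A := A ∪ B) f fun g hg => Finset.mem_union_right _ (hB g hg),
    conv_eq_sum (A := A ∪ B), ← Finset.sum_add_distrib]
  · simp [add_mul]
  · intro g hg
    by_cases h0 : h g = 0
    · exact Finset.mem_union_right _ (hB g (by simpa [h0] using hg))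
    · exact Finset.mem_union_left _ (hA g h0)

lemma conv_add_right {h : Γ → k} (f f' : Γ → k) (hh : FiniteLeft I h) :
    conv I h (f + f') = conv I h f + conv I h f' := by
  obtain ⟨A, hA⟩ := finite_of_finiteLeft hh
  funext x
  rw [Pi.add_apply, conv_eq_sum _ hA, conv_eq_sum _ hA, conv_eq_sum _ hA, ← Finset.sum_add_distrib]
  simp [mul_add]

lemma conv_smul_left (c : k) {h : Γ → k} (f : Γ → k) (hh : FiniteLeft I h) :
    conv I (c • h) f = c • conv I h f := by
  obtain ⟨A, hA⟩ := finite_of_finiteLeft hh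
  funext x
  rw [Pi.smul_apply, conv_eq_sum _ hA, conv_eq_sum (A := A), Finset.smul_sum]
  · simp [mul_assoc]
  · exact fun g hg => hA g fun h0 => hg (by simp [h0])

lemma conv_smul_right (c : k) {h : Γ → k} (f : Γ → k) (hh : FiniteLeft I h) :
    conv I h (c • f) = c • conv I h f := by
  obtain ⟨A, hA⟩ := finite_of_finiteLeft hh
  funext x
  rw [Pi.smul_apply, conv_eq_sum _ hA, conv_eq_sum _ hA, Finset.smul_sum]
  simp [mul_left_comm]

lemma conv_zero (h : Γ → k) : conv I h 0 = 0 := by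
  funext x
  simp [conv]

lemma zero_conv (f : Γ → k) : conv I 0 f = 0 := by
  funext x
  simp [conv]

variable (k I)

/-- The Hecke algebra `k[I \ Γ / I]`: the functions of `biinvariant k I` under convolution. -/
def HeckeAlgebra : Type _ := biinvariant k I

namespace HeckeAlgebra

noncomputable instance : AddCommGroup (HeckeAlgebra k I) :=
  inferInstanceAs (AddCommGroup (biinvariant k I))

noncomputable instance : Module k (HeckeAlgebra k I) :=
  inferInstanceAs (Module k (biinvariant k I))

variable {k I} in
/-- The function on `Γ` underlying an element of the Hecke algebra. -/
def toFun (h : HeckeAlgebra k I) : Γ → k := h.1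

noncomputable instance : Mul (HeckeAlgebra k I) :=
  ⟨fun h h' => ⟨conv I h.1 h'.1, conv_mem_biinvariant h.2 h'.2⟩⟩

open Classical in
noncomputable instance : One (HeckeAlgebra k I) :=
  ⟨⟨fun x => if x ∈ I then 1 else 0, charFun_mem⟩⟩

noncomputable instance : Ring (HeckeAlgebra k I) where
  __ := (inferInstance : AddCommGroup (HeckeAlgebra k I))
  left_distrib a b c := Subtype.ext (conv_add_right b.1 c.1 a.2.2.2.2)
  right_distrib a b c := Subtype.ext (conv_add_left c.1 a.2.2.2.2 b.2.2.2.2)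
  zero_mul a := Subtype.ext (zero_conv a.1)
  mul_zero a := Subtype.ext (conv_zero a.1)
  mul_assoc a b c := Subtype.ext (conv_assoc a.2 b.2 c.2.1)
  one_mul a := Subtype.ext (char_conv a.2.1)
  mul_one a := Subtype.ext (conv_char a.2.2.1)

noncomputable instance : Algebra k (HeckeAlgebra k I) :=
  Algebra.ofModule (fun c a b => Subtype.ext (conv_smul_left c b.1 a.2.2.2.2))
    (fun c a b => Subtype.ext (conv_smul_right c b.1 a.2.2.2.2))

/-- `X = k[I \ Γ]` is a left module over the Hecke algebra, by convolution. -/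
noncomputable instance : Module (HeckeAlgebra k I) (universalModule k I) where
  smul h f := ⟨conv I h.1 f.1, conv_mem_universalModule h.2 f.2⟩
  one_smul f := Subtype.ext (char_conv f.2.1)
  mul_smul h h' f := Subtype.ext (conv_assoc h.2 h'.2 f.2.1)
  smul_zero h := Subtype.ext (conv_zero h.1)
  smul_add h f f' := Subtype.ext (conv_add_right f.1 f'.1 h.2.2.2.2)
  add_smul h h' f := Subtype.ext (conv_add_left f.1 h.2.2.2.2 h'.2.2.2.2)
  zero_smul f := Subtype.ext (zero_conv f.1)

end HeckeAlgebra

/-- The action of `Γ` on `X = k[I \ Γ]` by right translations: `(g f)(x) = f (x g)`. -/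
def translate (g : Γ) (f : universalModule k I) : universalModule k I :=
  ⟨fun x => f.1 (x * g), fun i hi x => by
    change f.1 (i * x * g) = f.1 (x * g)
    rw [mul_assoc, f.2.1 i hi], by
    classical
    obtain ⟨S, hS⟩ := f.2.2
    refine ⟨S.image fun s => s * g⁻¹, fun x hx => ?_⟩
    obtain ⟨s, hs, i, hi, h⟩ := hS _ hx
    refine ⟨s * g⁻¹, Finset.mem_image_of_mem _ hs, i, hi, ?_⟩
    rw [← mul_assoc, ← h]
    group⟩

variable {I}

/-- Every double coset `I g I` is a finite union of left cosets of `I` (and then, replacing `g` by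
`g⁻¹`, also a finite union of right cosets). -/
def FiniteDoubleCosets {Γ : Type*} [Group Γ] (I : Subgroup Γ) : Prop :=
  ∀ g : Γ, ∃ S : Finset Γ, ∀ i ∈ I, ∃ s ∈ S, ∃ j ∈ I, i * g = s * j

open Classical in
/-- The characteristic function of the double coset `I g I`. -/
noncomputable def tau (hI : FiniteDoubleCosets I) (g : Γ) : HeckeAlgebra k I :=
  ⟨fun x => if ∃ i ∈ I, ∃ j ∈ I, x = i * g * j then 1 else 0, by
    refine ⟨fun i hi x => if_congr ⟨?_, ?_⟩ rfl rfl, fun i hi x => if_congr ⟨?_, ?_⟩ rfl rfl, ?_, ?_⟩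
    · rintro ⟨a, ha, c, hc, h⟩
      exact ⟨i⁻¹ * a, I.mul_mem (I.inv_mem hi) ha, c, hc, by
        rw [mul_assoc, mul_assoc, ← mul_assoc a, ← h]; group⟩
    · rintro ⟨a, ha, c, hc, rfl⟩
      exact ⟨i * a, I.mul_mem hi ha, c, hc, by group⟩
    · rintro ⟨a, ha, c, hc, h⟩
      exact ⟨a, ha, c * i⁻¹, I.mul_mem hc (I.inv_mem hi), by rw [← mul_assoc, ← h]; group⟩
    · rintro ⟨a, ha, c, hc, rfl⟩
      exact ⟨a, ha, c * i, I.mul_mem hc hi, by group⟩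
    · obtain ⟨S, hS⟩ := hI g⁻¹
      refine ⟨S.image fun s => s⁻¹, fun x hx => ?_⟩
      have : ∃ i ∈ I, ∃ j ∈ I, x = i * g * j := by by_contra h; simp [h] at hx
      obtain ⟨i, hi, j, hj, rfl⟩ := this
      obtain ⟨s, hs, l, hl, h⟩ := hS j⁻¹ (I.inv_mem hj)
      refine ⟨s⁻¹, Finset.mem_image_of_mem _ hs, i * l⁻¹, I.mul_mem hi (I.inv_mem hl), ?_⟩
      have h2 : g * j = l⁻¹ * s⁻¹ := by rw [← mul_inv_rev, ← h]; group
      rw [mul_assoc, h2, mul_assoc]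
    · obtain ⟨S, hS⟩ := hI g
      refine ⟨S, fun x hx => ?_⟩
      have : ∃ i ∈ I, ∃ j ∈ I, x = i * g * j := by by_contra h; simp [h] at hx
      obtain ⟨i, hi, j, hj, rfl⟩ := this
      obtain ⟨s, hs, l, hl, h⟩ := hS i hi
      exact ⟨s, hs, l * j, I.mul_mem hl hj, by rw [h, mul_assoc]⟩⟩

end Hecke

open scoped ValuativeRel

/-! ## Split reductive groups -/

/-- A faithful representation, over `ℤ`, of the split reductive group with root datum `P`, written
in a basis (indexed by `J`) of weight vectors: `wt j` is the weight of the `j`-th basis vector and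
`e α n` is the matrix of the divided power `e_α ^ n / n!` of the root vector `e_α`, where the
`e_α` form a Chevalley system for the roots of `P`. The representation being faithful means that
its weights generate the character lattice `X`. -/
structure ChevalleyLattice {ι X Y : Type*} [Finite ι] [AddCommGroup X] [AddCommGroup Y]
    (P : RootDatum ι X Y) (J : Type*) [Fintype J] [DecidableEq J] where
  /-- The weights. -/
  wt : J → X
  closure_wt : AddSubgroup.closure (Set.range wt) = ⊤
  /-- The divided powers of the root vectors; `e α 1` is the root vector `e_α`. -/
  e : ι → ℕ → Matrix J J ℤ
  factorial_smul_e : ∀ α n, n.factorial • e α n = e α 1 ^ n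
  /-- `e_α` maps vectors of weight `μ` to vectors of weight `μ + α`. -/
  wt_of_e_ne_zero : ∀ α i j, e α 1 i j ≠ 0 → wt i = wt j + P.root α
  /-- `[e_α, e_{-α}]` acts on vectors of weight `μ` by `⟨μ, α^∨⟩`. -/
  lie_neg : ∀ α α', P.root α' = -P.root α →
    e α 1 * e α' 1 - e α' 1 * e α 1 =
      Matrix.diagonal fun j => P.toLinearMap (wt j) (P.coroot α)
  /-- `[e_α, e_β] = ± (r + 1) e_{α + β}`, for `r` the largest integer with `β - r α` a root. -/
  lie_add : ∀ α β γ, P.root γ = P.root α + P.root β →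
    e α 1 * e β 1 - e β 1 * e α 1 = (P.chainBotCoeff α β + 1) • e γ 1 ∨
    e α 1 * e β 1 - e β 1 * e α 1 = -((P.chainBotCoeff α β + 1) • e γ 1)
  /-- `[e_α, e_β] = 0` when `α + β` is neither zero nor a root. -/
  lie_eq_zero : ∀ α β, P.root α + P.root β ≠ 0 → P.root α + P.root β ∉ Set.range P.root →
    e α 1 * e β 1 = e β 1 * e α 1

namespace ChevalleyLattice

variable {ι X Y : Type*} [Finite ι] [AddCommGroup X] [AddCommGroup Y] {P : RootDatum ι X Y}
  {J : Type*} [Fintype J] [DecidableEq J] (V : ChevalleyLattice P J)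

/-- The matrix `x_α(u) = exp (u e_α) = ∑ uⁿ e_α ^ n / n!`. The terms with `n ≥ |J|` vanish since
`e_α` is nilpotent. -/
def rootMatrix {S : Type*} [CommRing S] (α : ι) (u : S) : Matrix J J S :=
  ∑ n ∈ Finset.range (Fintype.card J), u ^ n • (V.e α n).map (Int.castRingHom S)

/-- The group `T(S) = Hom(X, Sˣ)` of `S`-points of the split torus with character lattice `X`. -/
abbrev Torus (X S : Type*) [AddCommGroup X] [CommRing S] : Type _ := Multiplicative X →* Sˣ

/-- `t ∈ T(S)` acts on a vector of weight `μ` by `t(μ)`. -/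
def torusHom (S : Type*) [CommRing S] : Torus X S →* Matrix.GeneralLinearGroup J S where
  toFun t :=
    { val := Matrix.diagonal fun j => (t (Multiplicative.ofAdd (V.wt j)) : S)
      inv := Matrix.diagonal fun j => ((t (Multiplicative.ofAdd (V.wt j)))⁻¹ : Sˣ)
      val_inv := by simp
      inv_val := by simp }
  map_one' := by ext1; simp
  map_mul' s t := by ext1; simp

/-- The subgroup `U(S)` generated by the `x_α(u)` for `u ∈ S` and `α` a positive root. -/
def unipotent (b : P.Base) (S : Type*) [CommRing S] :
    Subgroup (Matrix.GeneralLinearGroup J S) :=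
  Subgroup.closure {g | ∃ α, b.IsPos α ∧ ∃ u : S, (g : Matrix J J S) = V.rootMatrix α u}

/-- The group `G = G(F)` of `F`-points, for a field `F`, of the split connected reductive group
with root datum `P` (Chevalley's construction): it is generated by the points of the split torus
and by all root subgroups. Every split connected reductive group over `F` is of this form, and
different choices of `V` give the same group up to isomorphism. -/
def points (F : Type*) [Field F] : Subgroup (Matrix.GeneralLinearGroup J F) :=
  Subgroup.closure (Set.range (V.torusHom F) ∪
    {g | ∃ α, ∃ u : F, (g : Matrix J J F) = V.rootMatrix α u})

lemma isOpen_stabilizer {G A : Type*} [Group G] [TopologicalSpace G] [ContinuousMul G] {s : Set G}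
    (hs : IsOpen s) (f : G → A) (h1 : 1 ∈ s) (hf : ∀ w ∈ s, ∀ g, f (g * w) = f g) :
    IsOpen {w : G | ∀ g, f (g * w) = f g} := by
  let H : Subgroup G :=
    { carrier := {w : G | ∀ g, f (g * w) = f g}
      one_mem' := by simp
      mul_mem' := fun {a c} ha hc g => by rw [← mul_assoc, hc, ha]
      inv_mem' := fun {a} ha g => by rw [← ha (g * a⁻¹), inv_mul_cancel_right] }
  exact H.isOpen_of_mem_nhds (g := 1) (Filter.mem_of_superset (hs.mem_nhds h1) hf)

lemma exists_conj {F : Type*} [Field F] [ValuativeRel F] {J : Type*} [Fintype J] [DecidableEq J]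
    {a m c : 𝒪[F]} (ha : a = m * (c * c)) {g g' : Matrix J J F}
    (hg : ∃ p : Matrix J J 𝒪[F], (c : F) • g = p.map 𝒪[F].subtype)
    (hg' : ∃ p : Matrix J J 𝒪[F], (c : F) • g' = p.map 𝒪[F].subtype) (hgg : g' * g = 1)
    {h : Matrix J J 𝒪[F]}
    (hh : h.map (Ideal.Quotient.mk (Ideal.span {a})) = 1) :
    ∃ y : Matrix J J 𝒪[F], g' * h.map 𝒪[F].subtype * g = (1 + m • y).map 𝒪[F].subtype := by
  obtain ⟨p, hp⟩ := hg
  obtain ⟨p', hp'⟩ := hg'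
  have h1 : ∀ i j, ∃ z, h i j = (1 : Matrix J J 𝒪[F]) i j + a * z := by
    intro i j
    have h2 := congrFun (congrFun hh i) j
    have h3 : (Ideal.Quotient.mk (Ideal.span {a})) (h i j)
        = (Ideal.Quotient.mk (Ideal.span {a})) ((1 : Matrix J J 𝒪[F]) i j) := by
      rw [Matrix.map_apply] at h2
      rw [h2, Matrix.one_apply, Matrix.one_apply]
      split_ifs <;> simp
    rw [Ideal.Quotient.eq, Ideal.mem_span_singleton] at h3
    obtain ⟨z, hz⟩ := h3
    exact ⟨z, by rw [← hz]; ring⟩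
  choose z hz using h1
  have h4 : h = 1 + a • (Matrix.of z) := by
    ext i j
    simp [hz]
  refine ⟨p' * Matrix.of z * p, ?_⟩
  have e1 : ∀ (x y : Matrix J J 𝒪[F]), (x + y).map 𝒪[F].subtype
      = x.map 𝒪[F].subtype + y.map 𝒪[F].subtype := fun x y => Matrix.map_add _ (by simp) x y
  have e2 : ∀ (r : 𝒪[F]) (x : Matrix J J 𝒪[F]), (r • x).map 𝒪[F].subtype
      = (r : F) • x.map 𝒪[F].subtype := fun r x => by ext; simp
  have e3 : ∀ (x y : Matrix J J 𝒪[F]), (x * y).map 𝒪[F].subtype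
      = x.map 𝒪[F].subtype * y.map 𝒪[F].subtype := fun x y => Matrix.map_mul
  have e4 : (1 : Matrix J J 𝒪[F]).map 𝒪[F].subtype = 1 :=
    Matrix.map_one _ (by simp) (by simp)
  rw [h4, e1, e1, e2, e2, e3, e3, e4, ← hp, ← hp', ha]
  simp [mul_add, add_mul, hgg, smul_smul]

lemma exists_denominator {F : Type*} [Field F] [ValuativeRel F] {J : Type*} [Fintype J] (g : Matrix J J F) :
    ∃ c : 𝒪[F], c ≠ 0 ∧ ∃ p : Matrix J J 𝒪[F], (c : F) • g = p.map 𝒪[F].subtype := by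
  obtain ⟨c, hc⟩ := IsLocalization.exist_integer_multiples_of_finite (nonZeroDivisors 𝒪[F])
    (fun x : J × J => g x.1 x.2)
  choose p hp using hc
  refine ⟨c, nonZeroDivisors.ne_zero c.2, Matrix.of fun i j => p (i, j), ?_⟩
  ext i j
  exact (hp (i, j)).symm

section LocalField

variable (F : Type*) [Field F]

/-- The embedding of the torus `T = T(F)` in `G`. -/
def torusPoints : Torus X F →* V.points F :=
  (V.torusHom F).codRestrict _ fun t => Subgroup.subset_closure (Or.inl ⟨t, rfl⟩)

/-- `U = U(F)` as a subgroup of `G`. -/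
def unipotentPoints (b : P.Base) : Subgroup (V.points F) :=
  (V.unipotent b F).subgroupOf (V.points F)

variable [ValuativeRel F]

/-- The pro-`p` Iwahori subgroup `I` of `G`: its elements are the elements of
`K = G ∩ GL_J(𝒪)` whose reduction in `GL_J(𝓀)` lies in the group `U(𝓀)` of points of the unipotent
radical of the Borel subgroup given by the positive roots, `𝓀` being the residue field. -/
noncomputable def iwahori (b : P.Base) : Subgroup (V.points F) :=
  (((V.unipotent b 𝓀[F]).comap
    (Matrix.GeneralLinearGroup.map (IsLocalRing.residue 𝒪[F]))).map
      (Matrix.GeneralLinearGroup.map 𝒪[F].subtype)).subgroupOf (V.points F)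

variable [TopologicalSpace F] [IsNonarchimedeanLocalField F]

/-- The double cosets of `I` in `G` are finite unions of left cosets. -/
lemma finiteDoubleCosets_iwahori (b : P.Base) : Hecke.FiniteDoubleCosets (V.iwahori F b) := by
  classical
  intro g
  obtain ⟨c₁, hc₁, p₁, hp₁⟩ := exists_denominator (g.1 : Matrix J J F)
  obtain ⟨c₂, hc₂, p₂, hp₂⟩ := exists_denominator ((g.1⁻¹ : Matrix.GeneralLinearGroup J F) : Matrix J J F)
  obtain ⟨m, hm⟩ := IsDiscreteValuationRing.exists_irreducible 𝒪[F]
  set c := c₁ * c₂ with hc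
  set a := m * (c * c) with ha
  have ha0 : a ≠ 0 := mul_ne_zero hm.ne_zero
    (mul_ne_zero (mul_ne_zero hc₁ hc₂) (mul_ne_zero hc₁ hc₂))
  have hfin : Finite (𝒪[F] ⧸ Ideal.span {a}) := by
    obtain ⟨n, hn⟩ := IsDiscreteValuationRing.ideal_eq_span_pow_irreducible
      (s := Ideal.span {a}) (fun h => ha0 (Ideal.span_singleton_eq_bot.1 h)) hm
    rw [hn, ← Ideal.span_singleton_pow, ← hm.maximalIdeal_eq]
    have : Finite (𝒪[F] ⧸ 𝓂[F]) := inferInstanceAs (Finite 𝓀[F])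
    exact Ideal.finite_quotient_pow (IsNoetherian.noetherian _) n
  let ψ : Matrix.GeneralLinearGroup J 𝒪[F] →* Matrix.GeneralLinearGroup J (𝒪[F] ⧸ Ideal.span {a}) :=
    Matrix.GeneralLinearGroup.map (Ideal.Quotient.mk (Ideal.span {a}))
  have hlift : ∀ i : V.iwahori F b, ∃ i₀ : Matrix.GeneralLinearGroup J 𝒪[F],
      Matrix.GeneralLinearGroup.map (IsLocalRing.residue 𝒪[F]) i₀ ∈ V.unipotent b 𝓀[F] ∧
      Matrix.GeneralLinearGroup.map 𝒪[F].subtype i₀ = i.1.1 := fun i => i.2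
  choose l hl hl' using hlift
  have hfr : (Set.range fun i => ψ (l i)).Finite := Set.toFinite _
  have hr : ∀ q : Set.range fun i => ψ (l i), ∃ i, ψ (l i) = q := fun q => q.2
  choose r hr using hr
  refine ⟨(Set.range fun q => ((r q : V.iwahori F b) : V.points F) * g).toFinite.toFinset,
    fun i hi => ?_⟩
  let s := r ⟨ψ (l ⟨i, hi⟩), ⟨i, hi⟩, rfl⟩
  have hs : ψ (l s) = ψ (l ⟨i, hi⟩) := hr ⟨ψ (l ⟨i, hi⟩), ⟨i, hi⟩, rfl⟩
  refine ⟨s.1 * g, by simp [s], (s.1 * g)⁻¹ * (i * g), ?_, by group⟩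
  set h := (l s)⁻¹ * l ⟨i, hi⟩ with hh
  have hψ : ψ h = 1 := by rw [hh, map_mul, map_inv, hs, inv_mul_cancel]
  have hψ' : ψ h⁻¹ = 1 := by rw [map_inv, hψ, inv_one]
  have hmat : ∀ x : Matrix.GeneralLinearGroup J 𝒪[F], ψ x = 1 →
      (x : Matrix J J 𝒪[F]).map (Ideal.Quotient.mk (Ideal.span {a})) = 1 := fun x hx =>
    congrArg Units.val hx
  have d1 : ∃ p : Matrix J J 𝒪[F], (c : F) • (g.1 : Matrix J J F) = p.map 𝒪[F].subtype := by
    refine ⟨c₂ • p₁, ?_⟩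
    have : (c₂ • p₁).map 𝒪[F].subtype = (c₂ : F) • p₁.map 𝒪[F].subtype := by ext; simp
    rw [this, ← hp₁, smul_smul, hc, mul_comm c₁]
    rfl
  have d2 : ∃ p : Matrix J J 𝒪[F], (c : F) • ((g.1⁻¹ : Matrix.GeneralLinearGroup J F) : Matrix J J F) = p.map 𝒪[F].subtype := by
    refine ⟨c₁ • p₂, ?_⟩
    have : (c₁ • p₂).map 𝒪[F].subtype = (c₁ : F) • p₂.map 𝒪[F].subtype := by ext; simp
    rw [this, ← hp₂, smul_smul, hc]
    rfl
  obtain ⟨y, hy⟩ := exists_conj ha d1 d2 (Units.inv_mul g.1) (hmat h hψ)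
  obtain ⟨y', hy'⟩ := exists_conj ha d1 d2 (Units.inv_mul g.1) (hmat _ hψ')
  have hinj : Function.Injective fun x : Matrix J J 𝒪[F] => x.map 𝒪[F].subtype :=
    Matrix.map_injective Subtype.val_injective
  have hmul : ∀ x x' : Matrix J J 𝒪[F], (x * x').map 𝒪[F].subtype
      = x.map 𝒪[F].subtype * x'.map 𝒪[F].subtype := fun x x' => Matrix.map_mul
  have hone : (1 : Matrix J J 𝒪[F]).map 𝒪[F].subtype = 1 :=
    Matrix.map_one _ (by simp) (by simp)
  have hcancel : ∀ x x' : Matrix J J F, x * x' = 1 →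
      ((g.1⁻¹ : Matrix.GeneralLinearGroup J F) : Matrix J J F) * x * (g.1 : Matrix J J F) *
      (((g.1⁻¹ : Matrix.GeneralLinearGroup J F) : Matrix J J F) * x' * (g.1 : Matrix J J F)) = 1 := by
    intro x x' hx
    have : ∀ γ γ' : Matrix J J F, γ * γ' = 1 → γ' * γ = 1 → γ' * x * γ * (γ' * x' * γ) = 1 := by
      intro γ γ' h1 h2
      calc γ' * x * γ * (γ' * x' * γ) = γ' * x * (γ * γ') * x' * γ := by noncomm_ring
        _ = γ' * (x * x') * γ := by rw [h1]; noncomm_ring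
        _ = 1 := by rw [hx, mul_one, h2]
    exact this _ _ (Units.mul_inv g.1) (Units.inv_mul g.1)
  let h₁ : Matrix.GeneralLinearGroup J 𝒪[F] :=
    { val := 1 + m • y
      inv := 1 + m • y'
      val_inv := hinj (by
        change ((1 + m • y) * (1 + m • y')).map 𝒪[F].subtype
          = (1 : Matrix J J 𝒪[F]).map 𝒪[F].subtype
        rw [hmul, ← hy, ← hy', hone]
        exact hcancel _ _ (by rw [← hmul, Units.mul_inv, hone]))
      inv_val := hinj (by
        change ((1 + m • y') * (1 + m • y)).map 𝒪[F].subtype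
          = (1 : Matrix J J 𝒪[F]).map 𝒪[F].subtype
        rw [hmul, ← hy, ← hy', hone]
        exact hcancel _ _ (by rw [← hmul, Units.inv_mul, hone])) }
  refine ⟨h₁, ?_, ?_⟩
  · have : Matrix.GeneralLinearGroup.map (IsLocalRing.residue 𝒪[F]) h₁ = 1 := by
      ext i j
      have hm0 : IsLocalRing.residue 𝒪[F] m = 0 := (IsLocalRing.residue_eq_zero_iff m).2 hm.1
      change IsLocalRing.residue 𝒪[F] ((1 + m • y) i j) = (1 : Matrix J J 𝓀[F]) i j
      rw [Matrix.add_apply, Matrix.smul_apply, smul_eq_mul, map_add, map_mul, hm0, zero_mul,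
        add_zero, Matrix.one_apply, Matrix.one_apply]
      split_ifs <;> simp
    change Matrix.GeneralLinearGroup.map (IsLocalRing.residue 𝒪[F]) h₁ ∈ V.unipotent b 𝓀[F]
    rw [this]
    exact one_mem _
  · have e1 : Matrix.GeneralLinearGroup.map 𝒪[F].subtype h₁ =
        g.1⁻¹ * Matrix.GeneralLinearGroup.map 𝒪[F].subtype h * g.1 := Units.ext hy.symm
    have e2 : Matrix.GeneralLinearGroup.map 𝒪[F].subtype h = s.1.1⁻¹ * i.1 := by
      rw [hh, map_mul, map_inv, hl', hl']
    change Matrix.GeneralLinearGroup.map 𝒪[F].subtype h₁ = (s.1.1 * g.1)⁻¹ * (i.1 * g.1)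
    rw [e1, e2]
    group

/-! ## Characters of the antidominant subalgebra and principal series -/

section PrincipalSeries

variable {F}

/-- The subgroup `T¹ = T ∩ I` of `T`. -/
noncomputable def torusOne (b : P.Base) : Subgroup (Torus X F) :=
  (V.iwahori F b).comap (V.torusPoints F)

/-- `t ∈ T` is antidominant if the cocharacter `ν(t)` with `⟨ν(t), χ⟩ = -val(χ(t))` satisfies
`⟨ν(t), α⟩ ≤ 0`, that is `val(α(t)) ≥ 0`, for all positive roots `α`. -/
def IsAntidominant (b : P.Base) (t : Torus X F) : Prop :=
  ∀ α, b.IsPos α →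
    ValuativeRel.valuation F (t (Multiplicative.ofAdd (P.root α)) : F) ≤ 1

variable (F) (b : P.Base) (k : Type*) [Field k]

/-- The Hecke algebra `H = k[I \ G / I]`. -/
abbrev HeckeAlg : Type _ := Hecke.HeckeAlgebra k (V.iwahori F b)

/-- The universal module `X = k[I \ G]`. -/
abbrev Universal : Type _ := Hecke.universalModule k (V.iwahori F b)

variable {F}

/-- The characteristic function `τ_t` of `I t I`, for `t ∈ T`. -/
noncomputable def tau (t : Torus X F) : V.HeckeAlg F b k :=
  Hecke.tau k (V.finiteDoubleCosets_iwahori F b) (V.torusPoints F t)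

variable (F) in
/-- The subalgebra `A_anti` of `H` generated by the `τ_t` for `t ∈ T` antidominant. (These elements
are multiplicative in `t`, so that they form a basis of `A_anti`.) -/
noncomputable def antiAlgebra : Subalgebra k (V.HeckeAlg F b k) :=
  Algebra.adjoin k {h | ∃ t : Torus X F, IsAntidominant (P := P) b t ∧ h = V.tau b k t}

/-- `τ_t` as an element of `A_anti`, for `t` antidominant. -/
noncomputable def antiTau (t : Torus X F) (ht : IsAntidominant (P := P) b t) :
    V.antiAlgebra F b k :=
  ⟨V.tau b k t, Algebra.subset_adjoin ⟨t, ht, rfl⟩⟩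

variable {b k} {R : Type*} [CommRing R]

/-- The space of functions `f : G → R` with `f (t u g) = φ(t) f(g)` for `t ∈ T`, `u ∈ U`, `g ∈ G`
(so that `f (b g) = φ(b) f(g)` for `b ∈ B = T U`, when `φ` is inflated to `B`) whose stabilizer in
`G` under right translations is open: this is `Ind_B^G(φ)`. -/
def induced (b : P.Base) (φ : Torus X F →* Rˣ) : Submodule R (V.points F → R) where
  carrier := {f | (∀ t, ∀ u ∈ V.unipotentPoints F b, ∀ g, f (V.torusPoints F t * u * g) = φ t * f g) ∧
    IsOpen {w : V.points F | ∀ g, f (g * w) = f g}}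
  zero_mem' := by simp
  add_mem' := by
    rintro f f' ⟨hf, hfo⟩ ⟨hf', hfo'⟩
    refine ⟨fun t u hu g => by simp [hf t u hu, hf' t u hu, mul_add], ?_⟩
    exact isOpen_stabilizer (hfo.inter hfo') (f + f') (by simp) fun w hw g => by simp [hw.1 g, hw.2 g]
  smul_mem' := by
    rintro c f ⟨hf, hfo⟩
    refine ⟨fun t u hu g => by simp [hf t u hu, mul_left_comm], ?_⟩
    exact isOpen_stabilizer hfo (c • f) (by simp) fun w hw g => by simp [hw g]

variable [Algebra k R]

/-- A character `ξ : A_anti → R` is regular if it maps every `τ_t`, `t` antidominant, to a unit. -/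
def IsRegular (ξ : V.antiAlgebra F b k →ₐ[k] R) : Prop :=
  ∀ t (ht : IsAntidominant (P := P) b t), IsUnit (ξ (V.antiTau b k t ht))

/-- `φ : T → Rˣ` is the character attached to `ξ : A_anti → R`: it is trivial on `T¹` and
`ξ(τ_t) = φ(t⁻¹)` for all antidominant `t`. -/
structure IsAttached (ξ : V.antiAlgebra F b k →ₐ[k] R) (φ : Torus X F →* Rˣ) : Prop where
  trivial : ∀ t ∈ V.torusOne b, φ t = 1
  apply_antiTau : ∀ t (ht : IsAntidominant (P := P) b t),
    ξ (V.antiTau b k t ht) = (φ t⁻¹ : Rˣ)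

open scoped TensorProduct

/-- The `R`-module `ξ ⊗_{A_anti} X`: the quotient of `R ⊗_k X` by the relations
`r ξ(a) ⊗ x = r ⊗ a x` for `a ∈ A_anti`. -/
abbrev CharTensor (ξ : V.antiAlgebra F b k →ₐ[k] R) : Type _ :=
  (R ⊗[k] V.Universal F b k) ⧸ Submodule.span R
    {z : R ⊗[k] V.Universal F b k | ∃ (r : R) (a : V.antiAlgebra F b k) (x : V.Universal F b k),
      z = (r * ξ a) ⊗ₜ[k] x - r ⊗ₜ[k] ((a : V.HeckeAlg F b k) • x)}

/-- The element `r ⊗ x` of `ξ ⊗_{A_anti} X`. -/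
noncomputable def charTmul (ξ : V.antiAlgebra F b k →ₐ[k] R) (r : R) (x : V.Universal F b k) :
    V.CharTensor ξ :=
  Submodule.Quotient.mk (r ⊗ₜ[k] x)

end PrincipalSeries

end LocalField
end ChevalleyLattice

/-!
# Principal series as base change of the universal module

Let `f₀ : G → R` be the function supported on `B I` with `f₀(b i) = φ(b)`. The map
`Ψ : r ⊗ 1_{I g} ↦ r f₀(· g⁻¹)` is the required isomorphism.

*The map is well defined.* For `t` antidominant one has `t (B ∩ I) t⁻¹ ⊂ I` and
`t⁻¹ (U⁻ ∩ I) t ⊂ I`. With the factorization `I = (B ∩ I) (U⁻ ∩ I)` this gives `τ_t τ_s = τ_{ts}`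
(`tau_mul`), hence the character `φ` (`exists_isAttached`), and it shows that `f₀` is an eigenvector
for convolution by `τ_t`, with eigenvalue `φ(t⁻¹) = ξ(τ_t)` (`conv_borelFun_tau`).

*Injectivity and freeness.* Fix `c ∈ T` strictly antidominant. As `τ_t` acts on `ξ ⊗ X` by a unit,
the class of `1_{I g}` is a combination of classes of `1_{I t n g}` with `n ∈ U⁻ ∩ I`. Together
with `G = T U K` this shows that `ξ ⊗ X` is the increasing union of the submodules spanned by the
classes of `1_{I cᵐ κ}`, `κ ∈ K` (`iSup_span_charVec`). For fixed `m > 0`, the images under `Ψ` of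
two of these classes, restricted to `K`, either have disjoint supports or are multiples of each
other by a unit, and in the latter case the classes are already proportional in `ξ ⊗ X`
(`charVec_eq_smul`). So at level `m` there is an equivalence relation on `K`, which gets finer as `m`
grows, and a choice of representatives compatible with all `m` yields a basis of `ξ ⊗ X` on which
`Ψ` is triangular (`injective_and_free_of_refining`).

*Surjectivity.* Conjugation by `c⁻ᵐ` shrinks `U⁻ ∩ I` to `1`. So, for `m` large, a given element of
the induced representation is, on each class of the relation at level `m`, proportional to the
image of the corresponding vector, and there are finitely many classes (`exists_charMap_eq`).

*Structure of `G`.* The facts on `G` used above, namely `G = T U K` (`exists_iwasawa`), the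
factorization of `I` (`exists_eq_mul_of_mem_iwahori`) and the behaviour of `U` and `U⁻` under
conjugation by `T`, are derived from the Chevalley relations in the given representation. All
relations are proved over `ℤ` at the parameter `1` and transported to any ring by rescaling matrix
entries by a function multiplicative in the weight (`twist`). The commutator relations
(`exists_conj_eq_rootProd`) come from solving a linear differential equation in the lattice of
matrices over `ℚ[s]`: its solution is a product of root elements with polynomial parameters. These
parameters are integers at `s = 1` because the root vectors are primitive (`e_primitive`). Products
of the elements `n_α` are handled through the weights they permute, and a word preserving the
positive simple roots lies in `T` (`weylWord_mem_range_torusHom`). This gives `G = T U W U⁻`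
(`exists_birkhoff`), and a comparison of the entries of largest height singles out the trivial Weyl
element for elements of `I`.
-/

namespace ChevalleyLattice

variable {ι X Y : Type*} [Finite ι] [AddCommGroup X] [AddCommGroup Y] {P : RootDatum ι X Y}
  {J : Type*} [Fintype J] [DecidableEq J] (V : ChevalleyLattice P J)

/-! ### Divided powers of the root vectors -/

omit [Fintype J] [DecidableEq J] in
lemma matrix_nsmul_cancel {n : ℕ} (hn : n ≠ 0) {A B : Matrix J J ℤ} (h : n • A = n • B) :
    A = B := by
  ext i j
  have := congrFun (congrFun h i) j
  simpa [hn] using this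

omit [Finite ι] in
lemma nsmul_root_injective (P : RootDatum ι X Y) (α : ι) :
    Function.Injective fun n : ℤ => n • P.root α := by
  have : Module.IsReflexive ℤ X := .of_isPerfPair P.toLinearMap
  have : IsAddTorsionFree X := .of_isTorsionFree ℤ X
  exact smul_left_injective ℤ (P.ne_zero α)

lemma e_zero (α : ι) : V.e α 0 = 1 := by
  simpa using V.factorial_smul_e α 0

lemma e_mul (α : ι) (a c : ℕ) : V.e α a * V.e α c = (a + c).choose a • V.e α (a + c) := by
  refine matrix_nsmul_cancel (n := a.factorial * c.factorial) (by positivity) ?_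
  have h : (a + c).choose a * a.factorial * c.factorial = (a + c).factorial := by
    simpa using Nat.choose_mul_factorial_mul_factorial (Nat.le_add_right a c)
  rw [smul_smul, mul_comm _ (Nat.choose _ _), ← mul_assoc, h, V.factorial_smul_e, pow_add,
    ← V.factorial_smul_e, ← V.factorial_smul_e, smul_mul_smul_comm]

lemma succ_smul_e (α : ι) (n : ℕ) : (n + 1) • V.e α (n + 1) = V.e α 1 * V.e α n := by
  rw [e_mul, add_comm 1 n, Nat.choose_one_right]

lemma exists_wt_of_e_pow {α : ι} {n : ℕ} {i j : J} (h : (V.e α 1 ^ n) i j ≠ 0) :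
    V.wt i = V.wt j + n • P.root α ∧ ∀ k ≤ n, ∃ l, V.wt l = V.wt j + k • P.root α := by
  induction n generalizing i with
  | zero =>
    have : i = j := by by_contra hij; simp [hij] at h
    subst this
    simp
  | succ n ih =>
    rw [pow_succ', Matrix.mul_apply] at h
    obtain ⟨l, -, hl⟩ := Finset.exists_ne_zero_of_sum_ne_zero h
    obtain ⟨h1, h2⟩ := ih (right_ne_zero_of_mul hl)
    have h3 : V.wt i = V.wt j + (n + 1) • P.root α := by
      rw [V.wt_of_e_ne_zero α i l (left_ne_zero_of_mul hl), h1, add_smul, one_smul, add_assoc]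
    refine ⟨h3, fun k hk => ?_⟩
    rcases hk.lt_or_eq with hk | rfl
    · exact h2 k (by lia)
    · exact ⟨i, h3⟩

lemma wt_of_e {α : ι} {n : ℕ} {i j : J} (h : V.e α n i j ≠ 0) :
    V.wt i = V.wt j + n • P.root α := by
  refine (V.exists_wt_of_e_pow (α := α) (n := n) (i := i) (j := j) ?_).1
  rw [← V.factorial_smul_e]
  simpa using ⟨n.factorial_ne_zero, h⟩

/-- The weights `μ, μ + α, …, μ + n α` along a nonzero entry of `e_α ^ n` are distinct. -/
lemma e_eq_zero (α : ι) {n : ℕ} (hn : Fintype.card J ≤ n) : V.e α n = 0 := by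
  ext i j
  by_contra h
  have h1 : (V.e α 1 ^ n) i j ≠ 0 := by
    rw [← V.factorial_smul_e]
    simpa using ⟨n.factorial_ne_zero, h⟩
  have h2 : ∀ k : Fin (n + 1), ∃ l, V.wt l = V.wt j + (k : ℕ) • P.root α :=
    fun k => (V.exists_wt_of_e_pow h1).2 k (by lia)
  choose l hl using h2
  have hinj : Function.Injective l := by
    intro k k' hk
    have h3 : (k : ℕ) • P.root α = (k' : ℕ) • P.root α := by
      have := hl k
      rw [hk, hl k', add_left_cancel_iff] at this
      exact this.symm
    have h4 := nsmul_root_injective P α (a₁ := (k : ℕ)) (a₂ := (k' : ℕ)) (by simpa using h3)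
    exact Fin.ext (by exact_mod_cast h4)
  have := Fintype.card_le_of_injective l hinj
  simp at this
  lia

variable {S : Type*} [CommRing S]

lemma rootMatrix_eq_sum (α : ι) (u : S) {N : ℕ} (hN : Fintype.card J ≤ N) :
    V.rootMatrix α u = ∑ n ∈ Finset.range N, u ^ n • (V.e α n).map (Int.castRingHom S) := by
  refine Finset.sum_subset (Finset.range_mono hN) fun n _ hn => ?_
  rw [V.e_eq_zero α (by simpa using hn), Matrix.map_zero _ (map_zero _), smul_zero]

lemma sum_range_antidiagonal {A : Type*} [AddCommMonoid A] (f : ℕ → ℕ → A) {N : ℕ}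
    (h1 : ∀ a c, N ≤ a → f a c = 0) (h2 : ∀ a c, N ≤ c → f a c = 0) :
    ∑ n ∈ Finset.range (N + N), ∑ p ∈ Finset.HasAntidiagonal.antidiagonal n, f p.1 p.2 =
      ∑ a ∈ Finset.range N, ∑ c ∈ Finset.range N, f a c := by
  simp_rw [Finset.Nat.sum_antidiagonal_eq_sum_range_succ f]
  rw [Finset.sum_range_diag_flip (N + N) f, Finset.sum_range_add]
  have : ∑ x ∈ Finset.range N, ∑ k ∈ Finset.range (N + N - (N + x)), f (N + x) k = 0 :=
    Finset.sum_eq_zero fun x _ => Finset.sum_eq_zero fun k _ => h1 _ _ (by lia)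
  rw [this, add_zero]
  refine Finset.sum_congr rfl fun a ha => ?_
  have ha := Finset.mem_range.1 ha
  refine (Finset.sum_subset (Finset.range_mono (by lia)) fun c _ hc => ?_).symm
  exact h2 _ _ (by simpa using hc)

omit [DecidableEq J] in
lemma map_mul_int (A B : Matrix J J ℤ) :
    (A * B).map (Int.castRingHom S) = A.map (Int.castRingHom S) * B.map (Int.castRingHom S) :=
  Matrix.map_mul

omit [Fintype J] [DecidableEq J] in
lemma map_nsmul_int (n : ℕ) (A : Matrix J J ℤ) :
    (n • A).map (Int.castRingHom S) = n • A.map (Int.castRingHom S) := by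
  ext i j
  rw [Matrix.map_apply, Matrix.smul_apply, Matrix.smul_apply]
  simp

omit [Fintype J] [DecidableEq J] in
lemma map_zsmul_int (n : ℤ) (A : Matrix J J ℤ) :
    (n • A).map (Int.castRingHom S) = n • A.map (Int.castRingHom S) := by
  ext i j
  rw [Matrix.map_apply, Matrix.smul_apply, Matrix.smul_apply]
  simp

lemma rootMatrix_add (α : ι) (u v : S) :
    V.rootMatrix α (u + v) = V.rootMatrix α u * V.rootMatrix α v := by
  set N := Fintype.card J
  rw [V.rootMatrix_eq_sum α (u + v) (N := N + N) (by lia), rootMatrix, rootMatrix,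
    Finset.sum_mul_sum]
  rw [← sum_range_antidiagonal]
  · refine Finset.sum_congr rfl fun n _ => ?_
    rw [(Commute.all u v).add_pow', Finset.sum_smul]
    refine Finset.sum_congr rfl fun p hp => ?_
    obtain rfl := Finset.HasAntidiagonal.mem_antidiagonal.1 hp
    rw [smul_mul_smul_comm, ← map_mul_int, V.e_mul, map_nsmul_int, smul_assoc, smul_comm]
  · intro a c ha
    simp [V.e_eq_zero α ha]
  · intro a c hc
    simp [V.e_eq_zero α hc]

lemma rootMatrix_zero (α : ι) : V.rootMatrix α (0 : S) = 1 := by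
  rw [V.rootMatrix_eq_sum α (0 : S) (N := Fintype.card J + 1) (by lia), Finset.sum_range_succ']
  simp [V.e_zero]

lemma rootMatrix_mul_neg (α : ι) (u : S) : V.rootMatrix α u * V.rootMatrix α (-u) = 1 := by
  rw [← rootMatrix_add, add_neg_cancel, rootMatrix_zero]

lemma rootMatrix_neg_mul (α : ι) (u : S) : V.rootMatrix α (-u) * V.rootMatrix α u = 1 := by
  rw [← rootMatrix_add, neg_add_cancel, rootMatrix_zero]

lemma rootMatrix_map {S' : Type*} [CommRing S'] (f : S →+* S') (α : ι) (u : S) :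
    (V.rootMatrix α u).map f = V.rootMatrix α (f u) := by
  ext i j
  simp [rootMatrix, Matrix.sum_apply]

lemma rootMatrix_apply (α : ι) (u : S) (i j : J) :
    V.rootMatrix α u i j = ∑ n ∈ Finset.range (Fintype.card J), u ^ n * (V.e α n i j : S) := by
  simp [rootMatrix, Matrix.sum_apply]

lemma wt_of_rootMatrix {α : ι} {u : S} {i j : J} (h : V.rootMatrix α u i j ≠ 0) :
    ∃ n : ℕ, V.wt i = V.wt j + n • P.root α := by
  rw [rootMatrix_apply] at h
  obtain ⟨n, -, hn⟩ := Finset.exists_ne_zero_of_sum_ne_zero h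
  exact ⟨n, V.wt_of_e fun h0 => hn (by simp [h0])⟩

lemma rootMatrix_apply_of_wt_eq {α : ι} (u : S) {i j : J} (h : V.wt i = V.wt j) :
    V.rootMatrix α u i j = (1 : Matrix J J S) i j := by
  rw [rootMatrix_apply]
  have hJ : 0 < Fintype.card J := Fintype.card_pos_iff.2 ⟨i⟩
  rw [Finset.sum_eq_single_of_mem 0 (by simpa using hJ)]
  · simp [V.e_zero, Matrix.one_apply]
  · intro n _ hn
    have : V.e α n i j = 0 := by
      by_contra h0
      have h1 := V.wt_of_e h0
      rw [h, left_eq_add] at h1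
      have h2 := nsmul_root_injective P α (a₁ := (n : ℤ)) (a₂ := 0) (by simpa using h1)
      exact hn (by exact_mod_cast h2)
    simp [this]

/-- The root subgroup `x_α` as elements of `GL_J`. -/
def rootUnit (α : ι) (u : S) : Matrix.GeneralLinearGroup J S where
  val := V.rootMatrix α u
  inv := V.rootMatrix α (-u)
  val_inv := V.rootMatrix_mul_neg α u
  inv_val := V.rootMatrix_neg_mul α u

/-! ### The adjoint action of a root subgroup -/

/-- If `A₀, A₁, …` are integral divided powers of `ad e_α` applied to `A₀`, then
`e_α ^ n / n! * A₀` is given by the Leibniz rule. -/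
lemma e_mul_of_ad {α : ι} {A : ℕ → Matrix J J ℤ}
    (h : ∀ i, V.e α 1 * A i - A i * V.e α 1 = (i + 1) • A (i + 1)) (n : ℕ) :
    V.e α n * A 0 = ∑ p ∈ Finset.HasAntidiagonal.antidiagonal n, A p.1 * V.e α p.2 := by
  induction n with
  | zero => simp [V.e_zero]
  | succ n ih =>
    refine matrix_nsmul_cancel (n := n + 1) (by lia) ?_
    rw [← smul_mul_assoc, succ_smul_e, mul_assoc, ih, Finset.mul_sum, Finset.smul_sum]
    have h1 : ∀ p ∈ Finset.HasAntidiagonal.antidiagonal n, V.e α 1 * (A p.1 * V.e α p.2) =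
        (p.1 + 1) • (A (p.1 + 1) * V.e α p.2) + (p.2 + 1) • (A p.1 * V.e α (p.2 + 1)) := by
      intro p _
      rw [← mul_assoc, sub_eq_iff_eq_add.1 (h p.1), add_mul, mul_assoc, ← succ_smul_e,
        smul_mul_assoc, mul_smul_comm]
    have h2 : ∀ p ∈ Finset.HasAntidiagonal.antidiagonal (n + 1), (n + 1) • (A p.1 * V.e α p.2) =
        p.1 • (A p.1 * V.e α p.2) + p.2 • (A p.1 * V.e α p.2) := by
      intro p hp
      rw [← add_smul, Finset.HasAntidiagonal.mem_antidiagonal.1 hp]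
    rw [Finset.sum_congr rfl h1, Finset.sum_congr rfl h2, Finset.sum_add_distrib,
      Finset.sum_add_distrib, Finset.Nat.sum_antidiagonal_succ
        (f := fun p => p.1 • (A p.1 * V.e α p.2)),
      Finset.Nat.sum_antidiagonal_succ' (f := fun p => p.2 • (A p.1 * V.e α p.2))]
    simp

/-- `x_α(u) A₀ x_α(u)⁻¹ = ∑ uⁱ Aᵢ` if the `Aᵢ` are the divided powers of `ad e_α` applied to
`A₀`. -/
lemma rootMatrix_mul_of_ad {α : ι} {A : ℕ → Matrix J J ℤ}
    (h : ∀ i, V.e α 1 * A i - A i * V.e α 1 = (i + 1) • A (i + 1)) {N : ℕ}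
    (hA : ∀ i, N ≤ i → A i = 0) (u : S) :
    V.rootMatrix α u * (A 0).map (Int.castRingHom S) =
      (∑ i ∈ Finset.range N, u ^ i • (A i).map (Int.castRingHom S)) * V.rootMatrix α u := by
  have hs : ∀ M, N ≤ M → ∑ i ∈ Finset.range N, u ^ i • (A i).map (Int.castRingHom S) =
      ∑ i ∈ Finset.range M, u ^ i • (A i).map (Int.castRingHom S) := by
    intro M hM
    refine Finset.sum_subset (Finset.range_mono hM) fun n _ hn => ?_
    simp [hA n (by simpa using hn)]
  set M := max N (Fintype.card J)
  rw [hs M (le_max_left _ _)]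
  conv_rhs => rw [V.rootMatrix_eq_sum α u (N := M) (by lia), Finset.sum_mul_sum]
  rw [V.rootMatrix_eq_sum α u (N := M + M) (by lia), Finset.sum_mul]
  rw [← sum_range_antidiagonal]
  · refine Finset.sum_congr rfl fun n _ => ?_
    rw [smul_mul_assoc, ← map_mul_int, V.e_mul_of_ad h]
    have : (∑ p ∈ Finset.HasAntidiagonal.antidiagonal n, A p.1 * V.e α p.2).map (Int.castRingHom S) =
        ∑ p ∈ Finset.HasAntidiagonal.antidiagonal n, (A p.1 * V.e α p.2).map (Int.castRingHom S) :=
      map_sum (Int.castRingHom S).mapMatrix _ _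
    rw [this, Finset.smul_sum]
    refine Finset.sum_congr rfl fun p hp => ?_
    obtain rfl := Finset.HasAntidiagonal.mem_antidiagonal.1 hp
    rw [map_mul_int, smul_mul_smul_comm, pow_add]
  · intro a c ha
    simp [hA a (by lia)]
  · intro a c hc
    simp [V.e_eq_zero α (n := c) (by lia)]

/-! ### Rescaling matrix entries by a multiplicative function of the weight -/

/-- Multiply each `(i, j)` entry by `χ (wt i - wt j)`. -/
def twist (χ : X → S) (A : Matrix J J S) : Matrix J J S :=
  Matrix.of fun i j => χ (V.wt i - V.wt j) * A i j

/-- The nonzero entries of `A` raise weights by elements of `M`. -/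
def SuppIn (M : AddSubmonoid X) (A : Matrix J J S) : Prop :=
  ∀ i j, A i j ≠ 0 → V.wt i - V.wt j ∈ M

variable {V} {M : AddSubmonoid X}

lemma SuppIn.mul {A B : Matrix J J S} (hA : V.SuppIn M A) (hB : V.SuppIn M B) :
    V.SuppIn M (A * B) := by
  intro i j h
  rw [Matrix.mul_apply] at h
  obtain ⟨l, -, hl⟩ := Finset.exists_ne_zero_of_sum_ne_zero h
  have := M.add_mem (hA i l (left_ne_zero_of_mul hl)) (hB l j (right_ne_zero_of_mul hl))
  rwa [sub_add_sub_cancel] at this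

lemma suppIn_one : V.SuppIn M (1 : Matrix J J S) := by
  intro i j h
  have : i = j := by by_contra hij; simp [hij] at h
  simp [this]

lemma suppIn_rootMatrix {α : ι} (hα : P.root α ∈ M) (u : S) : V.SuppIn M (V.rootMatrix α u) := by
  intro i j h
  obtain ⟨n, hn⟩ := V.wt_of_rootMatrix h
  rw [hn, add_sub_cancel_left]
  exact M.nsmul_mem hα n

variable {χ : X → S}

lemma twist_mul (hχ : ∀ x ∈ M, ∀ y ∈ M, χ (x + y) = χ x * χ y) {A B : Matrix J J S}
    (hA : V.SuppIn M A) (hB : V.SuppIn M B) :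
    V.twist χ (A * B) = V.twist χ A * V.twist χ B := by
  ext i j
  simp only [twist, Matrix.of_apply, Matrix.mul_apply, Finset.mul_sum]
  refine Finset.sum_congr rfl fun l _ => ?_
  by_cases h1 : A i l = 0
  · simp [h1]
  by_cases h2 : B l j = 0
  · simp [h2]
  rw [← sub_add_sub_cancel (V.wt i) (V.wt l) (V.wt j), hχ _ (hA i l h1) _ (hB l j h2)]
  ring

lemma twist_one (h0 : χ 0 = 1) : V.twist χ 1 = 1 := by
  ext i j
  by_cases h : i = j
  · simp [twist, h, h0, Matrix.one_apply]
  · simp [twist, h]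

lemma twist_rootMatrix (h0 : χ 0 = 1) (hχ : ∀ x ∈ M, ∀ y ∈ M, χ (x + y) = χ x * χ y) {α : ι}
    (hα : P.root α ∈ M) (u : S) :
    V.twist χ (V.rootMatrix α u) = V.rootMatrix α (χ (P.root α) * u) := by
  have hn : ∀ n : ℕ, χ (n • P.root α) = χ (P.root α) ^ n := by
    intro n
    induction n with
    | zero => simp [h0]
    | succ n ih => rw [succ_nsmul, hχ _ (M.nsmul_mem hα n) _ hα, ih, pow_succ]
  ext i j
  simp only [twist, Matrix.of_apply, rootMatrix_apply, Finset.mul_sum]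
  refine Finset.sum_congr rfl fun n _ => ?_
  by_cases h : V.e α n i j = 0
  · simp [h]
  rw [V.wt_of_e h, add_sub_cancel_left, hn, mul_pow]
  ring

end ChevalleyLattice

namespace ChevalleyLattice

variable {ι X Y : Type*} [Finite ι] [AddCommGroup X] [AddCommGroup Y] {P : RootDatum ι X Y}
  {J : Type*} [Fintype J] [DecidableEq J] (V : ChevalleyLattice P J)
  {S : Type*} [CommRing S]

/-! ### The rank one subgroups -/

/-- `[e_α, e_{-α}]`, the action of the coroot `α^∨` on the lattice. -/
def cartan (α : ι) : Matrix J J ℤ :=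
  Matrix.diagonal fun j => P.toLinearMap (V.wt j) (P.coroot α)

omit [Finite ι] in
lemma coroot_eq_neg {α α' : ι} (h : P.root α' = -P.root α) : P.coroot α' = -P.coroot α := by
  have h1 : α' = P.reflectionPerm α α := P.root.injective (by simp [h])
  rw [h1, P.coroot_reflectionPerm, P.coreflection_apply_self]

omit [Finite ι] in
lemma root_eq_neg_symm {α α' : ι} (h : P.root α' = -P.root α) : P.root α = -P.root α' := by
  rw [h, neg_neg]

lemma cartan_neg {α α' : ι} (h : P.root α' = -P.root α) : V.cartan α' = -V.cartan α := by
  ext i j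
  by_cases hij : i = j
  · simp [cartan, coroot_eq_neg h, hij]
  · simp [cartan, hij]

lemma e_mul_cartan (α : ι) :
    V.e α 1 * V.cartan α - V.cartan α * V.e α 1 = (-2 : ℤ) • V.e α 1 := by
  ext i j
  rw [Matrix.sub_apply, cartan, Matrix.mul_diagonal, Matrix.diagonal_mul, Matrix.smul_apply]
  by_cases h : V.e α 1 i j = 0
  · simp [h]
  · rw [V.wt_of_e_ne_zero α i j h, map_add, LinearMap.add_apply, P.root_coroot_two, smul_eq_mul]
    ring

/-- `x_α(u) α^∨ x_α(-u) = α^∨ - 2 u e_α`. -/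
lemma rootMatrix_mul_cartan (α : ι) (u : ℤ) :
    V.rootMatrix α u * V.cartan α = (V.cartan α - (2 * u) • V.e α 1) * V.rootMatrix α u := by
  let A : ℕ → Matrix J J ℤ := fun n => match n with
    | 0 => V.cartan α
    | 1 => (-2 : ℤ) • V.e α 1
    | _ => 0
  have hA : ∀ i, V.e α 1 * A i - A i * V.e α 1 = (i + 1) • A (i + 1) := by
    rintro (_ | _ | i)
    · simpa [A] using V.e_mul_cartan α
    · simp only [A, mul_smul_comm, smul_mul_assoc, sub_self, smul_zero]
    · simp [A]
  have := V.rootMatrix_mul_of_ad hA (N := 2) (by rintro (_ | _ | i) h <;> simp_all [A]) u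
  rw [Finset.sum_range_succ, Finset.sum_range_one] at this
  simp only [A, map_zsmul_int] at this
  have hid : ∀ B : Matrix J J ℤ, B.map (Int.castRingHom ℤ) = B := fun B => by ext; simp
  rw [hid, hid] at this
  rw [this, pow_zero, one_smul, pow_one, smul_smul, sub_eq_add_neg, ← neg_smul]
  congr 3
  ring

/-- `x_α(u) e_{-α} x_α(-u) = e_{-α} + u α^∨ - u² e_α`. -/
lemma rootMatrix_mul_e_neg {α α' : ι} (h : P.root α' = -P.root α) (u : ℤ) :
    V.rootMatrix α u * V.e α' 1 =
      (V.e α' 1 + u • V.cartan α - u ^ 2 • V.e α 1) * V.rootMatrix α u := by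
  let A : ℕ → Matrix J J ℤ := fun n => match n with
    | 0 => V.e α' 1
    | 1 => V.cartan α
    | 2 => (-1 : ℤ) • V.e α 1
    | _ => 0
  have hA : ∀ i, V.e α 1 * A i - A i * V.e α 1 = (i + 1) • A (i + 1) := by
    rintro (_ | _ | _ | i)
    · simpa [A, cartan] using V.lie_neg α α' h
    · simp only [A, V.e_mul_cartan α]
      ext i j
      simp only [Matrix.smul_apply]
      simp
    · simp [A]
    · simp [A]
  have := V.rootMatrix_mul_of_ad hA (N := 3) (by rintro (_ | _ | _ | i) h <;> simp_all [A]) u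
  rw [Finset.sum_range_succ, Finset.sum_range_succ, Finset.sum_range_one] at this
  simp only [A, map_zsmul_int] at this
  have hid : ∀ B : Matrix J J ℤ, B.map (Int.castRingHom ℤ) = B := fun B => by ext; simp
  rw [hid, hid, hid] at this
  rw [this, pow_zero, one_smul, pow_one, smul_smul, sub_eq_add_neg, ← neg_smul]
  congr 3
  ring

lemma rootMatrix_mul_e (α : ι) (u : ℤ) :
    V.rootMatrix α u * V.e α 1 = V.e α 1 * V.rootMatrix α u := by
  let A : ℕ → Matrix J J ℤ := fun n => match n with
    | 0 => V.e α 1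
    | _ => 0
  have hA : ∀ i, V.e α 1 * A i - A i * V.e α 1 = (i + 1) • A (i + 1) := by
    rintro (_ | i) <;> simp [A]
  have := V.rootMatrix_mul_of_ad hA (N := 1) (by rintro (_ | i) h <;> simp_all [A]) u
  have hid : ∀ B : Matrix J J ℤ, B.map (Int.castRingHom ℤ) = B := fun B => by ext; simp
  simpa [A, hid] using this

/-- `n_α = x_α(1) x_{-α}(-1) x_α(1)`, a representative of the reflection `s_α`. -/
def weyl (S : Type*) [CommRing S] (α α' : ι) : Matrix J J S :=
  V.rootMatrix α 1 * V.rootMatrix α' (-1) * V.rootMatrix α 1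

lemma weyl_map (α α' : ι) : (V.weyl ℤ α α').map (Int.castRingHom S) = V.weyl S α α' := by
  rw [weyl, weyl, Matrix.map_mul, Matrix.map_mul, rootMatrix_map, rootMatrix_map]
  simp

/-- The inverse of `n_α`. -/
def weylInv (S : Type*) [CommRing S] (α α' : ι) : Matrix J J S :=
  V.rootMatrix α (-1) * V.rootMatrix α' 1 * V.rootMatrix α (-1)

lemma weyl_mul_weylInv (α α' : ι) : V.weyl S α α' * V.weylInv S α α' = 1 := by
  have h1 := V.rootMatrix_mul_neg α (1 : S)
  have h2 := V.rootMatrix_neg_mul α' (1 : S)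
  rw [weyl, weylInv, mul_assoc, ← mul_assoc (V.rootMatrix α 1) (V.rootMatrix α (-1) * _),
    ← mul_assoc (V.rootMatrix α 1), h1, one_mul, mul_assoc, ← mul_assoc (V.rootMatrix α' (-1)), h2,
    one_mul, h1]

lemma weylInv_mul_weyl (α α' : ι) : V.weylInv S α α' * V.weyl S α α' = 1 := by
  have h1 := V.rootMatrix_neg_mul α (1 : S)
  have h2 := V.rootMatrix_mul_neg α' (1 : S)
  rw [weyl, weylInv, mul_assoc, ← mul_assoc (V.rootMatrix α (-1)) (V.rootMatrix α 1 * _),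
    ← mul_assoc (V.rootMatrix α (-1)), h1, one_mul, mul_assoc, ← mul_assoc (V.rootMatrix α' 1), h2,
    one_mul, h1]

variable {V}

lemma weyl_mul_cartan {α α' : ι} (h : P.root α' = -P.root α) :
    V.weyl ℤ α α' * V.cartan α = -V.cartan α * V.weyl ℤ α α' := by
  have e1 := V.rootMatrix_mul_cartan α 1
  have e2 := V.rootMatrix_mul_cartan α' (-1)
  have e3 := V.rootMatrix_mul_e_neg (root_eq_neg_symm h) (-1)
  have e4 := V.rootMatrix_mul_e α 1
  rw [V.cartan_neg h] at e2 e3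
  have e5 : V.rootMatrix α' (-1) * (V.cartan α - (2 * 1 : ℤ) • V.e α 1) =
      (-V.cartan α - (2 : ℤ) • V.e α 1) * V.rootMatrix α' (-1) := by
    rw [mul_sub, mul_smul_comm, e3, ← neg_neg (V.cartan α), mul_neg, e2, ← neg_mul, ← smul_mul_assoc,
      ← sub_mul]
    congr 1
    module
  have e6 : V.rootMatrix α 1 * (-V.cartan α - (2 : ℤ) • V.e α 1) =
      -V.cartan α * V.rootMatrix α 1 := by
    rw [mul_sub, mul_neg, mul_smul_comm, e1, e4, ← neg_mul, ← smul_mul_assoc, ← sub_mul]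
    congr 1
    module
  rw [weyl, mul_assoc, e1, ← mul_assoc, mul_assoc (V.rootMatrix α 1), e5, ← mul_assoc, e6]
  simp only [mul_assoc]

lemma weyl_mul_e {α α' : ι} (h : P.root α' = -P.root α) :
    V.weyl ℤ α α' * V.e α 1 = -V.e α' 1 * V.weyl ℤ α α' := by
  have e1 := V.rootMatrix_mul_cartan α 1
  have e2 := V.rootMatrix_mul_e_neg h 1
  have e3 := V.rootMatrix_mul_e_neg (root_eq_neg_symm h) (-1)
  have e4 := V.rootMatrix_mul_e α 1
  rw [V.cartan_neg h] at e3
  have e6 : V.rootMatrix α 1 * (V.e α 1 + (-1 : ℤ) • -V.cartan α - (-1 : ℤ) ^ 2 • V.e α' 1) =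
      -V.e α' 1 * V.rootMatrix α 1 := by
    rw [mul_sub, mul_add, mul_smul_comm, mul_smul_comm, mul_neg, e1, e2, e4, ← neg_mul,
      ← smul_mul_assoc, ← smul_mul_assoc, ← add_mul, ← sub_mul]
    congr 1
    module
  rw [weyl, mul_assoc, e4, ← mul_assoc, mul_assoc (V.rootMatrix α 1), e3, ← mul_assoc, e6]
  simp only [mul_assoc]

lemma weyl_mul_e_neg {α α' : ι} (h : P.root α' = -P.root α) :
    V.weyl ℤ α α' * V.e α' 1 = -V.e α 1 * V.weyl ℤ α α' := by
  have e1 := V.rootMatrix_mul_e_neg h 1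
  have e2 := V.rootMatrix_mul_cartan α' (-1)
  have e3 := V.rootMatrix_mul_e_neg (root_eq_neg_symm h) (-1)
  have e4 := V.rootMatrix_mul_e α 1
  have e7 := V.rootMatrix_mul_e α' (-1)
  rw [V.cartan_neg h] at e2 e3
  have e5 : V.rootMatrix α' (-1) * (V.e α' 1 + (1 : ℤ) • V.cartan α - (1 : ℤ) ^ 2 • V.e α 1) =
      -V.e α 1 * V.rootMatrix α' (-1) := by
    rw [mul_sub, mul_add, mul_smul_comm, mul_smul_comm, ← neg_neg (V.cartan α), mul_neg, e2, e3, e7,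
      ← neg_mul, ← smul_mul_assoc, ← smul_mul_assoc, ← add_mul, ← sub_mul]
    congr 1
    module
  rw [weyl, mul_assoc, e1, ← mul_assoc, mul_assoc (V.rootMatrix α 1), e5, ← mul_assoc,
    mul_neg, e4]
  simp only [mul_assoc, neg_mul]

lemma suppIn_weyl {M : AddSubmonoid X} {α α' : ι} (hα : P.root α ∈ M) (hα' : P.root α' ∈ M) :
    V.SuppIn M (V.weyl S α α') :=
  ((suppIn_rootMatrix hα _).mul (suppIn_rootMatrix hα' _)).mul (suppIn_rootMatrix hα _)

omit [Finite ι] in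
lemma root_mem_zmultiples {α α' : ι} (h : P.root α' = -P.root α) :
    P.root α' ∈ (AddSubgroup.zmultiples (P.root α)).toAddSubmonoid := by
  rw [h, AddSubgroup.mem_toAddSubmonoid]
  exact neg_mem (AddSubgroup.mem_zmultiples _)

/-- `n_α` is a monomial matrix: it maps the weight space of `μ` to that of `s_α(μ)`. -/
lemma wt_of_weyl {α α' : ι} (h : P.root α' = -P.root α) {i j : J} (hij : V.weyl S α α' i j ≠ 0) :
    V.wt i = P.reflection α (V.wt j) := by
  have h0 : V.weyl ℤ α α' i j ≠ 0 := by
    rw [← V.weyl_map] at hij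
    exact fun h0 => hij (by simp [h0])
  have h1 := congrFun (congrFun (weyl_mul_cartan (V := V) h) i) j
  rw [cartan, Matrix.mul_diagonal, Matrix.neg_mul, Matrix.neg_apply, Matrix.diagonal_mul] at h1
  have h2 : P.toLinearMap (V.wt i) (P.coroot α) = -P.toLinearMap (V.wt j) (P.coroot α) := by
    have : V.weyl ℤ α α' i j * (P.toLinearMap (V.wt i) (P.coroot α) +
      P.toLinearMap (V.wt j) (P.coroot α)) = 0 := by linear_combination h1
    exact eq_neg_of_add_eq_zero_left ((mul_eq_zero.1 this).resolve_left h0)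
  obtain ⟨k, hk⟩ : V.wt i - V.wt j ∈ AddSubgroup.zmultiples (P.root α) :=
    suppIn_weyl (M := (AddSubgroup.zmultiples (P.root α)).toAddSubmonoid)
      (AddSubgroup.mem_zmultiples _) (root_mem_zmultiples h) i j h0
  have h3 : V.wt i = V.wt j + k • P.root α := by rw [← sub_eq_iff_eq_add', ← hk]
  rw [h3, map_add, LinearMap.add_apply, map_zsmul, LinearMap.smul_apply, P.root_coroot_two] at h2
  have h4 : k = -P.toLinearMap (V.wt j) (P.coroot α) := by
    rw [smul_eq_mul] at h2
    lia
  rw [h3, h4, P.reflection_apply, neg_smul, ← sub_eq_add_neg]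
  rfl

/-- `x_α(u) x_{-α}(-u⁻¹) x_α(u) = α^∨(u) n_α`. -/
lemma rootMatrix_mul_mul {α α' : ι} (h : P.root α' = -P.root α) (u : Sˣ) :
    V.rootMatrix α (u : S) * V.rootMatrix α' (-(u⁻¹ : Sˣ) : S) * V.rootMatrix α (u : S) =
      Matrix.diagonal (fun j => ((u ^ P.toLinearMap (V.wt j) (P.coroot α) : Sˣ) : S)) *
        V.weyl S α α' := by
  classical
  let χ : X → S := fun x => if h : ∃ k : ℤ, x = k • P.root α then ((u ^ h.choose : Sˣ) : S) else 0
  have hχ : ∀ k : ℤ, χ (k • P.root α) = ((u ^ k : Sˣ) : S) := by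
    intro k
    have h : ∃ k' : ℤ, k • P.root α = k' • P.root α := ⟨k, rfl⟩
    simp only [χ]
    rw [dif_pos h]
    congr 2
    exact (nsmul_root_injective P α h.choose_spec).symm
  set M := (AddSubgroup.zmultiples (P.root α)).toAddSubmonoid
  have hM : P.root α ∈ M := AddSubgroup.mem_zmultiples _
  have hM' : P.root α' ∈ M := root_mem_zmultiples h
  have h0 : χ 0 = 1 := by simpa using hχ 0
  have hmul : ∀ x ∈ M, ∀ y ∈ M, χ (x + y) = χ x * χ y := by
    rintro _ ⟨k, rfl⟩ _ ⟨l, rfl⟩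
    simp only
    rw [← add_smul, hχ, hχ, hχ, zpow_add, Units.val_mul]
  have h1 : χ (P.root α) = u := by simpa using hχ 1
  have h2 : χ (P.root α') = ((u⁻¹ : Sˣ) : S) := by
    have := hχ (-1)
    rw [neg_one_zsmul, ← h] at this
    simpa using this
  have key : V.twist χ (V.weyl S α α') = V.rootMatrix α (u : S) *
      V.rootMatrix α' (-(u⁻¹ : Sˣ) : S) * V.rootMatrix α (u : S) := by
    rw [weyl, twist_mul hmul ((suppIn_rootMatrix hM _).mul (suppIn_rootMatrix hM' _))
      (suppIn_rootMatrix hM _), twist_mul hmul (suppIn_rootMatrix hM _) (suppIn_rootMatrix hM' _),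
      twist_rootMatrix h0 hmul hM, twist_rootMatrix h0 hmul hM', h1, h2, mul_one, mul_neg, mul_one]
  rw [← key]
  ext i j
  rw [Matrix.diagonal_mul, twist, Matrix.of_apply]
  by_cases hij : V.weyl S α α' i j = 0
  · simp [hij]
  · congr 1
    have h3 := wt_of_weyl h hij
    have h4 : V.wt i - V.wt j = P.toLinearMap (V.wt i) (P.coroot α) • P.root α := by
      have h5 : V.wt j = P.reflection α (V.wt i) := by rw [h3]; exact (P.reflection_same α _).symm
      rw [h5, P.reflection_apply, sub_sub_cancel]
      rfl
    rw [h4, hχ]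

/-- Some weight pairs nontrivially with the coroot of `α`. -/
lemma exists_wt_ne_zero (V : ChevalleyLattice P J) (α : ι) :
    ∃ j, P.toLinearMap (V.wt j) (P.coroot α) ≠ 0 := by
  by_contra! hc
  have h : ∀ x ∈ AddSubgroup.closure (Set.range V.wt), P.toLinearMap x (P.coroot α) = 0 := by
    intro x hx
    induction hx using AddSubgroup.closure_induction with
    | mem x hx => obtain ⟨j, rfl⟩ := hx; exact hc j
    | zero => simp
    | add x y _ _ hx hy => simp [hx, hy]
    | neg x _ hx => simp [hx]
  have := h (P.root α) (by rw [V.closure_wt]; trivial)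
  rw [P.root_coroot_two] at this
  norm_num at this

lemma cartan_ne_zero (V : ChevalleyLattice P J) (α : ι) : V.cartan α ≠ 0 := by
  obtain ⟨j, hj⟩ := V.exists_wt_ne_zero α
  intro h
  have := congrFun (congrFun h j) j
  simp [cartan] at this
  exact hj this

lemma dvd_e_of_dvd {p : ℕ} (hp : p.Prime) {α : ι} (h : ∀ i j, (p : ℤ) ∣ V.e α 1 i j) {n : ℕ}
    (hn : n ≠ 0) (i j : J) : (p : ℤ) ∣ V.e α n i j := by
  have : Fact p.Prime := ⟨hp⟩
  choose B hB using h
  have h1 : V.e α 1 = (p : ℤ) • Matrix.of B := by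
    ext i j
    rw [Matrix.smul_apply, smul_eq_mul]
    exact hB i j
  have h2 : (n.factorial : ℤ) * V.e α n i j = p ^ n * (Matrix.of B ^ n) i j := by
    have := congrFun (congrFun (V.factorial_smul_e α n) i) j
    rw [h1, smul_pow, Matrix.smul_apply, Matrix.smul_apply] at this
    simpa using this
  by_contra hnd
  have h3 : (p : ℤ) ^ n ∣ n.factorial := by
    have hc : IsCoprime ((p : ℤ) ^ n) (V.e α n i j) :=
      IsCoprime.pow_left ((Prime.coprime_iff_not_dvd (Nat.prime_iff_prime_int.1 hp)).2 hnd)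
    exact hc.dvd_of_dvd_mul_right (Dvd.intro _ h2.symm)
  have h4 : p ^ n ∣ n.factorial := by exact_mod_cast h3
  have h5 := padicValNat_factorial_lt_of_ne_zero p hn
  have h6 := (padicValNat_dvd_iff_le (p := p) n.factorial_ne_zero).1 h4
  lia

/-- The root vectors are not divisible by any prime `p`: otherwise `x_α(1)` would be trivial
modulo `p`, so that `n_α` would be unipotent modulo `p`, and it permutes the weights nontrivially. -/
lemma e_primitive (V : ChevalleyLattice P J) (α : ι) {p : ℕ} (hp : p.Prime) :
    ∃ i j, ¬ (p : ℤ) ∣ V.e α 1 i j := by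
  by_contra! h
  have : Fact p.Prime := ⟨hp⟩
  obtain ⟨j, hj⟩ := V.exists_wt_ne_zero α
  have hα' : P.root (P.reflectionPerm α α) = -P.root α := by simp
  have h1 : V.rootMatrix α (1 : ZMod p) = 1 := by
    rw [V.rootMatrix_eq_sum α (1 : ZMod p) (N := Fintype.card J + 1) (by lia),
      Finset.sum_range_succ', Finset.sum_eq_zero]
    · simp [V.e_zero]
    · intro n _
      have : (V.e α (n + 1)).map (Int.castRingHom (ZMod p)) = 0 := by
        ext i j
        simpa [ZMod.intCast_zmod_eq_zero_iff_dvd] using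
          (ZMod.intCast_zmod_eq_zero_iff_dvd _ _).2 (dvd_e_of_dvd hp h n.succ_ne_zero i j)
      rw [this, smul_zero]
  have h2 : V.weyl (ZMod p) α (P.reflectionPerm α α) j j ≠ 0 := by
    rw [weyl, h1, one_mul, mul_one, rootMatrix_apply_of_wt_eq _ _ rfl, Matrix.one_apply_eq]
    exact one_ne_zero
  have h3 := wt_of_weyl hα' h2
  rw [P.reflection_apply, eq_sub_iff_add_eq, add_eq_left] at h3
  have h4 := nsmul_root_injective P α (a₁ := P.toLinearMap (V.wt j) (P.coroot α)) (a₂ := 0)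
    (by simpa using h3)
  exact hj h4

lemma e_ne_zero (V : ChevalleyLattice P J) (α : ι) : V.e α 1 ≠ 0 := by
  obtain ⟨i, j, h⟩ := V.e_primitive α Nat.prime_two
  intro h0
  simp [h0] at h

end ChevalleyLattice

namespace ChevalleyLattice

variable {ι X Y : Type*} [Finite ι] [AddCommGroup X] [AddCommGroup Y] {P : RootDatum ι X Y}
  {J : Type*} [Fintype J] [DecidableEq J] (V : ChevalleyLattice P J)
  {S : Type*} [CommRing S]

/-! ### The action of `n_α` on root vectors -/

/-- The divided powers of `ad e_α` applied to `e_β` are integral multiples of the root vectors of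
the roots `β + i α`: the structure constants `± (r + 1) (r + 2) ⋯ (r + i)` are divisible by `i!`. -/
lemma exists_ad_seq {α β : ι} (hαβ : LinearIndependent ℤ ![P.root α, P.root β]) :
    ∃ A : ℕ → Matrix J J ℤ, A 0 = V.e β 1 ∧
      (∀ i, V.e α 1 * A i - A i * V.e α 1 = (i + 1) • A (i + 1)) ∧
      (∃ N, ∀ i, N ≤ i → A i = 0) ∧
      ∀ i, A i = 0 ∨ ∃ γ, P.root γ = P.root β + i • P.root α ∧ ∃ c : ℤ, A i = c • V.e γ 1 := by
  let T : ℕ → Matrix J J ℤ → Prop := fun i A => A = 0 ∨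
    ∃ γ, P.root γ = P.root β + i • P.root α ∧ P.chainBotCoeff α γ = P.chainBotCoeff α β + i ∧
      ∃ s : ℤ, A = (s * ((P.chainBotCoeff α β + i).choose i : ℕ)) • V.e γ 1
  have step : ∀ i A, T i A → ∃ A', T (i + 1) A' ∧ V.e α 1 * A - A * V.e α 1 = (i + 1) • A' := by
    rintro i A (rfl | ⟨γ, hγ, hbot, s, rfl⟩)
    · exact ⟨0, Or.inl rfl, by simp⟩
    by_cases h : P.root γ + P.root α ∈ Set.range P.root
    · obtain ⟨δ, hδ⟩ := h
      have hli : LinearIndependent ℤ ![P.root α, P.root γ] := by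
        rw [LinearIndependent.pair_iff] at hαβ ⊢
        intro x y hxy
        have h1 := hαβ (x + y * i) y (by rw [← hxy, hγ]; simp only [← natCast_zsmul]; module)
        obtain ⟨h1, rfl⟩ := h1
        exact ⟨by simpa using h1, rfl⟩
      have hbot' : P.chainBotCoeff α δ = P.chainBotCoeff α β + (i + 1) := by
        rw [RootPairing.chainBotCoeff_of_add hli hδ, hbot, add_assoc]
      have hroot : P.root δ = P.root β + (i + 1) • P.root α := by rw [hδ, hγ]; module
      have hc : ((P.chainBotCoeff α β + i).choose i : ℤ) * (P.chainBotCoeff α β + i + 1) =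
          (i + 1) * ((P.chainBotCoeff α β + (i + 1)).choose (i + 1) : ℕ) := by
        have := Nat.add_one_mul_choose_eq (P.chainBotCoeff α β + i) i
        rw [add_assoc] at this
        zify at this
        linear_combination this
      have hrel : ∃ t : ℤ, V.e α 1 * V.e γ 1 - V.e γ 1 * V.e α 1 =
          (t * (P.chainBotCoeff α β + i + 1)) • V.e δ 1 := by
        rcases V.lie_add α γ δ (by rw [hδ, add_comm]) with h | h
        · refine ⟨1, ?_⟩
          rw [h, hbot, ← natCast_zsmul]
          push_cast
          rw [one_mul]
        · refine ⟨-1, ?_⟩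
          rw [h, hbot, ← natCast_zsmul, ← neg_smul]
          push_cast
          rw [neg_one_mul]
      obtain ⟨t, ht⟩ := hrel
      refine ⟨((s * t) * ((P.chainBotCoeff α β + (i + 1)).choose (i + 1) : ℕ)) • V.e δ 1,
        Or.inr ⟨δ, hroot, hbot', s * t, rfl⟩, ?_⟩
      rw [mul_smul_comm, smul_mul_assoc, ← smul_sub, ht, smul_smul, ← natCast_zsmul, smul_smul]
      congr 1
      push_cast
      linear_combination s * t * hc
    · refine ⟨0, Or.inl rfl, ?_⟩
      have hne : P.root α + P.root γ ≠ 0 := by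
        intro h0
        rw [LinearIndependent.pair_iff] at hαβ
        have := (hαβ (1 + i) 1 (by rw [← h0, hγ]; simp only [← natCast_zsmul]; module)).2
        norm_num at this
      rw [mul_smul_comm, smul_mul_assoc, V.lie_eq_zero α γ hne (by rwa [add_comm] at h), sub_self,
        smul_zero]
  choose! f hf hf' using step
  let A : ℕ → Matrix J J ℤ := fun n => Nat.rec (V.e β 1) (fun i B => f i B) n
  have hT : ∀ i, T i (A i) := by
    intro i
    induction i with
    | zero => exact Or.inr ⟨β, by simp, by simp, 1, by simp [A]⟩
    | succ i ih => exact hf i _ ih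
  refine ⟨A, rfl, fun i => hf' i _ (hT i), ⟨P.chainTopCoeff α β + 1, fun i hi => ?_⟩, fun i => ?_⟩
  · rcases hT i with h | ⟨γ, hγ, -⟩
    · exact h
    · have := (RootPairing.root_add_nsmul_mem_range_iff_le_chainTopCoeff hαβ (n := i)).1 ⟨γ, hγ⟩
      lia
  · rcases hT i with h | ⟨γ, hγ, -, s, hs⟩
    · exact Or.inl h
    · exact Or.inr ⟨γ, hγ, _, hs⟩

/-- The lattice spanned by the root vectors of the `α`-chain through `β`. -/
def chainLattice (α β : ι) : Submodule ℤ (Matrix J J ℤ) :=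
  Submodule.span ℤ {A | ∃ γ, (∃ k : ℤ, P.root γ = P.root β + k • P.root α) ∧ A = V.e γ 1}

variable {V}

omit [Finite ι] in
lemma linearIndependent_chain {α β γ : ι} (hαβ : LinearIndependent ℤ ![P.root α, P.root β]) {k : ℤ}
    (hγ : P.root γ = P.root β + k • P.root α) :
    LinearIndependent ℤ ![P.root α, P.root γ] := by
  rw [LinearIndependent.pair_iff] at hαβ ⊢
  intro x y hxy
  have h1 := hαβ (x + y * k) y (by rw [← hxy, hγ]; module)
  obtain ⟨h1, rfl⟩ := h1
  exact ⟨by simpa using h1, rfl⟩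

/-- Conjugation by `x_α(u)` preserves the lattice of an `α`-chain. -/
lemma conj_mem_chainLattice {α β : ι} (hαβ : LinearIndependent ℤ ![P.root α, P.root β]) (u : ℤ)
    {A : Matrix J J ℤ} (hA : A ∈ V.chainLattice α β) :
    V.rootMatrix α u * A * V.rootMatrix α (-u) ∈ V.chainLattice α β := by
  induction hA using Submodule.span_induction with
  | mem A hA =>
    obtain ⟨γ, ⟨k, hk⟩, rfl⟩ := hA
    obtain ⟨A, h0, had, ⟨N, hN⟩, hA⟩ := V.exists_ad_seq (linearIndependent_chain hαβ hk)
    have h1 := V.rootMatrix_mul_of_ad had hN u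
    have hid : ∀ B : Matrix J J ℤ, B.map (Int.castRingHom ℤ) = B := fun B => by ext; simp
    rw [hid, h0] at h1
    rw [h1, mul_assoc, V.rootMatrix_mul_neg, mul_one]
    refine Submodule.sum_mem _ fun i _ => Submodule.smul_mem _ _ ?_
    rw [hid]
    rcases hA i with h | ⟨δ, hδ, c, hc⟩
    · rw [h]
      exact zero_mem _
    · rw [hc]
      refine Submodule.smul_mem _ _ (Submodule.subset_span ⟨δ, ⟨k + i, ?_⟩, rfl⟩)
      rw [hδ, hk, ← natCast_zsmul]
      module
  | zero => simp
  | add A B _ _ hA hB =>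
    rw [mul_add, add_mul]
    exact add_mem hA hB
  | smul c A _ hA =>
    rw [mul_smul_comm, smul_mul_assoc]
    exact Submodule.smul_mem _ _ hA

lemma chainLattice_neg {α α' β : ι} (h : P.root α' = -P.root α) :
    V.chainLattice α' β = V.chainLattice α β := by
  have : ∀ γ, (∃ k : ℤ, P.root γ = P.root β + k • P.root α') ↔
      ∃ k : ℤ, P.root γ = P.root β + k • P.root α := by
    intro γ
    constructor
    · rintro ⟨k, hk⟩
      exact ⟨-k, by rw [hk, h]; module⟩
    · rintro ⟨k, hk⟩
      exact ⟨-k, by rw [hk, h]; module⟩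
  simp only [chainLattice, this]

omit [Finite ι] in
lemma linearIndependent_neg {α α' β : ι} (h : P.root α' = -P.root α)
    (hαβ : LinearIndependent ℤ ![P.root α, P.root β]) :
    LinearIndependent ℤ ![P.root α', P.root β] := by
  rw [LinearIndependent.pair_iff] at hαβ ⊢
  intro x y hxy
  have h1 := hαβ (-x) y (by rw [← hxy, h]; module)
  simpa using h1

lemma eq_smul_of_mem_chainLattice {α β γ : ι} {A : Matrix J J ℤ} (hA : A ∈ V.chainLattice α β)
    (h : ∀ i j, A i j ≠ 0 → V.wt i = V.wt j + P.root γ) : ∃ c : ℤ, A = c • V.e γ 1 := by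
  have key : ∃ c : ℤ, ∀ i j, V.wt i = V.wt j + P.root γ → A i j = c * V.e γ 1 i j := by
    clear h
    induction hA using Submodule.span_induction with
    | mem A hA =>
      obtain ⟨δ, -, rfl⟩ := hA
      by_cases hδ : δ = γ
      · exact ⟨1, fun i j _ => by rw [hδ, one_mul]⟩
      · refine ⟨0, fun i j hij => ?_⟩
        rw [zero_mul]
        by_contra h0
        have := V.wt_of_e_ne_zero δ i j h0
        rw [hij, add_left_cancel_iff] at this
        exact hδ (P.root.injective this.symm)
    | zero => exact ⟨0, by simp⟩
    | add A B _ _ hA hB =>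
      obtain ⟨c, hc⟩ := hA
      obtain ⟨d, hd⟩ := hB
      exact ⟨c + d, fun i j hij => by rw [Matrix.add_apply, hc i j hij, hd i j hij, add_mul]⟩
    | smul a A _ hA =>
      obtain ⟨c, hc⟩ := hA
      exact ⟨a * c, fun i j hij => by rw [Matrix.smul_apply, hc i j hij, smul_eq_mul, mul_assoc]⟩
  obtain ⟨c, hc⟩ := key
  refine ⟨c, ?_⟩
  ext i j
  rw [Matrix.smul_apply, smul_eq_mul]
  by_cases hij : V.wt i = V.wt j + P.root γ
  · exact hc i j hij
  · have h1 : A i j = 0 := by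
      by_contra h0
      exact hij (h i j h0)
    have h2 : V.e γ 1 i j = 0 := by
      by_contra h0
      exact hij (V.wt_of_e_ne_zero γ i j h0)
    rw [h1, h2, mul_zero]

lemma wt_of_weylInv {α α' : ι} (h : P.root α' = -P.root α) {i j : J}
    (hij : V.weylInv S α α' i j ≠ 0) : V.wt i = P.reflection α (V.wt j) := by
  have h1 := rootMatrix_mul_mul (V := V) h (-1 : Sˣ)
  have h2 : V.weylInv S α α' = Matrix.diagonal (fun j =>
      (((-1 : Sˣ) ^ P.toLinearMap (V.wt j) (P.coroot α) : Sˣ) : S)) * V.weyl S α α' := by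
    rw [← h1, weylInv]
    simp
  rw [h2, Matrix.diagonal_mul] at hij
  exact wt_of_weyl h (right_ne_zero_of_mul hij)

lemma wt_of_weyl_conj {α α' β γ : ι} (h : P.root α' = -P.root α)
    (hγ : P.root γ = P.reflection α (P.root β)) {i j : J}
    (hij : (V.weyl ℤ α α' * V.e β 1 * V.weylInv ℤ α α') i j ≠ 0) :
    V.wt i = V.wt j + P.root γ := by
  rw [Matrix.mul_apply] at hij
  obtain ⟨l, -, hl⟩ := Finset.exists_ne_zero_of_sum_ne_zero hij
  have h1 := left_ne_zero_of_mul hl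
  rw [Matrix.mul_apply] at h1
  obtain ⟨m, -, hm⟩ := Finset.exists_ne_zero_of_sum_ne_zero h1
  rw [wt_of_weyl h (left_ne_zero_of_mul hm), V.wt_of_e_ne_zero β m l (right_ne_zero_of_mul hm),
    wt_of_weylInv h (right_ne_zero_of_mul hl), map_add, P.reflection_same, hγ]

lemma wt_of_weylInv_conj {α α' β γ : ι} (h : P.root α' = -P.root α)
    (hγ : P.root γ = P.reflection α (P.root β)) {i j : J}
    (hij : (V.weylInv ℤ α α' * V.e β 1 * V.weyl ℤ α α') i j ≠ 0) :
    V.wt i = V.wt j + P.root γ := by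
  rw [Matrix.mul_apply] at hij
  obtain ⟨l, -, hl⟩ := Finset.exists_ne_zero_of_sum_ne_zero hij
  have h1 := left_ne_zero_of_mul hl
  rw [Matrix.mul_apply] at h1
  obtain ⟨m, -, hm⟩ := Finset.exists_ne_zero_of_sum_ne_zero h1
  rw [wt_of_weylInv h (left_ne_zero_of_mul hm), V.wt_of_e_ne_zero β m l (right_ne_zero_of_mul hm),
    wt_of_weyl h (right_ne_zero_of_mul hl), map_add, P.reflection_same, hγ]

lemma weyl_conj_mem {α α' β : ι} (h : P.root α' = -P.root α)
    (hαβ : LinearIndependent ℤ ![P.root α, P.root β]) {A : Matrix J J ℤ}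
    (hA : A ∈ V.chainLattice α β) :
    V.weyl ℤ α α' * A * V.weylInv ℤ α α' ∈ V.chainLattice α β ∧
      V.weylInv ℤ α α' * A * V.weyl ℤ α α' ∈ V.chainLattice α β := by
  have h1 : ∀ u : ℤ, ∀ A ∈ V.chainLattice α β,
      V.rootMatrix α' u * A * V.rootMatrix α' (-u) ∈ V.chainLattice α β := by
    intro u A hA
    rw [← chainLattice_neg h] at hA ⊢
    exact conj_mem_chainLattice (linearIndependent_neg h hαβ) u hA
  constructor
  · have := conj_mem_chainLattice hαβ 1 (h1 (-1) _ (conj_mem_chainLattice hαβ 1 hA))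
    simp only [neg_neg] at this
    convert! this using 1
    simp only [weyl, weylInv, mul_assoc]
  · have := conj_mem_chainLattice hαβ (-1) (h1 1 _ (conj_mem_chainLattice hαβ (-1) hA))
    simp only [neg_neg] at this
    convert! this using 1
    simp only [weyl, weylInv, mul_assoc]

/-- `n_α e_β n_α⁻¹ = ± e_{s_α β}`: the coefficient and its inverse are integers, since conjugation
by `n_α` preserves the lattice of the `α`-chain through `β`. -/
lemma exists_weyl_mul_e [P.IsReduced] {α α' β γ : ι} (h : P.root α' = -P.root α)
    (hγ : P.root γ = P.reflection α (P.root β)) :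
    ∃ c : ℤ, (c = 1 ∨ c = -1) ∧ V.weyl ℤ α α' * V.e β 1 = c • V.e γ 1 * V.weyl ℤ α α' := by
  by_cases h1 : β = α
  · have : γ = α' := P.root.injective (by rw [hγ, h1, P.reflection_apply_self, h])
    exact ⟨-1, Or.inr rfl, by rw [this, h1, weyl_mul_e h, neg_one_zsmul]⟩
  by_cases h2 : P.root β = -P.root α
  · have h3 : β = α' := P.root.injective (by rw [h2, h])
    have : γ = α := P.root.injective (by rw [hγ, h2, map_neg, P.reflection_apply_self, neg_neg])
    exact ⟨-1, Or.inr rfl, by rw [this, h3, weyl_mul_e_neg h, neg_one_zsmul]⟩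
  have hαβ : LinearIndependent ℤ ![P.root α, P.root β] :=
    RootPairing.IsReduced.linearIndependent P (Ne.symm h1) fun h3 => h2 (by rw [h3, neg_neg])
  have hγβ : P.root γ = P.root β + (-P.toLinearMap (P.root β) (P.coroot α)) • P.root α := by
    rw [hγ, P.reflection_apply, neg_smul, ← sub_eq_add_neg]
    rfl
  have hβγ : P.root β = P.reflection α (P.root γ) := by rw [hγ, P.reflection_same]
  have hm1 : V.e β 1 ∈ V.chainLattice α β := Submodule.subset_span ⟨β, ⟨0, by simp⟩, rfl⟩
  have hm2 : V.e γ 1 ∈ V.chainLattice α β := Submodule.subset_span ⟨γ, ⟨_, hγβ⟩, rfl⟩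
  obtain ⟨c, hc⟩ := eq_smul_of_mem_chainLattice (weyl_conj_mem h hαβ hm1).1
    fun i j => wt_of_weyl_conj h hγ
  obtain ⟨d, hd⟩ := eq_smul_of_mem_chainLattice (weyl_conj_mem h hαβ hm2).2
    fun i j => wt_of_weylInv_conj h hβγ
  have e1 : V.weyl ℤ α α' * V.e β 1 = c • V.e γ 1 * V.weyl ℤ α α' := by
    rw [← hc, mul_assoc, V.weylInv_mul_weyl, mul_one]
  have e2 : (d * c) • V.e β 1 = V.e β 1 := by
    rw [mul_comm, mul_smul, ← hd, ← smul_mul_assoc, ← mul_smul_comm, mul_assoc, ← e1, ← mul_assoc,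
      V.weylInv_mul_weyl, one_mul]
  have e3 : d * c = 1 := by
    by_contra hne
    refine V.e_ne_zero β ?_
    ext i j
    have := congrFun (congrFun e2 i) j
    rw [Matrix.smul_apply, smul_eq_mul] at this
    have h3 : (d * c - 1) * V.e β 1 i j = 0 := by linear_combination this
    exact (mul_eq_zero.1 h3).resolve_left (sub_ne_zero.2 hne)
  exact ⟨c, Int.isUnit_iff.1 (IsUnit.of_mul_eq_one_right _ e3), e1⟩

/-- `n_α x_β(u) n_α⁻¹ = x_{s_α β}(± u)`, where the sign for `-β` is the same as that for `β`. -/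
lemma exists_weyl_mul_rootMatrix [P.IsReduced] (V : ChevalleyLattice P J) {α α' β β' γ γ' : ι}
    (h : P.root α' = -P.root α) (hβ : P.root β' = -P.root β)
    (hγ : P.root γ = P.reflection α (P.root β)) (hγ' : P.root γ' = -P.root γ) :
    ∃ c : ℤ, (c = 1 ∨ c = -1) ∧ ∀ (S : Type*) [CommRing S] (u : S),
      V.weyl S α α' * V.rootMatrix β u = V.rootMatrix γ (c * u) * V.weyl S α α' ∧
      V.weyl S α α' * V.rootMatrix β' u = V.rootMatrix γ' (c * u) * V.weyl S α α' := by
  have hγ'β : P.root γ' = P.reflection α (P.root β') := by rw [hγ', hγ, hβ, map_neg]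
  obtain ⟨c, hc, e1⟩ := exists_weyl_mul_e (V := V) h hγ
  obtain ⟨d, hd, e2⟩ := exists_weyl_mul_e (V := V) h hγ'β
  set n := V.weyl ℤ α α'
  have hH : n * V.cartan β = V.cartan γ * n := by
    ext i j
    rw [cartan, cartan, Matrix.mul_diagonal, Matrix.diagonal_mul, mul_comm]
    by_cases hij : n i j = 0
    · simp [hij]
    congr 1
    have h1 : γ = P.reflectionPerm α β := P.root.injective (by simp [hγ])
    rw [wt_of_weyl h hij, h1, P.coroot_reflectionPerm, P.reflection_apply, P.coreflection_apply]
    simp [P.root_coroot_two]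
    ring
  have hcd : c * d = 1 := by
    have e3 : n * V.cartan β = (c * d) • (V.cartan γ * n) := by
      have hβ' := V.lie_neg β β' hβ
      have hγ'' := V.lie_neg γ γ' hγ'
      change _ = V.cartan β at hβ'
      change _ = V.cartan γ at hγ''
      rw [← hβ', ← hγ'', mul_sub, ← mul_assoc, ← mul_assoc, e1, e2, mul_assoc, e2, mul_assoc, e1,
        ← mul_assoc, ← mul_assoc, smul_mul_smul_comm, smul_mul_smul_comm, mul_comm d c, ← sub_mul,
        ← smul_sub, smul_mul_assoc]
    rw [hH] at e3
    by_contra hne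
    refine V.cartan_ne_zero γ ?_
    have h0 : V.cartan γ * n = 0 := by
      ext i j
      have := congrFun (congrFun e3 i) j
      rw [Matrix.smul_apply, smul_eq_mul] at this
      have h3 : (c * d - 1) * (V.cartan γ * n) i j = 0 := by linear_combination -this
      exact (mul_eq_zero.1 h3).resolve_left (sub_ne_zero.2 hne)
    rw [← mul_one (V.cartan γ), ← V.weyl_mul_weylInv α α', ← mul_assoc, h0, zero_mul]
  have hcd' : d = c := by
    rcases hc with rfl | rfl <;> lia
  subst hcd'
  have key : ∀ (δ ε : ι), n * V.e δ 1 = d • V.e ε 1 * n → ∀ (S : Type _) [CommRing S] (u : S),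
      V.weyl S α α' * V.rootMatrix δ u = V.rootMatrix ε (d * u) * V.weyl S α α' := by
    intro δ ε h1 S _ u
    have h2 : ∀ k, n * V.e δ k = d ^ k • V.e ε k * n := by
      intro k
      refine matrix_nsmul_cancel k.factorial_ne_zero ?_
      rw [← mul_smul_comm, V.factorial_smul_e, ← smul_mul_assoc, smul_comm, V.factorial_smul_e,
        ← smul_pow]
      clear e1 e2 hH
      induction k with
      | zero => simp
      | succ k ih => rw [pow_succ, ← mul_assoc, ih, mul_assoc, h1, ← mul_assoc, ← pow_succ]
    rw [rootMatrix, rootMatrix, Finset.mul_sum, Finset.sum_mul]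
    refine Finset.sum_congr rfl fun k _ => ?_
    rw [mul_smul_comm, ← weyl_map, ← map_mul_int, h2, map_mul_int, map_zsmul_int, mul_pow,
      ← Int.cast_pow, mul_comm, mul_smul, Int.cast_smul_eq_zsmul, smul_mul_assoc,
      smul_mul_assoc, smul_mul_assoc]
  exact ⟨d, hc, fun S _ u => ⟨key β γ e1 S u, key β' γ' e2 S u⟩⟩

end ChevalleyLattice

namespace ChevalleyLattice

variable {ι X Y : Type*} [Finite ι] [AddCommGroup X] [AddCommGroup Y] {P : RootDatum ι X Y}
  {J : Type*} [Fintype J] [DecidableEq J] (V : ChevalleyLattice P J)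
  {S : Type*} [CommRing S]

/-! ### The height function on weights -/

open Classical in
/-- The linear functional on the character lattice given by the sum of the positive coroots. On
roots it is twice the height. -/
noncomputable def ht (b : P.Base) : X →ₗ[ℤ] ℤ :=
  haveI := Fintype.ofFinite ι
  ∑ γ with b.IsPos γ, P.toLinearMap.flip (P.coroot γ)

lemma ht_apply_simple [P.IsReduced] (b : P.Base) {α : ι} (hα : α ∈ b.support) :
    ht b (P.root α) = 2 := by
  classical
  let _ := Fintype.ofFinite ι
  have h1 : ht b (P.root α) = ∑ γ with b.IsPos γ, P.pairing α γ := by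
    rw [ht, LinearMap.sum_apply]
    refine Finset.sum_congr (by congr) fun γ _ => ?_
    rw [LinearMap.flip_apply, P.root_coroot_eq_pairing]
  have hpos := b.isPos_of_mem_support hα
  rw [h1, ← Finset.add_sum_erase _ _ (Finset.mem_filter.2 ⟨Finset.mem_univ α, hpos⟩),
    P.pairing_same, add_eq_left]
  set s := (Finset.univ.filter fun γ => b.IsPos γ).erase α
  have hs : ∀ γ ∈ s, P.reflectionPerm α γ ∈ s := by
    intro γ hγ
    obtain ⟨h2, h3⟩ := Finset.mem_erase.1 hγ
    have h3 := (Finset.mem_filter.1 h3).2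
    refine Finset.mem_erase.2 ⟨fun h4 => ?_, Finset.mem_filter.2 ⟨Finset.mem_univ _,
      h3.reflectionPerm hα h2⟩⟩
    have h5 : P.root γ = -P.root α := by
      rw [← P.reflection_apply_self, ← P.reflection_same α (P.root γ), ← P.root_reflectionPerm, h4]
    rw [b.isPos_iff] at h3
    have h6 : P.root γ = P.root α + (-2 : ℤ) • P.root α := by rw [h5]; module
    have := b.height_add_zsmul h6
    rw [RootPairing.Base.height_one_of_mem_support hα] at this
    norm_num at this
    lia
  have h2 : ∑ γ ∈ s, P.pairing α γ = ∑ γ ∈ s, -P.pairing α γ := by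
    refine Finset.sum_nbij' (P.reflectionPerm α) (P.reflectionPerm α) hs hs ?_ ?_ ?_
    · simp
    · simp
    · intro γ _
      rw [P.pairing_reflectionPerm, P.pairing_reflectionPerm_self_left, neg_neg]
  rw [Finset.sum_neg_distrib] at h2
  lia

lemma ht_root [P.IsReduced] (b : P.Base) (γ : ι) : ht b (P.root γ) = 2 * b.height γ := by
  obtain ⟨f, -, -, hf⟩ := b.exists_root_eq_sum_int γ
  rw [RootPairing.Base.height_eq_sum hf, hf, map_sum, Finset.mul_sum]
  refine Finset.sum_congr rfl fun j hj => ?_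
  rw [map_zsmul, ht_apply_simple b hj, smul_eq_mul, mul_comm]

lemma isPos_iff_ht [P.IsReduced] (b : P.Base) (γ : ι) : b.IsPos γ ↔ 0 < ht b (P.root γ) := by
  rw [ht_root, b.isPos_iff]
  lia

lemma ht_ne_zero [P.IsReduced] (b : P.Base) (γ : ι) : ht b (P.root γ) ≠ 0 := by
  rw [ht_root]
  have := b.height_ne_zero γ
  lia

/-! ### The commutator relations -/

/-- The entrywise derivative of a matrix of polynomials. -/
noncomputable def deriv (f : Matrix J J (Polynomial ℚ)) : Matrix J J (Polynomial ℚ) :=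
  f.map Polynomial.derivative

omit [DecidableEq J] in
lemma deriv_mul (f g : Matrix J J (Polynomial ℚ)) :
    deriv (f * g) = deriv f * g + f * deriv g := by
  ext1 i j
  simp [deriv, Matrix.mul_apply, Finset.sum_add_distrib]

/-- The root vector `e_α` as a matrix over a commutative ring. -/
def eMap (S : Type*) [CommRing S] (α : ι) : Matrix J J S := (V.e α 1).map (Int.castRingHom S)

lemma deriv_rootMatrix (α : ι) (p : Polynomial ℚ) :
    deriv (V.rootMatrix α p) =
      Polynomial.derivative p • (V.eMap (Polynomial ℚ) α * V.rootMatrix α p) := by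
  have h1 : deriv (V.rootMatrix α p) = ∑ n ∈ Finset.range (Fintype.card J + 1),
      Polynomial.derivative (p ^ n) • (V.e α n).map (Int.castRingHom (Polynomial ℚ)) := by
    rw [V.rootMatrix_eq_sum α p (N := Fintype.card J + 1) (by lia)]
    ext1 i j
    simp [deriv, Matrix.sum_apply]
  rw [h1, Finset.sum_range_succ', rootMatrix, Finset.mul_sum, Finset.smul_sum]
  simp only [pow_zero, Polynomial.derivative_one, zero_smul, add_zero]
  refine Finset.sum_congr rfl fun n _ => ?_
  rw [Polynomial.derivative_pow_succ, mul_smul_comm, eMap, ← map_mul_int, ← succ_smul_e,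
    map_nsmul_int, ← Nat.cast_smul_eq_nsmul (Polynomial ℚ), smul_smul, smul_smul]
  congr 1
  simp
  ring

lemma rootMatrix_mul_eMap (α : ι) (u : S) :
    V.rootMatrix α u * V.eMap S α = V.eMap S α * V.rootMatrix α u := by
  let A : ℕ → Matrix J J ℤ := fun n => match n with
    | 0 => V.e α 1
    | _ => 0
  have hA : ∀ i, V.e α 1 * A i - A i * V.e α 1 = (i + 1) • A (i + 1) := by
    rintro (_ | i) <;> simp [A]
  have := V.rootMatrix_mul_of_ad hA (N := 1) (by rintro (_ | i) h <;> simp_all [A]) u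
  simpa [A, eMap] using this

lemma exists_antiderivative (z : Polynomial ℚ) :
    ∃ p : Polynomial ℚ, Polynomial.derivative p = z ∧ p.eval 0 = 0 := by
  induction z using Polynomial.induction_on' with
  | add p q hp hq =>
    obtain ⟨p', h1, h2⟩ := hp
    obtain ⟨q', h3, h4⟩ := hq
    exact ⟨p' + q', by simp [h1, h3], by simp [h2, h4]⟩
  | monomial n a =>
    refine ⟨Polynomial.monomial (n + 1) (a / (n + 1)), ?_, by simp⟩
    rw [Polynomial.derivative_monomial]
    congr 1
    push_cast
    field_simp

/-- The ordered product of root matrices. -/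
def rootProd (m : List (ι × S)) : Matrix J J S := (m.map fun x => V.rootMatrix x.1 x.2).prod

lemma rootProd_map {S' : Type*} [CommRing S'] (f : S →+* S') (m : List (ι × S)) :
    (V.rootProd m).map f = V.rootProd (m.map fun x => (x.1, f x.2)) := by
  induction m with
  | nil => simp [rootProd]
  | cons x m ih =>
    simp only [rootProd, List.map_cons, List.prod_cons] at ih ⊢
    rw [Matrix.map_mul, ih, rootMatrix_map]

/-- The span of the root vectors of the roots in a list. -/
def eSpan (S : Type*) [CommRing S] (l : List ι) : Submodule S (Matrix J J S) :=
  Submodule.span S {A | ∃ γ ∈ l, A = V.eMap S γ}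

/-- A list of roots such that every subsequent root stays in the rest of the list under addition of
multiples of the earlier ones. -/
def IsNilpotentList (P : RootDatum ι X Y) : List ι → Prop
  | [] => True
  | γ :: t => (∀ δ ∈ t, LinearIndependent ℤ ![P.root γ, P.root δ] ∧
      ∀ ε, ∀ i : ℕ, P.root ε = P.root δ + i • P.root γ → ε ∈ t) ∧ IsNilpotentList P t

lemma conj_eMap_mem {γ δ : ι} (h : LinearIndependent ℤ ![P.root γ, P.root δ]) {t : List ι}
    (ht : ∀ ε, ∀ i : ℕ, P.root ε = P.root δ + i • P.root γ → ε ∈ t) (u : S) :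
    V.rootMatrix γ u * V.eMap S δ * V.rootMatrix γ (-u) ∈ V.eSpan S t := by
  obtain ⟨A, h0, had, ⟨N, hN⟩, hA⟩ := V.exists_ad_seq h
  have h1 := V.rootMatrix_mul_of_ad had hN u
  rw [h0] at h1
  rw [eMap, h1, mul_assoc, V.rootMatrix_mul_neg, mul_one]
  refine Submodule.sum_mem _ fun i _ => Submodule.smul_mem _ _ ?_
  rcases hA i with h | ⟨ε, hε, c, hc⟩
  · rw [h, Matrix.map_zero _ (map_zero _)]
    exact zero_mem _
  · rw [hc, map_zsmul_int, ← Int.cast_smul_eq_zsmul S]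
    exact Submodule.smul_mem _ _ (Submodule.subset_span ⟨ε, ht ε i hε, rfl⟩)

/-- A solution of the differential equation `f' = Z f` with `f(0) = 1` is an ordered product of
root group elements if `Z` is in the span of the root vectors of a suitable list of roots. -/
lemma exists_eq_rootProd (l : List ι) (hl : IsNilpotentList P l) (f Z : Matrix J J (Polynomial ℚ))
    (hZ : Z ∈ V.eSpan (Polynomial ℚ) l) (hD : deriv f = Z * f)
    (h0 : f.map (Polynomial.evalRingHom 0) = 1) :
    ∃ m : List (ι × Polynomial ℚ), m.map Prod.fst = l ∧ f = V.rootProd m := by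
  induction l generalizing f Z with
  | nil =>
    refine ⟨[], rfl, ?_⟩
    have hZ0 : Z = 0 := by simpa [eSpan] using hZ
    rw [hZ0, zero_mul] at hD
    ext1 i j
    have h1 : Polynomial.derivative (f i j) = 0 := congrFun (congrFun hD i) j
    have h2 : (f i j).eval 0 = (1 : Matrix J J ℚ) i j := congrFun (congrFun h0 i) j
    rw [Polynomial.eq_C_of_derivative_eq_zero h1] at h2 ⊢
    rw [Polynomial.eval_C] at h2
    rw [h2]
    by_cases hij : i = j
    · subst hij
      simp [rootProd]
    · simp [rootProd, hij]
  | cons γ t ih =>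
    obtain ⟨hγ, ht⟩ := hl
    have hset : {A | ∃ δ ∈ γ :: t, A = V.eMap (Polynomial ℚ) δ} =
        insert (V.eMap (Polynomial ℚ) γ) {A | ∃ δ ∈ t, A = V.eMap (Polynomial ℚ) δ} := by
      ext A
      simp
    rw [eSpan, hset, Submodule.mem_span_insert] at hZ
    obtain ⟨z, Z', hZ', rfl⟩ := hZ
    obtain ⟨p, hp, hp0⟩ := exists_antiderivative z
    set x := V.rootMatrix γ p
    set y := V.rootMatrix γ (-p) with hy
    have hxy : x * y = 1 := V.rootMatrix_mul_neg γ p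
    have hconj : y * Z' * x ∈ V.eSpan (Polynomial ℚ) t := by
      clear hD
      induction hZ' using Submodule.span_induction with
      | mem A hA =>
        obtain ⟨δ, hδ, rfl⟩ := hA
        simpa [x] using V.conj_eMap_mem (hγ δ hδ).1 (hγ δ hδ).2 (-p)
      | zero => simp
      | add A B _ _ hA hB =>
        rw [mul_add, add_mul]
        exact add_mem hA hB
      | smul c A _ hA =>
        rw [mul_smul_comm, smul_mul_assoc]
        exact Submodule.smul_mem _ _ hA
    obtain ⟨m, hm, hm'⟩ := ih ht (y * f) (y * Z' * x) hconj (by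
      have hcomm : y * V.eMap (Polynomial ℚ) γ = V.eMap (Polynomial ℚ) γ * y :=
        V.rootMatrix_mul_eMap γ (-p)
      rw [deriv_mul, hD, hy, deriv_rootMatrix, ← hy, map_neg, hp, mul_assoc (y * Z'),
        ← mul_assoc x, hxy, one_mul, add_mul, mul_add, smul_mul_assoc, smul_mul_assoc,
        mul_smul_comm, ← mul_assoc y, hcomm, neg_smul, mul_assoc y Z' f, neg_add_cancel_left])
      (by
        have : y.map (Polynomial.evalRingHom (0 : ℚ)) = 1 := by
          rw [hy, rootMatrix_map]
          simp [hp0, rootMatrix_zero]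
        rw [Matrix.map_mul, h0, this, one_mul])
    refine ⟨(γ, p) :: m, by simp [hm], ?_⟩
    simp only [rootProd, List.map_cons, List.prod_cons] at hm' ⊢
    rw [← hm', ← mul_assoc, hxy, one_mul]

/-- In a product of root group elements of height at least `h`, the entries of height at most `h`
are those of the sum of the root vectors. -/
lemma rootProd_apply_of_ht_le [P.IsReduced] (b : P.Base) {h : ℤ} (hh : 0 < h) (m : List (ι × ℚ))
    (hm : ∀ x ∈ m, h ≤ ht b (P.root x.1)) {i j : J} (hij : ht b (V.wt i - V.wt j) ≤ h) :
    V.rootProd m i j = (1 : Matrix J J ℚ) i j + (m.map fun x : ι × ℚ => x.2 * V.e x.1 1 i j).sum := by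
  induction m generalizing i j with
  | nil => simp [rootProd]
  | cons x m ih =>
    obtain ⟨γ, c⟩ := x
    have hγ : h ≤ ht b (P.root γ) := hm (γ, c) (by simp)
    have hm' : ∀ x ∈ m, h ≤ ht b (P.root x.1) := fun x hx => hm x (by simp [hx])
    have ih' := fun {i j} => ih hm' (i := i) (j := j)
    have hsupp : ∀ i j, ht b (V.wt i - V.wt j) < h → i ≠ j → V.rootProd m i j = 0 := by
      intro i j hlt hne
      rw [ih' hlt.le, Matrix.one_apply_ne hne, zero_add]
      refine List.sum_eq_zero fun y hy => ?_
      obtain ⟨x, hx, rfl⟩ := List.mem_map.1 hy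
      by_cases h0 : V.e x.1 1 i j = 0
      · simp [h0]
      · rw [V.wt_of_e_ne_zero x.1 i j h0, add_sub_cancel_left] at hlt
        exact absurd (hm' x hx) (not_le.2 hlt)
    have hone : ∀ i, V.rootProd m i i = 1 := by
      intro i
      rw [ih' (by simpa using hh.le), Matrix.one_apply_eq, List.sum_eq_zero, add_zero]
      intro y hy
      obtain ⟨x, hx, rfl⟩ := List.mem_map.1 hy
      by_cases h0 : V.e x.1 1 i i = 0
      · simp [h0]
      · have := V.wt_of_e_ne_zero x.1 i i h0
        rw [left_eq_add] at this
        exact absurd this (P.ne_zero _)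
    have hexp : ∀ i l, V.rootMatrix γ c i l = (1 : Matrix J J ℚ) i l + c * V.e γ 1 i l ∨
        h < ht b (V.wt i - V.wt l) := by
      intro i l
      by_cases hlt : h < ht b (V.wt i - V.wt l)
      · exact Or.inr hlt
      refine Or.inl ?_
      rw [V.rootMatrix_eq_sum γ c (N := Fintype.card J + 2) (by lia), Finset.sum_range_succ',
        Finset.sum_range_succ', Matrix.add_apply, Matrix.add_apply, Matrix.sum_apply,
        Finset.sum_eq_zero]
      · rcases eq_or_ne i l with rfl | hil
        · simp [V.e_zero, add_comm]
        · simp [V.e_zero, hil]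
      · intro n _
        by_cases h0 : V.e γ (n + 1 + 1) i l = 0
        · simp [h0]
        · exfalso
          rw [V.wt_of_e h0, add_sub_cancel_left, map_nsmul] at hlt
          apply hlt
          have : (n + 1 + 1) • ht b (P.root γ) = ht b (P.root γ) + (n + 1) • ht b (P.root γ) := by
            rw [succ_nsmul']
          rw [this]
          have : 0 < (n + 1) • ht b (P.root γ) := nsmul_pos (by lia) (by lia)
          lia
    have hlow : ∀ i l, V.rootMatrix γ c i l ≠ 0 → i ≠ l → h ≤ ht b (V.wt i - V.wt l) := by
      intro i l h0 hne
      rcases hexp i l with h1 | h1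
      · rw [h1, Matrix.one_apply_ne hne, zero_add] at h0
        have h2 : V.e γ 1 i l ≠ 0 := fun h3 => h0 (by simp [h3])
        rwa [V.wt_of_e_ne_zero γ i l h2, add_sub_cancel_left]
      · exact h1.le
    have hprod : V.rootProd ((γ, c) :: m) = V.rootMatrix γ c * V.rootProd m := by
      simp [rootProd]
    rw [hprod, Matrix.mul_apply, List.map_cons, List.sum_cons]
    by_cases hne : i = j
    · subst hne
      rw [Finset.sum_eq_single_of_mem i (Finset.mem_univ _)]
      · rw [rootMatrix_apply_of_wt_eq _ _ rfl, Matrix.one_apply_eq, one_mul, ih' hij,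
          Matrix.one_apply_eq]
        have : V.e γ 1 i i = 0 := by
          by_contra h0
          have := V.wt_of_e_ne_zero γ i i h0
          rw [left_eq_add] at this
          exact absurd this (P.ne_zero _)
        simp [this]
      · intro l _ hl
        by_contra h0
        have h1 := hlow i l (left_ne_zero_of_mul h0) (Ne.symm hl)
        have h2 : ¬ ht b (V.wt l - V.wt i) < h := fun h3 =>
          right_ne_zero_of_mul h0 (hsupp l i h3 hl)
        rw [map_sub] at h1 h2
        lia
    · rw [← Finset.add_sum_erase _ _ (Finset.mem_univ i), ← Finset.add_sum_erase _ _
        (Finset.mem_erase.2 ⟨Ne.symm hne, Finset.mem_univ j⟩), Finset.sum_eq_zero, hone,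
        rootMatrix_apply_of_wt_eq _ _ rfl, Matrix.one_apply_eq, ih' hij, Matrix.one_apply_ne hne]
      · rcases hexp i j with h1 | h1
        · rw [h1, Matrix.one_apply_ne hne]
          ring
        · lia
      · intro l hl
        have hlj := (Finset.mem_erase.1 hl).1
        have hli := (Finset.mem_erase.1 (Finset.mem_erase.1 hl).2).1
        by_contra h0
        have h1 := hlow i l (left_ne_zero_of_mul h0) (Ne.symm hli)
        have h2 : ¬ ht b (V.wt l - V.wt j) < h := fun h3 =>
          right_ne_zero_of_mul h0 (hsupp l j h3 hlj)
        rw [map_sub] at h1 h2 hij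
        lia

/-- A rational multiple of a root vector is integral only if the coefficient is an integer. -/
lemma exists_int_of_smul_e (γ : ι) (c : ℚ) (h : ∀ i j, ∃ z : ℤ, c * V.e γ 1 i j = z) :
    ∃ z : ℤ, c = z := by
  by_contra hc
  have hden : c.den ≠ 1 := fun h1 => hc ⟨c.num, ((Rat.den_eq_one_iff c).1 h1).symm⟩
  obtain ⟨p, hp, hpd⟩ := Nat.exists_prime_and_dvd hden
  obtain ⟨i, j, hij⟩ := V.e_primitive γ hp
  obtain ⟨z, hz⟩ := h i j
  have h1 : c.num * V.e γ 1 i j = z * c.den := by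
    have h2 : (c.den : ℚ) ≠ 0 := by exact_mod_cast c.den_ne_zero
    have h3 : (c.num : ℚ) = c * c.den := (Rat.mul_den_eq_num c).symm
    have : (c.num : ℚ) * V.e γ 1 i j = z * c.den := by
      rw [h3, ← hz]
      ring
    exact_mod_cast this
  have h2 : (p : ℤ) ∣ c.num * V.e γ 1 i j := by
    rw [h1]
    exact Dvd.dvd.mul_left (by exact_mod_cast hpd) _
  rcases (Nat.prime_iff_prime_int.1 hp).dvd_or_dvd h2 with h3 | h3
  · have h4 : p ∣ c.num.natAbs := Int.natCast_dvd.1 h3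
    have := Nat.Coprime.eq_one_of_dvd (Nat.Coprime.coprime_dvd_left h4 c.reduced) hpd
    exact hp.one_lt.ne' this
  · exact hij h3

/-- An integral ordered product of rational root group elements has integral coordinates. -/
lemma exists_int_rootProd [P.IsReduced] (b : P.Base) (m : List (ι × ℚ))
    (hpos : ∀ x ∈ m, b.IsPos x.1) (hnd : (m.map Prod.fst).Nodup)
    (hs : (m.map Prod.fst).Pairwise fun γ δ => b.height γ ≤ b.height δ)
    (hint : ∀ i j, ∃ z : ℤ, V.rootProd m i j = z) :
    ∃ m' : List (ι × ℤ), m = m'.map fun x => (x.1, (x.2 : ℚ)) := by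
  induction m with
  | nil => exact ⟨[], rfl⟩
  | cons x m ih =>
    obtain ⟨γ, c⟩ := x
    have hγ : 0 < ht b (P.root γ) := (isPos_iff_ht b γ).1 (hpos (γ, c) (by simp))
    rw [List.map_cons, List.nodup_cons] at hnd
    rw [List.map_cons, List.pairwise_cons] at hs
    have hc : ∃ z : ℤ, c = z := by
      refine V.exists_int_of_smul_e γ c fun i j => ?_
      by_cases h0 : V.e γ 1 i j = 0
      · exact ⟨0, by simp [h0]⟩
      have hwt := V.wt_of_e_ne_zero γ i j h0
      obtain ⟨z, hz⟩ := hint i j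
      refine ⟨z, ?_⟩
      rw [V.rootProd_apply_of_ht_le b hγ, Matrix.one_apply_ne, List.map_cons, List.sum_cons,
        List.sum_eq_zero (l := m.map _), add_zero, zero_add] at hz
      · exact hz
      · intro y hy
        obtain ⟨x, hx, rfl⟩ := List.mem_map.1 hy
        have : V.e x.1 1 i j = 0 := by
          by_contra h1
          have h2 := V.wt_of_e_ne_zero x.1 i j h1
          rw [hwt, add_left_cancel_iff] at h2
          exact hnd.1 (List.mem_map.2 ⟨x, hx, (P.root.injective h2).symm⟩)
        simp [this]
      · rintro rfl
        rw [left_eq_add] at hwt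
        exact P.ne_zero _ hwt
      · intro x hx
        rcases List.mem_cons.1 hx with rfl | hx
        · exact le_rfl
        · rw [ht_root, ht_root]
          have := hs.1 x.1 (List.mem_map_of_mem hx)
          lia
      · rw [hwt, add_sub_cancel_left]
    obtain ⟨c, rfl⟩ := hc
    obtain ⟨m', hm'⟩ := ih (fun x hx => hpos x (by simp [hx])) hnd.2 hs.2 fun i j => by
      choose B hB using hint
      refine ⟨(V.rootMatrix γ (-c) * Matrix.of B) i j, ?_⟩
      have h1 : V.rootProd m = V.rootMatrix γ (-(c : ℚ)) * V.rootProd ((γ, (c : ℚ)) :: m) := by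
        simp only [rootProd, List.map_cons, List.prod_cons]
        rw [← mul_assoc, V.rootMatrix_neg_mul, one_mul]
      have h2 : V.rootProd ((γ, (c : ℚ)) :: m) = (Matrix.of B).map (Int.castRingHom ℚ) := by
        ext i j
        simpa using hB i j
      have h3 : V.rootMatrix γ (-(c : ℚ)) = (V.rootMatrix γ (-c)).map (Int.castRingHom ℚ) := by
        rw [rootMatrix_map]
        simp
      rw [h1, h2, h3, ← map_mul_int]
      rfl
    exact ⟨(γ, c) :: m', by simp [hm']⟩

/-- The roots `i α + j β` with `i ≥ 0` and `j ≥ 1`, in order of increasing height. -/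
lemma exists_list_cone [P.IsReduced] (b : P.Base) {α β : ι} (hα : b.IsPos α) (hβ : b.IsPos β) :
    ∃ l : List ι, (∀ γ, γ ∈ l ↔ ∃ i j : ℕ, 1 ≤ j ∧ P.root γ = i • P.root α + j • P.root β) ∧
      l.Nodup ∧ (l.Pairwise fun γ δ => b.height γ ≤ b.height δ) ∧ (∀ γ ∈ l, b.IsPos γ) ∧
      IsNilpotentList P l := by
  classical
  have := Fintype.ofFinite ι
  let s : Finset ι := Finset.univ.filter fun γ =>
    ∃ i j : ℕ, 1 ≤ j ∧ P.root γ = i • P.root α + j • P.root β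
  let l := s.toList.insertionSort fun γ δ => b.height γ ≤ b.height δ
  have hperm : l.Perm s.toList := List.perm_insertionSort _ _
  have hmem : ∀ γ, γ ∈ l ↔ ∃ i j : ℕ, 1 ≤ j ∧ P.root γ = i • P.root α + j • P.root β := by
    intro γ
    rw [hperm.mem_iff]
    simp [s]
  have hnd : l.Nodup := hperm.nodup_iff.2 s.nodup_toList
  have hsort : l.Pairwise fun γ δ => b.height γ ≤ b.height δ := by
    have : Std.Total fun γ δ : ι => b.height γ ≤ b.height δ := ⟨fun γ δ => le_total _ _⟩
    have : IsTrans ι fun γ δ : ι => b.height γ ≤ b.height δ := ⟨fun γ δ ε => le_trans⟩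
    exact List.pairwise_insertionSort _ _
  have hpos : ∀ γ ∈ l, b.IsPos γ := by
    intro γ hγ
    obtain ⟨i, j, hj, h⟩ := (hmem γ).1 hγ
    rw [isPos_iff_ht] at hα hβ ⊢
    rw [h, map_add, map_nsmul, map_nsmul, nsmul_eq_mul, nsmul_eq_mul]
    have : (0 : ℤ) < j * ht b (P.root β) := by positivity
    have : (0 : ℤ) ≤ i * ht b (P.root α) := by positivity
    lia
  refine ⟨l, hmem, hnd, hsort, hpos, ?_⟩
  have hclosed : ∀ γ ∈ l, ∀ δ ∈ l, ∀ ε, ∀ i : ℕ, P.root ε = P.root δ + i • P.root γ → ε ∈ l := by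
    intro γ hγ δ hδ ε i hε
    obtain ⟨a, c, hc, h⟩ := (hmem γ).1 hγ
    obtain ⟨a', c', hc', h'⟩ := (hmem δ).1 hδ
    refine (hmem ε).2 ⟨a' + i * a, c' + i * c, by lia, ?_⟩
    rw [hε, h, h']
    module
  have hind : ∀ γ ∈ l, ∀ δ ∈ l, γ ≠ δ → LinearIndependent ℤ ![P.root γ, P.root δ] := by
    intro γ hγ δ hδ hne
    refine RootPairing.IsReduced.linearIndependent P hne fun h => ?_
    have h1 := (isPos_iff_ht b γ).1 (hpos γ hγ)
    have h2 := (isPos_iff_ht b δ).1 (hpos δ hδ)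
    rw [h, map_neg] at h1
    lia
  clear_value l
  clear hmem hperm
  induction l with
  | nil => trivial
  | cons γ t ih =>
    rw [List.nodup_cons] at hnd
    rw [List.pairwise_cons] at hsort
    have hht : ∀ δ ε : ι, δ ∈ t → ∀ η : ι, η ∈ γ :: t → ∀ i : ℕ, 1 ≤ i →
        P.root ε = P.root δ + i • P.root η → b.height γ < b.height ε := by
      intro δ ε hδ η hη i hi h
      have h1 := b.height_add_zsmul (z := i) (by rwa [natCast_zsmul])
      have h2 := hpos η hη
      rw [b.isPos_iff] at h2
      have h3 := hsort.1 δ hδ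
      rw [h1, smul_eq_mul]
      have : (0 : ℤ) < i * b.height η := by positivity
      lia
    refine ⟨fun δ hδ => ⟨hind γ (by simp) δ (by simp [hδ]) fun h => hnd.1 (h ▸ hδ),
      fun ε i hε => ?_⟩, ih hnd.2 hsort.2 (fun δ hδ => hpos δ (by simp [hδ])) ?_ ?_⟩
    · rcases Nat.eq_zero_or_pos i with rfl | hi
      · have : ε = δ := P.root.injective (by simpa using hε)
        rwa [this]
      · rcases List.mem_cons.1 (hclosed γ (by simp) δ (by simp [hδ]) ε i hε) with rfl | h
        · exact absurd (hht δ ε hδ ε (by simp) i hi hε) (lt_irrefl _)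
        · exact h
    · intro η hη δ hδ ε i hε
      rcases Nat.eq_zero_or_pos i with rfl | hi
      · have : ε = δ := P.root.injective (by simpa using hε)
        rwa [this]
      · rcases List.mem_cons.1 (hclosed η (by simp [hη]) δ (by simp [hδ]) ε i hε) with rfl | h
        · exact absurd (hht δ ε hδ η (by simp [hη]) i hi hε) (lt_irrefl _)
        · exact h
    · exact fun η hη δ hδ => hind η (by simp [hη]) δ (by simp [hδ])

lemma suppIn_rootProd {M : AddSubmonoid X} (m : List (ι × S)) (hm : ∀ x ∈ m, P.root x.1 ∈ M) :
    V.SuppIn M (V.rootProd m) := by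
  induction m with
  | nil => simpa [rootProd] using suppIn_one
  | cons x m ih =>
    simp only [rootProd, List.map_cons, List.prod_cons] at ih ⊢
    exact (suppIn_rootMatrix (hm x (by simp)) _).mul (ih fun y hy => hm y (by simp [hy]))

lemma twist_rootProd {M : AddSubmonoid X} {χ : X → S} (h0 : χ 0 = 1)
    (hχ : ∀ x ∈ M, ∀ y ∈ M, χ (x + y) = χ x * χ y) (m : List (ι × S))
    (hm : ∀ x ∈ m, P.root x.1 ∈ M) :
    V.twist χ (V.rootProd m) = V.rootProd (m.map fun x => (x.1, χ (P.root x.1) * x.2)) := by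
  induction m with
  | nil => simpa [rootProd] using twist_one h0
  | cons x m ih =>
    have ih' := ih fun y hy => hm y (by simp [hy])
    have hs := V.suppIn_rootProd m fun y hy => hm y (by simp [hy])
    simp only [rootProd, List.map_cons, List.prod_cons] at ih' hs ⊢
    rw [twist_mul hχ (suppIn_rootMatrix (hm x (by simp)) _) hs, ih',
      twist_rootMatrix h0 hχ (hm x (by simp))]

/-- Chevalley's commutator relations: `x_α(v) x_β(u) x_α(-v)` is a product of elements of the root
groups of the roots `i α + j β` with `j ≥ 1`. -/
lemma exists_conj_eq_rootProd [P.IsReduced] (b : P.Base) {α β : ι} (hα : b.IsPos α)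
    (hβ : b.IsPos β) (hne : α ≠ β) (u v : S) :
    ∃ m : List (ι × S),
      (∀ x ∈ m, ∃ i j : ℕ, 1 ≤ j ∧ P.root x.1 = i • P.root α + j • P.root β) ∧
      V.rootMatrix α v * V.rootMatrix β u * V.rootMatrix α (-v) = V.rootProd m := by
  classical
  have hli : LinearIndependent ℤ ![P.root α, P.root β] := by
    refine RootPairing.IsReduced.linearIndependent P hne fun h => ?_
    have h1 := (isPos_iff_ht b α).1 hα
    have h2 := (isPos_iff_ht b β).1 hβ
    rw [h, map_neg] at h1
    lia
  obtain ⟨l, hmem, hnd, hsort, hpos, hnil⟩ := exists_list_cone b hα hβ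
  -- the path `s ↦ x_α(1) x_β(s) x_α(-1)` over `ℚ`
  obtain ⟨m, hm, hm'⟩ := V.exists_eq_rootProd l hnil
    (V.rootMatrix α 1 * V.rootMatrix β Polynomial.X * V.rootMatrix α (-1))
    (V.rootMatrix α 1 * V.eMap _ β * V.rootMatrix α (-1))
    (V.conj_eMap_mem hli (fun ε i hε => (hmem ε).2 ⟨i, 1, le_rfl, by rw [hε]; module⟩) 1)
    (by
      have hc : ∀ (α : ι) (c : ℤ), deriv (V.rootMatrix α (c : Polynomial ℚ)) = 0 := by
        intro α c
        rw [deriv_rootMatrix]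
        simp
      have h1 := hc α 1
      have h2 := hc α (-1)
      rw [Int.cast_neg] at h2
      rw [Int.cast_one] at h1 h2
      rw [deriv_mul, deriv_mul, h1, h2, deriv_rootMatrix, Polynomial.derivative_X, one_smul,
        mul_zero, zero_mul, zero_add, add_zero]
      simp only [mul_assoc]
      rw [← mul_assoc (V.rootMatrix α (-1)), V.rootMatrix_neg_mul, one_mul])
    (by
      rw [Matrix.map_mul, Matrix.map_mul, rootMatrix_map, rootMatrix_map, rootMatrix_map]
      simp [rootMatrix_zero, rootMatrix_mul_neg])
  have hm1 := congrArg (fun A => A.map (Polynomial.evalRingHom (1 : ℚ))) hm'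
  simp only [Matrix.map_mul, rootMatrix_map, rootProd_map] at hm1
  simp only [map_one, map_neg, Polynomial.coe_evalRingHom, Polynomial.eval_X] at hm1
  set m₁ : List (ι × ℚ) := m.map fun x => (x.1, Polynomial.eval 1 x.2) with hm₁
  have hfst : m₁.map Prod.fst = l := by
    rw [hm₁, ← hm, List.map_map]
    rfl
  have hZ : V.rootMatrix α 1 * V.rootMatrix β 1 * V.rootMatrix α (-1) =
      (V.rootMatrix α (1 : ℤ) * V.rootMatrix β 1 * V.rootMatrix α (-1)).map
        (Int.castRingHom ℚ) := by
    rw [Matrix.map_mul, Matrix.map_mul, rootMatrix_map, rootMatrix_map, rootMatrix_map]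
    simp
  obtain ⟨m₂, hm₂⟩ := V.exists_int_rootProd b m₁
    (fun x hx => hpos _ (hfst ▸ List.mem_map_of_mem hx)) (hfst ▸ hnd) (hfst ▸ hsort)
    (fun i j => ⟨(V.rootMatrix α (1 : ℤ) * V.rootMatrix β 1 * V.rootMatrix α (-1) :
      Matrix J J ℤ) i j, by
      rw [← hm1, hZ]; rfl⟩)
  have hm2 : V.rootMatrix α (1 : ℤ) * V.rootMatrix β 1 * V.rootMatrix α (-1) = V.rootProd m₂ := by
    have h1 : (V.rootProd m₂).map (Int.castRingHom ℚ) = V.rootProd m₁ := by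
      rw [rootProd_map, hm₂]
      rfl
    refine Matrix.map_injective (f := Int.castRingHom ℚ) Int.cast_injective ?_
    simp only
    rw [h1, ← hm1, hZ]
  have hm₂l : ∀ x ∈ m₂, ∃ i j : ℕ, 1 ≤ j ∧ P.root x.1 = i • P.root α + j • P.root β := by
    intro x hx
    rw [← hmem, ← hfst, hm₂, List.map_map]
    exact List.mem_map_of_mem (f := Prod.fst ∘ fun x : ι × ℤ => (x.1, (x.2 : ℚ))) hx
  have hS : V.rootMatrix α (1 : S) * V.rootMatrix β 1 * V.rootMatrix α (-1) =
      V.rootProd (m₂.map fun x => (x.1, (x.2 : S))) := by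
    have := congrArg (fun A => A.map (Int.castRingHom S)) hm2
    simp only [Matrix.map_mul, rootMatrix_map, rootProd_map] at this
    simpa using this
  -- by homogeneity it suffices to treat the parameters `u = v = 1`
  let χ : X → S := fun x => if h : ∃ p : ℕ × ℕ, x = p.1 • P.root α + p.2 • P.root β
    then v ^ h.choose.1 * u ^ h.choose.2 else 0
  have hχ : ∀ i j : ℕ, χ (i • P.root α + j • P.root β) = v ^ i * u ^ j := by
    intro i j
    have h : ∃ p : ℕ × ℕ, i • P.root α + j • P.root β = p.1 • P.root α + p.2 • P.root β :=
      ⟨(i, j), rfl⟩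
    have h1 := h.choose_spec
    simp only [χ]
    rw [dif_pos h]
    rw [LinearIndependent.pair_iff] at hli
    have h2 := hli ((i : ℤ) - h.choose.1) ((j : ℤ) - h.choose.2) (by
      rw [sub_smul, sub_smul, natCast_zsmul, natCast_zsmul, natCast_zsmul, natCast_zsmul,
        sub_add_sub_comm, ← h1, sub_self])
    have h3 : i = h.choose.1 := by lia
    have h4 : j = h.choose.2 := by lia
    rw [← h3, ← h4]
  let M : AddSubmonoid X :=
    { carrier := {x | ∃ i j : ℕ, x = i • P.root α + j • P.root β}
      zero_mem' := ⟨0, 0, by simp⟩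
      add_mem' := by
        rintro _ _ ⟨i, j, rfl⟩ ⟨i', j', rfl⟩
        exact ⟨i + i', j + j', by module⟩ }
  have hMα : P.root α ∈ M := ⟨1, 0, by simp⟩
  have hMβ : P.root β ∈ M := ⟨0, 1, by simp⟩
  have h0 : χ 0 = 1 := by simpa using hχ 0 0
  have hmul : ∀ x ∈ M, ∀ y ∈ M, χ (x + y) = χ x * χ y := by
    rintro _ ⟨i, j, rfl⟩ _ ⟨i', j', rfl⟩
    have : i • P.root α + j • P.root β + (i' • P.root α + j' • P.root β) =
        (i + i') • P.root α + (j + j') • P.root β := by module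
    rw [this, hχ, hχ, hχ]
    ring
  have hχα : χ (P.root α) = v := by simpa using hχ 1 0
  have hχβ : χ (P.root β) = u := by simpa using hχ 0 1
  have hMm : ∀ x ∈ m₂.map (fun x => (x.1, (x.2 : S))), P.root x.1 ∈ M := by
    intro x hx
    obtain ⟨y, hy, rfl⟩ := List.mem_map.1 hx
    obtain ⟨i, j, -, h⟩ := hm₂l y hy
    exact ⟨i, j, h⟩
  have key := congrArg (V.twist χ) hS
  rw [twist_mul hmul ((suppIn_rootMatrix hMα _).mul (suppIn_rootMatrix hMβ _))
    (suppIn_rootMatrix hMα _), twist_mul hmul (suppIn_rootMatrix hMα _) (suppIn_rootMatrix hMβ _),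
    twist_rootMatrix h0 hmul hMα, twist_rootMatrix h0 hmul hMβ, twist_rootMatrix h0 hmul hMα,
    hχα, hχβ, mul_one, mul_one, mul_neg, mul_one, V.twist_rootProd h0 hmul _ hMm] at key
  refine ⟨_, ?_, key⟩
  intro x hx
  obtain ⟨y, hy, rfl⟩ := List.mem_map.1 hx
  obtain ⟨z, hz, rfl⟩ := List.mem_map.1 hy
  exact hm₂l z hz

end ChevalleyLattice

namespace ChevalleyLattice

variable {ι X Y : Type*} [Finite ι] [AddCommGroup X] [AddCommGroup Y] {P : RootDatum ι X Y}
  {J : Type*} [Fintype J] [DecidableEq J] (V : ChevalleyLattice P J)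
  {S : Type*} [CommRing S]

/-! ### Groups generated by root subgroups -/

lemma rootUnit_add (α : ι) (u v : S) :
    V.rootUnit α (u + v) = V.rootUnit α u * V.rootUnit α v :=
  Units.ext (V.rootMatrix_add α u v)

lemma rootUnit_zero (α : ι) : V.rootUnit α (0 : S) = 1 := Units.ext (V.rootMatrix_zero α)

lemma rootUnit_neg (α : ι) (u : S) : V.rootUnit α (-u) = (V.rootUnit α u)⁻¹ := Units.ext rfl

/-- The subgroup generated by the root subgroups of the roots satisfying `p`. -/
def rootGroup (p : ι → Prop) (S : Type*) [CommRing S] :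
    Subgroup (Matrix.GeneralLinearGroup J S) :=
  Subgroup.closure {g | ∃ α, p α ∧ ∃ u : S, (g : Matrix J J S) = V.rootMatrix α u}

variable {V} {p q : ι → Prop}

lemma rootUnit_mem_rootGroup {α : ι} (hα : p α) (u : S) : V.rootUnit α u ∈ V.rootGroup p S :=
  Subgroup.subset_closure ⟨α, hα, u, rfl⟩

lemma rootGroup_le {H : Subgroup (Matrix.GeneralLinearGroup J S)}
    (h : ∀ α, p α → ∀ u : S, V.rootUnit α u ∈ H) : V.rootGroup p S ≤ H := by
  refine (Subgroup.closure_le _).2 ?_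
  rintro g ⟨α, hα, u, hg⟩
  have : g = V.rootUnit α u := Units.ext hg
  exact this ▸ h α hα u

lemma rootGroup_mono (h : ∀ α, p α → q α) : V.rootGroup p S ≤ V.rootGroup q S :=
  rootGroup_le fun α hα u => rootUnit_mem_rootGroup (h α hα) u

lemma conj_mem_rootGroup {g : Matrix.GeneralLinearGroup J S}
    (h : ∀ α, p α → ∀ u : S, g * V.rootUnit α u * g⁻¹ ∈ V.rootGroup q S)
    {x : Matrix.GeneralLinearGroup J S} (hx : x ∈ V.rootGroup p S) :
    g * x * g⁻¹ ∈ V.rootGroup q S := by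
  have : V.rootGroup p S ≤ (V.rootGroup q S).comap (MulAut.conj g).toMonoidHom :=
    rootGroup_le fun α hα u => h α hα u
  exact this hx

variable (V)

lemma torusHom_mul_rootUnit (t : Torus X S) (α : ι) (u : S) :
    V.torusHom S t * V.rootUnit α u =
      V.rootUnit α (t (Multiplicative.ofAdd (P.root α)) * u) * V.torusHom S t := by
  have h := V.twist_rootMatrix (M := ⊤) (χ := fun x => (t (Multiplicative.ofAdd x) : S))
    (by simp) (by simp) (α := α) trivial u
  refine Units.ext ?_
  change Matrix.diagonal _ * V.rootMatrix α u = V.rootMatrix α _ * Matrix.diagonal _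
  rw [← h]
  ext i j
  rw [Matrix.diagonal_mul, Matrix.mul_diagonal]
  change _ = (t (Multiplicative.ofAdd (V.wt i - V.wt j)) : S) * _ * _
  rw [ofAdd_sub, map_div, div_eq_mul_inv, Units.val_mul]
  linear_combination (-((t (Multiplicative.ofAdd (V.wt i)) : Sˣ) : S) * V.rootMatrix α u i j) *
    (t (Multiplicative.ofAdd (V.wt j))).inv_mul

lemma torusHom_conj_mem_rootGroup (t : Torus X S) {x : Matrix.GeneralLinearGroup J S}
    (hx : x ∈ V.rootGroup p S) :
    V.torusHom S t * x * (V.torusHom S t)⁻¹ ∈ V.rootGroup p S := by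
  refine conj_mem_rootGroup (fun α hα u => ?_) hx
  rw [torusHom_mul_rootUnit, mul_inv_cancel_right]
  exact rootUnit_mem_rootGroup hα _

/-- By the commutator relations, `x_α(v)` normalizes the group generated by the root subgroups of
the other positive roots. -/
lemma rootUnit_conj_mem_rootGroup [P.IsReduced] (b : P.Base) {α : ι} (hα : b.IsPos α) (v : S)
    {x : Matrix.GeneralLinearGroup J S} (hx : x ∈ V.rootGroup (fun β => b.IsPos β ∧ β ≠ α) S) :
    V.rootUnit α v * x * (V.rootUnit α v)⁻¹ ∈ V.rootGroup (fun β => b.IsPos β ∧ β ≠ α) S := by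
  refine conj_mem_rootGroup (fun β hβ u => ?_) hx
  obtain ⟨m, hm, h⟩ := V.exists_conj_eq_rootProd b hα hβ.1 (Ne.symm hβ.2) u v
  have h1 : V.rootUnit α v * V.rootUnit β u * (V.rootUnit α v)⁻¹ =
      (m.map fun x => V.rootUnit x.1 x.2).prod := by
    refine Units.ext ?_
    change V.rootMatrix α v * V.rootMatrix β u * V.rootMatrix α (-v) =
      (Units.coeHom (Matrix J J S)) _
    rw [h, map_list_prod, List.map_map]
    rfl
  rw [h1]
  refine Subgroup.list_prod_mem _ fun y hy => ?_
  obtain ⟨⟨γ, c⟩, hx, rfl⟩ := List.mem_map.1 hy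
  obtain ⟨i, j, hj, hγ⟩ := hm _ hx
  refine rootUnit_mem_rootGroup ⟨?_, ?_⟩ c
  · have h1 := hβ.1
    rw [isPos_iff_ht] at hα h1 ⊢
    rw [hγ, map_add, map_nsmul, map_nsmul, nsmul_eq_mul, nsmul_eq_mul]
    have : (0 : ℤ) < j * ht b (P.root β) := by positivity
    have : (0 : ℤ) ≤ i * ht b (P.root α) := by positivity
    lia
  · rintro rfl
    have hli : LinearIndependent ℤ ![P.root γ, P.root β] := by
      refine RootPairing.IsReduced.linearIndependent P (Ne.symm hβ.2) fun h => ?_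
      have h1 := (isPos_iff_ht b γ).1 hα
      have h2 := (isPos_iff_ht b β).1 hβ.1
      rw [h, map_neg] at h1
      lia
    rw [LinearIndependent.pair_iff] at hli
    have := hli ((i : ℤ) - 1) j (by
      rw [sub_smul, one_smul, natCast_zsmul, natCast_zsmul]
      nth_rewrite 2 [hγ]
      abel)
    lia

/-- A positive root subgroup is split off from `U`. -/
lemma exists_mul_rootUnit_of_mem [P.IsReduced] (b : P.Base) {α : ι} (hα : b.IsPos α)
    {x : Matrix.GeneralLinearGroup J S} (hx : x ∈ V.rootGroup b.IsPos S) :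
    ∃ y ∈ V.rootGroup (fun β => b.IsPos β ∧ β ≠ α) S, ∃ v : S, x = y * V.rootUnit α v := by
  have key : ∀ β, b.IsPos β → ∀ w : S, ∀ y ∈ V.rootGroup (fun β => b.IsPos β ∧ β ≠ α) S,
      ∀ v : S, ∃ y' ∈ V.rootGroup (fun β => b.IsPos β ∧ β ≠ α) S, ∃ v' : S,
        V.rootUnit β w * (y * V.rootUnit α v) = y' * V.rootUnit α v' := by
    intro β hβ w y hy v
    by_cases h : β = α
    · subst h
      refine ⟨_, V.rootUnit_conj_mem_rootGroup b hβ w hy, w + v, ?_⟩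
      rw [rootUnit_add]
      group
    · exact ⟨V.rootUnit β w * y, mul_mem (rootUnit_mem_rootGroup ⟨hβ, h⟩ w) hy, v,
        (mul_assoc _ _ _).symm⟩
  induction hx using Subgroup.closure_induction_left with
  | one => exact ⟨1, one_mem _, 0, by rw [rootUnit_zero, one_mul]⟩
  | mul_left g hg x _ ih =>
    obtain ⟨β, hβ, w, hg⟩ := hg
    obtain ⟨y, hy, v, rfl⟩ := ih
    have : g = V.rootUnit β w := Units.ext hg
    exact this ▸ key β hβ w y hy v
  | inv_mul_cancel g hg x _ ih =>
    obtain ⟨β, hβ, w, hg⟩ := hg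
    obtain ⟨y, hy, v, rfl⟩ := ih
    have : g⁻¹ = V.rootUnit β (-w) := by
      rw [rootUnit_neg, inv_inj]
      exact Units.ext hg
    exact this ▸ key β hβ (-w) y hy v

/-! ### Representatives of the simple reflections -/

/-- The negative of a root. -/
def negRoot (P : RootDatum ι X Y) (α : ι) : ι := P.reflectionPerm α α

omit [Finite ι] in
lemma root_negRoot (α : ι) : P.root (negRoot P α) = -P.root α := by
  rw [negRoot, P.root_reflectionPerm, P.reflection_apply_self]

omit [Finite ι] in
lemma negRoot_negRoot (α : ι) : negRoot P (negRoot P α) = α :=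
  P.root.injective (by rw [root_negRoot, root_negRoot, neg_neg])

omit [Finite ι] in
lemma reflectionPerm_negRoot (α β : ι) :
    P.reflectionPerm α (negRoot P β) = negRoot P (P.reflectionPerm α β) :=
  P.root.injective (by
    rw [root_negRoot, P.root_reflectionPerm, P.root_reflectionPerm, root_negRoot, map_neg])

lemma isPos_negRoot [P.IsReduced] (b : P.Base) (α : ι) : b.IsPos (negRoot P α) ↔ ¬ b.IsPos α := by
  have := ht_ne_zero b α
  rw [isPos_iff_ht, isPos_iff_ht, root_negRoot, map_neg]
  lia

/-- The element `n_α = x_α(1) x_{-α}(-1) x_α(1)`, which represents the reflection `s_α`. -/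
def weylUnit (S : Type*) [CommRing S] (α : ι) : Matrix.GeneralLinearGroup J S :=
  V.rootUnit α 1 * V.rootUnit (negRoot P α) (-1) * V.rootUnit α 1

/-- The value `α^∨(u)` of a coroot, as an element of the torus. -/
def corootTorus (P : RootDatum ι X Y) (α : ι) (u : Sˣ) : Torus X S where
  toFun x := u ^ P.toLinearMap x.toAdd (P.coroot α)
  map_one' := by simp
  map_mul' x y := by simp [zpow_add]

lemma rootUnit_mul_mul (α : ι) (u : Sˣ) :
    V.rootUnit α (u : S) * V.rootUnit (negRoot P α) (-(u⁻¹ : Sˣ) : S) * V.rootUnit α (u : S) =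
      V.torusHom S (corootTorus P α u) * V.weylUnit S α :=
  Units.ext (V.rootMatrix_mul_mul (root_negRoot α) u)

/-- The reflection `s_α` acting on the torus. -/
def reflTorus (α : ι) (t : Torus X S) : Torus X S :=
  t.comp (AddMonoidHom.toMultiplicative ((P.reflection α : X ≃ₗ[ℤ] X) : X →+ X))

lemma weylUnit_mul_torusHom (α : ι) (t : Torus X S) :
    V.weylUnit S α * V.torusHom S t = V.torusHom S (reflTorus (P := P) α t) * V.weylUnit S α := by
  refine Units.ext ?_
  change V.weyl S α (negRoot P α) * Matrix.diagonal _ = Matrix.diagonal _ * V.weyl S α (negRoot P α)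
  ext i j
  rw [Matrix.mul_diagonal, Matrix.diagonal_mul]
  by_cases h : V.weyl S α (negRoot P α) i j = 0
  · rw [h, zero_mul, mul_zero]
  · have h1 : reflTorus (P := P) α t (Multiplicative.ofAdd (V.wt i)) =
        t (Multiplicative.ofAdd (V.wt j)) := by
      rw [V.wt_of_weyl (root_negRoot α) h]
      change t (Multiplicative.ofAdd (P.reflection α (P.reflection α (V.wt j)))) = _
      rw [P.reflection_same]
    rw [h1, mul_comm]

lemma weylUnit_inv (α : ι) :
    (V.weylUnit S α)⁻¹ = V.torusHom S (corootTorus P α (-1)) * V.weylUnit S α := by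
  rw [← rootUnit_mul_mul, weylUnit, mul_inv_rev, mul_inv_rev, ← rootUnit_neg, ← rootUnit_neg]
  simp [mul_assoc]

/-- The product of the `n_α` for `α` in a list of roots. -/
def weylWord (S : Type*) [CommRing S] (l : List ι) : Matrix.GeneralLinearGroup J S :=
  (l.map (V.weylUnit S)).prod

/-- The product of the reflections in a list of roots, as a permutation of the roots. -/
def wordPerm (P : RootDatum ι X Y) (l : List ι) : Equiv.Perm ι := (l.map P.reflectionPerm).prod

lemma weylWord_cons (α : ι) (l : List ι) :
    V.weylWord S (α :: l) = V.weylUnit S α * V.weylWord S l := by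
  simp [weylWord]

lemma weylWord_append (l l' : List ι) :
    V.weylWord S (l ++ l') = V.weylWord S l * V.weylWord S l' := by
  simp [weylWord]

omit [Finite ι] in
lemma wordPerm_cons (α : ι) (l : List ι) (β : ι) :
    wordPerm P (α :: l) β = P.reflectionPerm α (wordPerm P l β) := by
  simp [wordPerm]

omit [Finite ι] in
lemma wordPerm_append (l l' : List ι) (β : ι) :
    wordPerm P (l ++ l') β = wordPerm P l (wordPerm P l' β) := by
  simp [wordPerm]

omit [Finite ι] in
lemma wordPerm_negRoot (l : List ι) (β : ι) :
    wordPerm P l (negRoot P β) = negRoot P (wordPerm P l β) := by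
  induction l with
  | nil => simp [wordPerm]
  | cons α l ih => rw [wordPerm_cons, wordPerm_cons, ih, reflectionPerm_negRoot]

omit [Finite ι] in
lemma wordPerm_reflectionPerm (l : List ι) (β γ : ι) :
    wordPerm P l (P.reflectionPerm β γ) =
      P.reflectionPerm (wordPerm P l β) (wordPerm P l γ) := by
  have key : ∀ α β γ : ι, P.reflectionPerm α (P.reflectionPerm β γ) =
      P.reflectionPerm (P.reflectionPerm α β) (P.reflectionPerm α γ) := by
    intro α β γ
    refine P.root.injective ?_
    rw [P.root_reflectionPerm, P.root_reflectionPerm, P.reflection_apply_root,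
      P.root_reflectionPerm, P.reflection_apply_root, P.pairing_reflectionPerm,
      P.reflectionPerm_self, P.root_reflectionPerm, map_sub, map_zsmul, P.root_reflectionPerm]
  induction l with
  | nil => simp [wordPerm]
  | cons α l ih => rw [wordPerm_cons, ih, wordPerm_cons, wordPerm_cons, key]

variable [P.IsReduced]

lemma exists_weylWord_mul_rootUnit (l : List ι) (β : ι) :
    ∃ c : ℤ, (c = 1 ∨ c = -1) ∧ ∀ u : S,
      V.weylWord S l * V.rootUnit β u = V.rootUnit (wordPerm P l β) (c * u) * V.weylWord S l ∧
      V.weylWord S l * V.rootUnit (negRoot P β) u =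
        V.rootUnit (negRoot P (wordPerm P l β)) (c * u) * V.weylWord S l := by
  induction l with
  | nil => exact ⟨1, Or.inl rfl, fun u => by simp [weylWord, wordPerm]⟩
  | cons α l ih =>
    obtain ⟨c, hc, h⟩ := ih
    obtain ⟨d, hd, h'⟩ := V.exists_weyl_mul_rootMatrix (root_negRoot α)
      (root_negRoot (wordPerm P l β)) (P.root_reflectionPerm α (wordPerm P l β))
      (root_negRoot (P.reflectionPerm α (wordPerm P l β)))
    refine ⟨d * c, by rcases hc with rfl | rfl <;> rcases hd with rfl | rfl <;> simp, fun u => ?_⟩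
    have h1 : ∀ w : S, V.weylUnit S α * V.rootUnit (wordPerm P l β) w =
        V.rootUnit (P.reflectionPerm α (wordPerm P l β)) (d * w) * V.weylUnit S α :=
      fun w => Units.ext (h' S w).1
    have h2 : ∀ w : S, V.weylUnit S α * V.rootUnit (negRoot P (wordPerm P l β)) w =
        V.rootUnit (negRoot P (P.reflectionPerm α (wordPerm P l β))) (d * w) * V.weylUnit S α :=
      fun w => Units.ext (h' S w).2
    rw [weylWord_cons, wordPerm_cons, Int.cast_mul, mul_assoc (d : S)]
    constructor
    · rw [mul_assoc, (h u).1, ← mul_assoc, h1, mul_assoc]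
    · rw [mul_assoc, (h u).2, ← mul_assoc, h2, mul_assoc]

lemma exists_rootUnit_mul_weylWord (l : List ι) (β : ι) (u : S) :
    ∃ v : S, V.rootUnit (wordPerm P l β) u * V.weylWord S l =
      V.weylWord S l * V.rootUnit β v := by
  obtain ⟨c, hc, h⟩ := V.exists_weylWord_mul_rootUnit (S := S) l β
  refine ⟨c * u, ?_⟩
  rw [(h _).1, ← mul_assoc]
  have : (c : S) * c = 1 := by
    rcases hc with rfl | rfl <;> simp
  rw [this, one_mul]

omit [P.IsReduced] in
lemma exists_weylWord_mul_torusHom (l : List ι) (t : Torus X S) :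
    ∃ t', V.weylWord S l * V.torusHom S t = V.torusHom S t' * V.weylWord S l := by
  induction l with
  | nil => exact ⟨t, by simp [weylWord]⟩
  | cons α l ih =>
    obtain ⟨t', h⟩ := ih
    exact ⟨_, by rw [weylWord_cons, mul_assoc, h, ← mul_assoc, weylUnit_mul_torusHom, mul_assoc]⟩

lemma exists_weylWord_mul_weylUnit (l : List ι) (β : ι) :
    ∃ t, V.weylWord S l * V.weylUnit S β =
      V.torusHom S t * V.weylUnit S (wordPerm P l β) * V.weylWord S l := by
  obtain ⟨c, hc, h⟩ := V.exists_weylWord_mul_rootUnit (S := S) l β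
  have hu : ∃ w : Sˣ, (w : S) = c ∧ ((w⁻¹ : Sˣ) : S) = c := by
    rcases hc with rfl | rfl
    · exact ⟨1, by simp⟩
    · exact ⟨-1, by simp⟩
  obtain ⟨w, hw, hw'⟩ := hu
  refine ⟨corootTorus P (wordPerm P l β) w, ?_⟩
  rw [← rootUnit_mul_mul, hw, hw', weylUnit, ← mul_assoc, ← mul_assoc, (h 1).1,
    mul_assoc (V.rootUnit _ _), (h (-1)).2, mul_one, mul_neg, mul_one]
  simp only [mul_assoc]
  rw [(h 1).1, mul_one]

/-- If a product of simple reflections makes a positive root negative, then some tail of the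
product maps this root to the simple root preceding the tail. -/
lemma exists_wordPerm_eq (b : P.Base) {l : List ι} (hl : ∀ i ∈ l, i ∈ b.support) {β : ι}
    (hβ : b.IsPos β) (h : ¬ b.IsPos (wordPerm P l β)) :
    ∃ l₁ i l₂, l = l₁ ++ i :: l₂ ∧ wordPerm P l₂ β = i := by
  induction l with
  | nil => exact absurd hβ h
  | cons a l ih =>
    by_cases h1 : b.IsPos (wordPerm P l β)
    · refine ⟨[], a, l, rfl, ?_⟩
      by_contra hne
      rw [wordPerm_cons] at h
      exact h (h1.reflectionPerm (hl a (by simp)) hne)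
    · obtain ⟨l₁, i, l₂, rfl, h2⟩ := ih (fun i hi => hl i (by simp [hi])) h1
      exact ⟨a :: l₁, i, l₂, rfl, h2⟩

/-- A product of simple reflections that keeps the simple roots positive is trivial, and then the
corresponding product of representatives lies in the torus. -/
lemma weylWord_mem_range_torusHom (b : P.Base) (l : List ι) (hl : ∀ i ∈ l, i ∈ b.support)
    (h : ∀ α ∈ b.support, b.IsPos (wordPerm P l α)) :
    ∃ t, V.weylWord S l = V.torusHom S t := by
  obtain ⟨n, hn⟩ : ∃ n, l.length = n := ⟨_, rfl⟩
  induction n using Nat.strong_induction_on generalizing l with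
  | _ n ih =>
    rcases List.eq_nil_or_concat l with rfl | ⟨l, m, rfl⟩
    · exact ⟨1, by simp [weylWord]⟩
    simp only [List.concat_eq_append] at hl h hn
    have hm := hl m (by simp)
    have hwm : wordPerm P [m] m = negRoot P m := by simp [wordPerm, negRoot]
    have hneg : ¬ b.IsPos (wordPerm P l m) := by
      have := h m hm
      rwa [wordPerm_append, hwm, wordPerm_negRoot, isPos_negRoot] at this
    obtain ⟨l₁, i, l₂, rfl, hi⟩ := exists_wordPerm_eq b (fun i hi => hl i (by simp [hi]))
      (b.isPos_of_mem_support hm) hneg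
    obtain ⟨t, ht⟩ := ih (l₁ ++ l₂).length (by rw [← hn]; simp) (l₁ ++ l₂)
      (fun j hj => hl j (by
        rcases List.mem_append.1 hj with hj | hj <;> simp [hj])) (fun α hα => by
        have := h α hα
        rw [wordPerm_append, wordPerm_append, wordPerm_cons] at this
        rw [wordPerm_append]
        have h1 : wordPerm P l₂ (wordPerm P [m] α) = P.reflectionPerm i (wordPerm P l₂ α) := by
          rw [wordPerm_cons, wordPerm_reflectionPerm, hi]
          simp [wordPerm]
        rwa [h1, P.reflectionPerm_self] at this) rfl
    obtain ⟨t₁, h₁⟩ := V.exists_weylWord_mul_weylUnit (S := S) l₂ m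
    rw [hi] at h₁
    have h₂ : V.weylUnit S i * V.weylUnit S i = (V.torusHom S (corootTorus P i (-1)))⁻¹ := by
      rw [eq_inv_iff_mul_eq_one]
      have h3 := V.weylUnit_inv (S := S) i
      have h4 : V.weylUnit S i * V.torusHom S (corootTorus P i (-1)) =
          V.torusHom S (corootTorus P i (-1)) * V.weylUnit S i := by
        rw [weylUnit_mul_torusHom]
        congr 2
        refine MonoidHom.ext fun x => ?_
        change (-1 : Sˣ) ^ P.toLinearMap (P.reflection i x.toAdd) (P.coroot i) =
          (-1 : Sˣ) ^ P.toLinearMap x.toAdd (P.coroot i)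
        rw [P.reflection_apply, map_sub, LinearMap.sub_apply, map_smul, LinearMap.smul_apply,
          P.root_coroot_two, smul_eq_mul, zpow_sub, mul_comm _ (2 : ℤ), zpow_mul]
        simp
      rw [mul_assoc, h4, ← h3, mul_inv_cancel]
    obtain ⟨t₂, h₃⟩ := V.exists_weylWord_mul_torusHom (S := S) l₁
      (reflTorus (P := P) i t₁ * (corootTorus P i (-1))⁻¹)
    refine ⟨t₂ * t, ?_⟩
    rw [List.concat_eq_append, weylWord_append, weylWord_append, weylWord_cons, mul_assoc, mul_assoc]
    have : V.weylWord S [m] = V.weylUnit S m := by simp [weylWord]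
    rw [this, h₁, mul_assoc, ← mul_assoc (V.weylUnit S i), weylUnit_mul_torusHom, mul_assoc,
      ← mul_assoc (V.weylUnit S i), h₂, ← map_inv, ← mul_assoc (V.torusHom S _), ← map_mul,
      ← mul_assoc, h₃, mul_assoc, ← weylWord_append, ht, ← map_mul]

end ChevalleyLattice

namespace ChevalleyLattice

variable {ι X Y : Type*} [Finite ι] [AddCommGroup X] [AddCommGroup Y] {P : RootDatum ι X Y}
  {J : Type*} [Fintype J] [DecidableEq J] (V : ChevalleyLattice P J)
  {F : Type*} [Field F] [P.IsReduced]

/-! ### Decompositions of the group of points -/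

/-- `map_inv`, for the inverse on `T` that is written pointwise. -/
lemma torus_map_inv {A : Type*} [Group A] (φ : Torus X F →* A) (t : Torus X F) :
    φ t⁻¹ = (φ t)⁻¹ := map_inv φ t

/-- For simple `α`, the reflection in `α` permutes the other positive roots, so `n_α` normalizes the
group generated by their root subgroups. -/
lemma weylUnit_conj_mem_rootGroup (b : P.Base) {α : ι} (hα : α ∈ b.support)
    {x : Matrix.GeneralLinearGroup J F} (hx : x ∈ V.rootGroup (fun β => b.IsPos β ∧ β ≠ α) F) :
    V.weylUnit F α * x * (V.weylUnit F α)⁻¹ ∈ V.rootGroup (fun β => b.IsPos β ∧ β ≠ α) F := by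
  refine conj_mem_rootGroup (fun β hβ u => ?_) hx
  obtain ⟨c, -, h⟩ := V.exists_weylWord_mul_rootUnit (S := F) [α] β
  have h1 := (h u).1
  simp only [weylWord, List.map_cons, List.map_nil, List.prod_cons, List.prod_nil, mul_one] at h1
  rw [h1, mul_inv_cancel_right]
  have h2 : wordPerm P [α] β = P.reflectionPerm α β := by simp [wordPerm]
  rw [h2]
  refine rootUnit_mem_rootGroup ⟨hβ.1.reflectionPerm hα hβ.2, fun h3 => ?_⟩ _
  have h4 : β = negRoot P α := by
    rw [← P.reflectionPerm_self α β, h3, negRoot]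
  have := hβ.1
  rw [h4, isPos_negRoot] at this
  exact this (b.isPos_of_mem_support hα)

omit [P.IsReduced] in
lemma weylUnit_mul_rootUnit (α : ι) (v : Fˣ) :
    V.weylUnit F α * V.rootUnit α (v : F) = (V.torusHom F (corootTorus P α (-v)))⁻¹ *
      V.rootUnit α (-v : F) * V.rootUnit (negRoot P α) ((v⁻¹ : Fˣ) : F) := by
  have h := V.rootUnit_mul_mul α (-v)
  rw [eq_inv_mul_iff_mul_eq.2 h.symm, inv_neg, Units.val_neg, Units.val_neg, neg_neg, rootUnit_neg]
  group

/-- To prove a property of all elements of `G` it suffices to see that it is stable under left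
multiplication by the torus, the positive root subgroups and the `n_α` for `α` simple. -/
lemma points_induction_left (b : P.Base) {p : Matrix.GeneralLinearGroup J F → Prop} (one : p 1)
    (torus : ∀ t g, p g → p (V.torusHom F t * g))
    (root : ∀ α, b.IsPos α → ∀ (u : F) g, p g → p (V.rootUnit α u * g))
    (weyl : ∀ α ∈ b.support, ∀ g, p g → p (V.weylUnit F α * g)) :
    ∀ g ∈ V.points F, p g := by
  let H : Subgroup (Matrix.GeneralLinearGroup J F) :=
    { carrier := {h | ∀ g, (p g → p (h * g)) ∧ (p g → p (h⁻¹ * g))}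
      one_mem' := by simp
      mul_mem' := fun {x y} hx hy g => by
        refine ⟨fun hg => ?_, fun hg => ?_⟩
        · rw [mul_assoc]
          exact (hx _).1 ((hy _).1 hg)
        · rw [mul_inv_rev, mul_assoc]
          exact (hy _).2 ((hx _).2 hg)
      inv_mem' := fun {x} hx g => by simpa using (hx g).symm }
  have htor : ∀ t, V.torusHom F t ∈ H := fun t g =>
    ⟨torus t g, fun hg => by rw [← map_inv]; exact torus _ g hg⟩
  have hpos : ∀ α, b.IsPos α → ∀ u : F, V.rootUnit α u ∈ H := fun α hα u g =>
    ⟨root α hα u g, fun hg => by rw [← rootUnit_neg]; exact root α hα _ g hg⟩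
  have hweyl : ∀ α ∈ b.support, V.weylUnit F α ∈ H := fun α hα g =>
    ⟨weyl α hα g, fun hg => by
      rw [weylUnit_inv, mul_assoc]
      exact torus _ _ (weyl α hα g hg)⟩
  have hconj : ∀ α ∈ b.support, ∀ β, (∀ u : F, V.rootUnit β u ∈ H) →
      ∀ u : F, V.rootUnit (P.reflectionPerm α β) u ∈ H := by
    intro α hα β hβ u
    obtain ⟨v, hv⟩ := V.exists_rootUnit_mul_weylWord [α] β u
    simp only [weylWord, wordPerm, List.map_cons, List.map_nil, List.prod_cons, List.prod_nil,
      mul_one] at hv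
    rw [eq_mul_inv_of_mul_eq hv]
    exact mul_mem (mul_mem (hweyl α hα) (hβ v)) (inv_mem (hweyl α hα))
  have hroot : ∀ α, (∀ u : F, V.rootUnit α u ∈ H) ∧ ∀ u : F, V.rootUnit (negRoot P α) u ∈ H := by
    intro α
    refine RootPairing.Base.induction_reflect (b := b) α (p := fun α => (∀ u : F, V.rootUnit α u ∈ H) ∧
      ∀ u : F, V.rootUnit (negRoot P α) u ∈ H) ?_ ?_ ?_
    · intro α h
      change _ ∧ ∀ u : F, V.rootUnit (negRoot P (negRoot P α)) u ∈ H
      rw [negRoot_negRoot]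
      exact h.symm
    · intro α hα
      have h1 := hpos α (b.isPos_of_mem_support hα)
      exact ⟨h1, hconj α hα α h1⟩
    · intro β α h hα
      refine ⟨hconj α hα β h.1, ?_⟩
      rw [← reflectionPerm_negRoot]
      exact hconj α hα _ h.2
  have hle : V.points F ≤ H := by
    refine (Subgroup.closure_le _).2 ?_
    rintro g (⟨t, rfl⟩ | ⟨α, u, hg⟩)
    · exact htor t
    · have : g = V.rootUnit α u := Units.ext hg
      exact this ▸ (hroot α).1 u
  intro g hg
  have := (hle hg 1).1 one
  rwa [mul_one] at this

/-- The common pattern of the Iwasawa and Birkhoff decompositions `G = T U Q`. -/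
lemma exists_eq_torus_mul_unipotent_mul (b : P.Base) {Q : Matrix.GeneralLinearGroup J F → Prop}
    (one : Q 1)
    (step : ∀ α ∈ b.support, ∀ (v : F) r, Q r → Q (V.weylUnit F α * V.rootUnit α v * r) ∨
      ∃ w : Fˣ, (w : F) = v ∧ Q (V.rootUnit (negRoot P α) ((w⁻¹ : Fˣ) : F) * r))
    {g : Matrix.GeneralLinearGroup J F} (hg : g ∈ V.points F) :
    ∃ t, ∃ u ∈ V.unipotent b F, ∃ r, Q r ∧ g = V.torusHom F t * u * r := by
  refine V.points_induction_left b (p := fun g => ∃ t, ∃ u ∈ V.unipotent b F, ∃ r, Q r ∧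
    g = V.torusHom F t * u * r) ?_ ?_ ?_ ?_ g hg
  · exact ⟨1, 1, one_mem _, 1, one, by simp⟩
  · rintro t _ ⟨t', u, hu, r, hr, rfl⟩
    exact ⟨t * t', u, hu, r, hr, by rw [map_mul]; group⟩
  · rintro α hα v _ ⟨t, u, hu, r, hr, rfl⟩
    refine ⟨t, (V.torusHom F t⁻¹ * V.rootUnit α v * (V.torusHom F t⁻¹)⁻¹) * u,
      mul_mem (V.torusHom_conj_mem_rootGroup t⁻¹ (rootUnit_mem_rootGroup hα v)) hu, r, hr, ?_⟩
    rw [torus_map_inv]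
    group
  · rintro α hα _ ⟨t, u, hu, r, hr, rfl⟩
    obtain ⟨y, hy, v, rfl⟩ := V.exists_mul_rootUnit_of_mem b (b.isPos_of_mem_support hα) hu
    have hy' := V.weylUnit_conj_mem_rootGroup b hα hy
    set y' := V.weylUnit F α * y * (V.weylUnit F α)⁻¹ with hy'_def
    have hyU : y' ∈ V.unipotent b F := rootGroup_mono (fun β hβ => hβ.1) hy'
    have e : V.weylUnit F α * (V.torusHom F t * (y * V.rootUnit α v) * r) =
        V.torusHom F (reflTorus (P := P) α t) * y' * (V.weylUnit F α * V.rootUnit α v * r) := by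
      rw [hy'_def]
      simp only [← mul_assoc]
      rw [weylUnit_mul_torusHom]
      group
    rcases step α hα v r hr with h | ⟨w, rfl, h⟩
    · exact ⟨_, y', hyU, _, h, e⟩
    · set s := corootTorus P α (-w) with hs
      refine ⟨reflTorus (P := P) α t * s⁻¹,
        (V.torusHom F s * y' * (V.torusHom F s)⁻¹) * V.rootUnit α (-w : F),
        mul_mem (V.torusHom_conj_mem_rootGroup s hyU)
          (rootUnit_mem_rootGroup (b.isPos_of_mem_support hα) _), _, h, ?_⟩
      rw [e, weylUnit_mul_rootUnit, map_mul, torus_map_inv, ← hs]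
      group

/-- The subgroup opposite to `U`, generated by the negative root subgroups. -/
def oppUnipotent (b : P.Base) (S : Type*) [CommRing S] :
    Subgroup (Matrix.GeneralLinearGroup J S) :=
  V.rootGroup (fun α => ¬ b.IsPos α) S

/-- The Birkhoff decomposition `G = ⋃ T U n_w U⁻`. -/
lemma exists_birkhoff (b : P.Base) {g : Matrix.GeneralLinearGroup J F} (hg : g ∈ V.points F) :
    ∃ t, ∃ u ∈ V.unipotent b F, ∃ l : List ι, (∀ i ∈ l, i ∈ b.support) ∧
      ∃ n ∈ V.oppUnipotent b F, g = V.torusHom F t * u * (V.weylWord F l * n) := by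
  let Q : Matrix.GeneralLinearGroup J F → Prop := fun r => ∃ l : List ι,
    (∀ i ∈ l, i ∈ b.support) ∧ ∃ n ∈ V.oppUnipotent b F, r = V.weylWord F l * n
  have step : ∀ α ∈ b.support, ∀ (v : F) r, Q r → Q (V.weylUnit F α * V.rootUnit α v * r) ∨
      ∃ w : Fˣ, (w : F) = v ∧ Q (V.rootUnit (negRoot P α) ((w⁻¹ : Fˣ) : F) * r) := by
    intro α hα v r hr
    obtain ⟨l, hl, n, hn, rfl⟩ := hr
    -- a root subgroup of a root whose image under the inverse of the word is negative moves to `U⁻`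
    have move : ∀ β, ¬ b.IsPos ((wordPerm P l).symm β) → ∀ v : F,
        ∃ n' ∈ V.oppUnipotent b F,
          V.rootUnit β v * (V.weylWord F l * n) = V.weylWord F l * n' := by
      intro β hβ v
      obtain ⟨v', hv'⟩ := V.exists_rootUnit_mul_weylWord l ((wordPerm P l).symm β) v
      rw [Equiv.apply_symm_apply] at hv'
      have h1 : V.rootUnit ((wordPerm P l).symm β) v' ∈ V.oppUnipotent b F :=
        rootUnit_mem_rootGroup (p := fun α => ¬ b.IsPos α) hβ v'
      exact ⟨V.rootUnit ((wordPerm P l).symm β) v' * n, mul_mem h1 hn, by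
        rw [← mul_assoc, hv', mul_assoc]⟩
    have hcons : ∀ i ∈ α :: l, i ∈ b.support := by
      intro i hi
      rcases List.mem_cons.1 hi with rfl | hi
      · exact hα
      · exact hl i hi
    by_cases hpos : b.IsPos ((wordPerm P l).symm α)
    · by_cases hv : v = 0
      · refine Or.inl ⟨α :: l, hcons, n, hn, ?_⟩
        rw [hv, rootUnit_zero, mul_one, weylWord_cons, mul_assoc]
      · refine Or.inr ⟨Units.mk0 v hv, rfl, l, hl, ?_⟩
        refine move _ ?_ _
        have : (wordPerm P l).symm (negRoot P α) = negRoot P ((wordPerm P l).symm α) := by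
          rw [Equiv.symm_apply_eq, wordPerm_negRoot, Equiv.apply_symm_apply]
        rw [this, isPos_negRoot, not_not]
        exact hpos
    · obtain ⟨n', hn', h⟩ := move α hpos v
      exact Or.inl ⟨α :: l, hcons, n', hn', by rw [mul_assoc, h, weylWord_cons, mul_assoc]⟩
  obtain ⟨t, u, hu, r, ⟨l, hl, n, hn, rfl⟩, h⟩ := V.exists_eq_torus_mul_unipotent_mul b
    (Q := Q) ⟨[], by simp, 1, one_mem _, by simp [weylWord]⟩ step hg
  exact ⟨t, u, hu, l, hl, n, hn, h⟩

end ChevalleyLattice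

namespace ChevalleyLattice

variable {ι X Y : Type*} [Finite ι] [AddCommGroup X] [AddCommGroup Y] {P : RootDatum ι X Y}
  {J : Type*} [Fintype J] [DecidableEq J] (V : ChevalleyLattice P J)
  {S : Type*} [CommRing S] {p : ι → Prop}

/-! ### Triangularity of unipotent elements -/

/-- `A` is unitriangular with respect to the grading of the weights by the functional `s`. -/
def IsUnitri (s : X →ₗ[ℤ] ℤ) (A : Matrix J J S) : Prop :=
  ∀ i j, s (V.wt i) ≤ s (V.wt j) → A i j = (1 : Matrix J J S) i j

variable {V} in
lemma IsUnitri.mul {s : X →ₗ[ℤ] ℤ} {A B : Matrix J J S} (hA : V.IsUnitri s A)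
    (hB : V.IsUnitri s B) : V.IsUnitri s (A * B) := by
  intro i j hij
  rw [Matrix.mul_apply, Finset.sum_eq_single i, hA i i le_rfl, hB i j hij, Matrix.one_apply_eq,
    one_mul]
  · intro l _ hl
    by_cases h : s (V.wt i) ≤ s (V.wt l)
    · rw [hA i l h, Matrix.one_apply_ne (Ne.symm hl), zero_mul]
    · rw [hB l j (by lia), Matrix.one_apply_ne, mul_zero]
      rintro rfl
      exact h hij
  · simp

lemma isUnitri_rootMatrix {s : X →ₗ[ℤ] ℤ} {α : ι} (hα : 0 < s (P.root α)) (u : S) :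
    V.IsUnitri s (V.rootMatrix α u) := by
  intro i j hij
  by_cases h : V.wt i = V.wt j
  · exact V.rootMatrix_apply_of_wt_eq u h
  · rw [Matrix.one_apply_ne (fun h' => h (by rw [h']))]
    by_contra h0
    obtain ⟨n, hn⟩ := V.wt_of_rootMatrix h0
    rcases Nat.eq_zero_or_pos n with rfl | hpos
    · exact h (by simpa using hn)
    · rw [hn, map_add, map_nsmul, nsmul_eq_mul] at hij
      have : (0 : ℤ) < n * s (P.root α) := by positivity
      lia

variable {V}

/-- A property of matrices that holds for the elements of the root subgroups and is stable under
products holds for the group that they generate. -/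
lemma rootGroup_induction {Q : Matrix J J S → Prop} (one : Q 1)
    (mul : ∀ A B, Q A → Q B → Q (A * B)) (root : ∀ α, p α → ∀ u : S, Q (V.rootMatrix α u))
    {g : Matrix.GeneralLinearGroup J S} (hg : g ∈ V.rootGroup p S) : Q g := by
  induction hg using Subgroup.closure_induction_left with
  | one => exact one
  | mul_left x hx y _ ih =>
    obtain ⟨α, hα, u, hx⟩ := hx
    rw [Units.val_mul, hx]
    exact mul _ _ (root α hα u) ih
  | inv_mul_cancel x hx y _ ih =>
    obtain ⟨α, hα, u, hx⟩ := hx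
    have : x⁻¹ = V.rootUnit α (-u) := by
      rw [rootUnit_neg, inv_inj]
      exact Units.ext hx
    rw [Units.val_mul, this]
    exact mul _ _ (root α hα (-u)) ih

lemma isUnitri_of_mem_rootGroup {s : X →ₗ[ℤ] ℤ} (hs : ∀ α, p α → 0 < s (P.root α))
    {g : Matrix.GeneralLinearGroup J S} (hg : g ∈ V.rootGroup p S) :
    V.IsUnitri s (g : Matrix J J S) :=
  rootGroup_induction (Q := V.IsUnitri s) (fun _ _ _ => rfl) (fun _ _ hA hB => hA.mul hB)
    (fun _ hα u => V.isUnitri_rootMatrix (hs _ hα) u) hg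

lemma suppIn_of_mem_rootGroup {M : AddSubmonoid X} (hM : ∀ α, p α → P.root α ∈ M)
    {g : Matrix.GeneralLinearGroup J S} (hg : g ∈ V.rootGroup p S) :
    V.SuppIn M (g : Matrix J J S) :=
  rootGroup_induction (Q := V.SuppIn M) suppIn_one (fun _ _ hA hB => hA.mul hB)
    (fun _ hα u => suppIn_rootMatrix (hM _ hα) u) hg

lemma exists_eq_twist_of_mem_rootGroup {M : AddSubmonoid X} {χ : X → S} (h0 : χ 0 = 1)
    (hχ : ∀ x ∈ M, ∀ y ∈ M, χ (x + y) = χ x * χ y) (hM : ∀ α, p α → P.root α ∈ M)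
    {g : Matrix.GeneralLinearGroup J S} (hg : g ∈ V.rootGroup p S) :
    ∃ h ∈ V.rootGroup p S, (h : Matrix J J S) = V.twist χ (g : Matrix J J S) := by
  refine (rootGroup_induction (V := V) (p := p) (Q := fun A => V.SuppIn M A ∧
    ∃ h ∈ V.rootGroup p S, (h : Matrix J J S) = V.twist χ A)
    ⟨suppIn_one, 1, one_mem _, (twist_one h0).symm⟩ ?_ ?_ hg).2
  · rintro A B ⟨hA, h, hh, e⟩ ⟨hB, h', hh', e'⟩
    exact ⟨hA.mul hB, h * h', mul_mem hh hh', by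
      rw [Units.val_mul, e, e', twist_mul hχ hA hB]⟩
  · intro α hα u
    exact ⟨suppIn_rootMatrix (hM α hα) u, V.rootUnit α (χ (P.root α) * u),
      rootUnit_mem_rootGroup hα _, (twist_rootMatrix h0 hχ (hM α hα) u).symm⟩

variable (V)

lemma isUnitri_unipotent [P.IsReduced] {b : P.Base} {g : Matrix.GeneralLinearGroup J S}
    (hg : g ∈ V.unipotent b S) : V.IsUnitri (ht b) (g : Matrix J J S) :=
  isUnitri_of_mem_rootGroup (fun α hα => (isPos_iff_ht b α).1 hα) hg

lemma isUnitri_oppUnipotent [P.IsReduced] {b : P.Base} {g : Matrix.GeneralLinearGroup J S}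
    (hg : g ∈ V.oppUnipotent b S) : V.IsUnitri (-ht b) (g : Matrix J J S) := by
  refine isUnitri_of_mem_rootGroup (p := fun α => ¬ b.IsPos α) (fun α hα => ?_) hg
  rw [isPos_iff_ht] at hα
  have := ht_ne_zero b α
  rw [LinearMap.neg_apply]
  lia

lemma torusHom_apply (t : Torus X S) (i j : J) :
    (V.torusHom S t : Matrix J J S) i j =
      if i = j then (t (Multiplicative.ofAdd (V.wt i)) : S) else 0 := by
  change Matrix.diagonal _ i j = _
  rw [Matrix.diagonal_apply]

lemma torusHom_mul_apply (t : Torus X S) (A : Matrix J J S) (i j : J) :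
    ((V.torusHom S t : Matrix J J S) * A) i j = t (Multiplicative.ofAdd (V.wt i)) * A i j :=
  Matrix.diagonal_mul _ _ _ _

lemma mul_torusHom_apply (t : Torus X S) (A : Matrix J J S) (i j : J) :
    (A * (V.torusHom S t : Matrix J J S)) i j = A i j * t (Multiplicative.ofAdd (V.wt j)) :=
  Matrix.mul_diagonal _ _ _ _

lemma torusHom_conj_apply (t : Torus X S) (A : Matrix J J S) (i j : J) :
    ((V.torusHom S t : Matrix J J S) * A * ((V.torusHom S t)⁻¹ : Matrix.GeneralLinearGroup J S)) i j
      = t (Multiplicative.ofAdd (V.wt i - V.wt j)) * A i j := by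
  have h : ((V.torusHom S t)⁻¹ : Matrix.GeneralLinearGroup J S) = V.torusHom S t⁻¹ :=
    (map_inv (V.torusHom S) t).symm
  rw [h, mul_torusHom_apply, torusHom_mul_apply, ofAdd_sub, map_div, div_eq_mul_inv,
    MonoidHom.inv_apply, Units.val_mul]
  ring

/-! ### Words in the representatives and weights -/

/-- The product of the reflections in a list of roots, acting on the character lattice. -/
def wordRefl (P : RootDatum ι X Y) (l : List ι) : X →ₗ[ℤ] X :=
  (l.map fun α => ((P.reflection α : X ≃ₗ[ℤ] X) : Module.End ℤ X)).prod

omit [Finite ι] in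
lemma wordRefl_cons (α : ι) (l : List ι) (x : X) :
    wordRefl P (α :: l) x = P.reflection α (wordRefl P l x) := by
  simp [wordRefl, Module.End.mul_apply]

omit [Finite ι] in
lemma root_wordPerm (l : List ι) (β : ι) :
    P.root (wordPerm P l β) = wordRefl P l (P.root β) := by
  induction l with
  | nil => simp [wordPerm, wordRefl]
  | cons α l ih => rw [wordPerm_cons, wordRefl_cons, P.root_reflectionPerm, ih]

lemma wt_of_weylWord (l : List ι) {i j : J} (h : (V.weylWord S l : Matrix J J S) i j ≠ 0) :
    V.wt i = wordRefl P l (V.wt j) := by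
  induction l generalizing i with
  | nil =>
    have : i = j := by
      by_contra hij
      exact h (by simp [weylWord, hij])
    simp [wordRefl, this]
  | cons α l ih =>
    rw [weylWord_cons, Units.val_mul, Matrix.mul_apply] at h
    obtain ⟨m, -, hm⟩ := Finset.exists_ne_zero_of_sum_ne_zero h
    rw [wordRefl_cons, ← ih (right_ne_zero_of_mul hm)]
    exact V.wt_of_weyl (root_negRoot α) (left_ne_zero_of_mul hm)

/-- If the heights of the weights do not increase under a product of simple reflections, then the
product is trivial. -/
lemma weylWord_mem_range_torusHom_of_le [P.IsReduced] {F : Type*} [Field F] (b : P.Base)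
    (l : List ι) (hl : ∀ i ∈ l, i ∈ b.support)
    (h : ∀ j, ht b (wordRefl P l (V.wt j)) ≤ ht b (V.wt j)) :
    ∃ t, V.weylWord F l = V.torusHom F t := by
  have hdet : (V.weylWord F l : Matrix J J F).det ≠ 0 :=
    ((Matrix.isUnit_iff_isUnit_det _).1 (V.weylWord F l).isUnit).ne_zero
  rw [Matrix.det_apply] at hdet
  obtain ⟨σ, -, hσ⟩ := Finset.exists_ne_zero_of_sum_ne_zero hdet
  have hσ' : ∀ j, V.wt (σ j) = wordRefl P l (V.wt j) := by
    intro j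
    refine V.wt_of_weylWord (S := F) l fun h0 => hσ ?_
    have h1 : ∏ i, (V.weylWord F l : Matrix J J F) (σ i) i = 0 :=
      Finset.prod_eq_zero (Finset.mem_univ j) h0
    rw [h1, smul_zero]
  -- the product permutes the weights, so that the sum of their heights does not change
  have hsum : ∑ j, ht b (wordRefl P l (V.wt j)) = ∑ j, ht b (V.wt j) := by
    rw [← Equiv.sum_comp σ fun j => ht b (V.wt j)]
    exact Finset.sum_congr rfl fun j _ => by rw [hσ']
  have heq : ∀ j, ht b (wordRefl P l (V.wt j)) = ht b (V.wt j) := fun j =>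
    (Finset.sum_eq_sum_iff_of_le fun j _ => h j).1 hsum j (Finset.mem_univ j)
  have hX : ∀ x ∈ AddSubgroup.closure (Set.range V.wt), ht b (wordRefl P l x) = ht b x := by
    intro x hx
    induction hx using AddSubgroup.closure_induction with
    | mem x hx =>
      obtain ⟨j, rfl⟩ := hx
      exact heq j
    | zero => simp
    | add x y _ _ hx hy => simp [hx, hy]
    | neg x _ hx => simp [hx]
  refine V.weylWord_mem_range_torusHom b l hl fun α hα => ?_
  rw [isPos_iff_ht, root_wordPerm, hX _ (by rw [V.closure_wt]; trivial), ← isPos_iff_ht]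
  exact b.isPos_of_mem_support hα

end ChevalleyLattice

namespace ChevalleyLattice

open ValuativeRel (valuation)

variable {ι X Y : Type*} [Finite ι] [AddCommGroup X] [AddCommGroup Y] {P : RootDatum ι X Y}
  {J : Type*} [Fintype J] [DecidableEq J] (V : ChevalleyLattice P J)
  {F : Type*} [Field F] [ValuativeRel F]

/-! ### Integral matrices and reduction -/

lemma residue_eq_zero_iff_valuation_lt_one (x : 𝒪[F]) :
    IsLocalRing.residue 𝒪[F] x = 0 ↔ valuation F (x : F) < 1 := by
  rw [IsLocalRing.residue_eq_zero_iff, IsLocalRing.mem_maximalIdeal, mem_nonunits_iff,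
    Valuation.Integer.not_isUnit_iff_valuation_lt_one]

omit [Fintype J] [DecidableEq J] in
/-- A matrix over `F` with integral entries comes from a matrix over `𝒪`. -/
lemma exists_map_eq {A : Matrix J J F} (h : ∀ i j, valuation F (A i j) ≤ 1) :
    ∃ B : Matrix J J 𝒪[F], A = B.map 𝒪[F].subtype :=
  ⟨Matrix.of fun i j => ⟨A i j, h i j⟩, rfl⟩

/-- A matrix over `𝒪` with invertible reduction is invertible. -/
lemma exists_generalLinearGroup_eq {A : Matrix J J 𝒪[F]}
    (h : IsUnit (A.map (IsLocalRing.residue 𝒪[F]))) :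
    ∃ g : Matrix.GeneralLinearGroup J 𝒪[F], (g : Matrix J J 𝒪[F]) = A := by
  rw [Matrix.isUnit_iff_isUnit_det] at h
  have h1 : (A.map (IsLocalRing.residue 𝒪[F])).det = IsLocalRing.residue 𝒪[F] A.det :=
    (RingHom.map_det _ A).symm
  rw [h1, isUnit_map_iff, ← Matrix.isUnit_iff_isUnit_det] at h
  exact h

variable (J F) in
/-- The image of `GL_J(𝒪)` in `GL_J(F)`. -/
noncomputable def intGL : Subgroup (Matrix.GeneralLinearGroup J F) :=
  (Matrix.GeneralLinearGroup.map 𝒪[F].subtype).range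

lemma mem_intGL_iff {g : Matrix.GeneralLinearGroup J F} :
    g ∈ intGL J F ↔ (∀ i j, valuation F ((g : Matrix J J F) i j) ≤ 1) ∧
      ∀ i j, valuation F (((g⁻¹ : Matrix.GeneralLinearGroup J F) : Matrix J J F) i j) ≤ 1 := by
  constructor
  · rintro ⟨g, rfl⟩
    refine ⟨fun i j => ((g : Matrix J J 𝒪[F]) i j).2, fun i j => ?_⟩
    rw [← map_inv]
    exact (((g⁻¹ : Matrix.GeneralLinearGroup J 𝒪[F]) : Matrix J J 𝒪[F]) i j).2
  · rintro ⟨h, h'⟩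
    obtain ⟨A, hA⟩ := exists_map_eq h
    obtain ⟨B, hB⟩ := exists_map_eq h'
    have hinj : Function.Injective fun x : Matrix J J 𝒪[F] => x.map 𝒪[F].subtype :=
      Matrix.map_injective Subtype.val_injective
    have hone : (1 : Matrix J J 𝒪[F]).map 𝒪[F].subtype = 1 :=
      Matrix.map_one _ (by simp) (by simp)
    refine ⟨⟨A, B, hinj ?_, hinj ?_⟩, Units.ext hA.symm⟩
    · simp only
      rw [Matrix.map_mul, ← hA, ← hB, hone, ← Units.val_mul, mul_inv_cancel, Units.val_one]
    · simp only
      rw [Matrix.map_mul, ← hA, ← hB, hone, ← Units.val_mul, inv_mul_cancel, Units.val_one]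

/-- The preimage of `U(𝓀)` in `GL_J(𝒪)`, as a subgroup of `GL_J(F)`. -/
noncomputable def iwahoriGL (b : P.Base) (F : Type*) [Field F] [ValuativeRel F] :
    Subgroup (Matrix.GeneralLinearGroup J F) :=
  ((V.unipotent b 𝓀[F]).comap (Matrix.GeneralLinearGroup.map (IsLocalRing.residue 𝒪[F]))).map
    (Matrix.GeneralLinearGroup.map 𝒪[F].subtype)

lemma mem_iwahori_iff {b : P.Base} {g : V.points F} :
    g ∈ V.iwahori F b ↔ (g : Matrix.GeneralLinearGroup J F) ∈ V.iwahoriGL b F := Iff.rfl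

lemma mem_iwahoriGL_iff {b : P.Base} {g : Matrix.GeneralLinearGroup J F} :
    g ∈ V.iwahoriGL b F ↔ ∃ A : Matrix J J 𝒪[F], (g : Matrix J J F) = A.map 𝒪[F].subtype ∧
      ∃ h ∈ V.unipotent b 𝓀[F],
        A.map (IsLocalRing.residue 𝒪[F]) = (h : Matrix J J 𝓀[F]) := by
  constructor
  · rintro ⟨g, hg, rfl⟩
    exact ⟨g, rfl, _, hg, rfl⟩
  · rintro ⟨A, hA, h, hh, e⟩
    obtain ⟨g', rfl⟩ := exists_generalLinearGroup_eq (A := A) (e ▸ h.isUnit)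
    refine ⟨g', ?_, Units.ext hA.symm⟩
    have : Matrix.GeneralLinearGroup.map (IsLocalRing.residue 𝒪[F]) g' = h := Units.ext e
    rwa [← this] at hh

lemma iwahoriGL_le_intGL (b : P.Base) : V.iwahoriGL b F ≤ intGL J F := by
  rintro _ ⟨g, -, rfl⟩
  exact ⟨g, rfl⟩

omit [Fintype J] in
lemma valuation_sub_one_le {A : Matrix J J F} {i j : J} (h : valuation F (A i j) ≤ 1) :
    valuation F (A i j - (1 : Matrix J J F) i j) ≤ 1 := by
  refine (Valuation.map_sub _ _ _).trans (max_le h ?_)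
  rw [Matrix.one_apply]
  split_ifs <;> simp

omit [Fintype J] in
lemma map_residue_eq_iff {A : Matrix J J 𝒪[F]} {i j : J} :
    IsLocalRing.residue 𝒪[F] (A i j) = (1 : Matrix J J 𝓀[F]) i j ↔
      valuation F (A.map 𝒪[F].subtype i j - (1 : Matrix J J F) i j) < 1 := by
  have h1 : IsLocalRing.residue 𝒪[F] ((1 : Matrix J J 𝒪[F]) i j) = (1 : Matrix J J 𝓀[F]) i j := by
    rw [Matrix.one_apply, Matrix.one_apply]
    split_ifs <;> simp
  have h2 : A.map 𝒪[F].subtype i j - (1 : Matrix J J F) i j =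
      ((A i j - (1 : Matrix J J 𝒪[F]) i j : 𝒪[F]) : F) := by
    rw [Matrix.one_apply, Matrix.one_apply]
    split_ifs <;> simp
  rw [h2, ← residue_eq_zero_iff_valuation_lt_one, map_sub, h1, sub_eq_zero]

/-- An element of the principal congruence subgroup lies in the pro-`p` Iwahori subgroup. -/
lemma mem_iwahoriGL_of_valuation_lt_one (b : P.Base) {g : Matrix.GeneralLinearGroup J F}
    (h : ∀ i j, valuation F ((g : Matrix J J F) i j - (1 : Matrix J J F) i j) < 1) :
    g ∈ V.iwahoriGL b F := by
  obtain ⟨A, hA⟩ := exists_map_eq (A := (g : Matrix J J F)) fun i j => by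
    have h1 : valuation F ((1 : Matrix J J F) i j) ≤ 1 := by
      rw [Matrix.one_apply]
      split_ifs <;> simp
    rw [← sub_add_cancel ((g : Matrix J J F) i j) ((1 : Matrix J J F) i j)]
    exact (Valuation.map_add _ _ _).trans (max_le (h i j).le h1)
  refine V.mem_iwahoriGL_iff.2 ⟨A, hA, 1, one_mem _, ?_⟩
  ext i j
  rw [Matrix.map_apply, Units.val_one, map_residue_eq_iff, ← hA]
  exact h i j

lemma valuation_apply_le_one {b : P.Base} {g : Matrix.GeneralLinearGroup J F}
    (hg : g ∈ V.iwahoriGL b F) (i j : J) : valuation F ((g : Matrix J J F) i j) ≤ 1 :=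
  (mem_intGL_iff.1 (V.iwahoriGL_le_intGL b hg)).1 i j

lemma valuation_apply_sub_lt_one [P.IsReduced] {b : P.Base} {g : Matrix.GeneralLinearGroup J F}
    (hg : g ∈ V.iwahoriGL b F) {i j : J} (hij : ht b (V.wt i) ≤ ht b (V.wt j)) :
    valuation F ((g : Matrix J J F) i j - (1 : Matrix J J F) i j) < 1 := by
  obtain ⟨A, hA, h, hh, e⟩ := V.mem_iwahoriGL_iff.1 hg
  rw [hA, ← map_residue_eq_iff, ← V.isUnitri_unipotent hh i j hij, ← e, Matrix.map_apply]

/-- Let `g` be integral with unitriangular reduction, and let `x` be a nonzero vector. Among the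
coordinates of `x` of maximal absolute value take one of minimal height. Then this coordinate of
`g x` is nonzero. -/
lemma exists_mulVec_apply_ne_zero {s : J → ℤ} {g : Matrix J J F}
    (h1 : ∀ i j, valuation F (g i j) ≤ 1)
    (h2 : ∀ i j, s i ≤ s j → valuation F (g i j - (1 : Matrix J J F) i j) < 1) {x : J → F}
    (hx : x ≠ 0) :
    ∃ i, g.mulVec x i ≠ 0 ∧ x i ≠ 0 ∧ (∀ j, valuation F (x j) ≤ valuation F (x i)) ∧
      ∀ j, valuation F (x j) = valuation F (x i) → s i ≤ s j := by
  classical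
  obtain ⟨i₁, hi₁⟩ := Function.ne_iff.1 hx
  obtain ⟨i₀, -, hi₀⟩ := Finset.exists_max_image Finset.univ (fun j => valuation F (x j))
    ⟨i₁, Finset.mem_univ _⟩
  obtain ⟨i, hi, hmin⟩ := Finset.exists_min_image
    (Finset.univ.filter fun j => valuation F (x j) = valuation F (x i₀)) s
    ⟨i₀, Finset.mem_filter.2 ⟨Finset.mem_univ _, rfl⟩⟩
  have hii := (Finset.mem_filter.1 hi).2
  have hmax : ∀ j, valuation F (x j) ≤ valuation F (x i) := fun j =>
    hii ▸ hi₀ j (Finset.mem_univ j)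
  have hs : ∀ j, valuation F (x j) = valuation F (x i) → s i ≤ s j := fun j hj =>
    hmin j (Finset.mem_filter.2 ⟨Finset.mem_univ _, hj.trans hii⟩)
  have hne : valuation F (x i) ≠ 0 := by
    intro h0
    have h3 := hmax i₁
    rw [h0, le_zero_iff, map_eq_zero] at h3
    exact hi₁ h3
  have hxi : x i ≠ 0 := fun h0 => hne (by rw [h0, map_zero])
  refine ⟨i, ?_, hxi, hmax, hs⟩
  have hsum : g.mulVec x i = x i + ∑ j, (g i j - (1 : Matrix J J F) i j) * x j := by
    simp only [sub_mul, Finset.sum_sub_distrib]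
    have : ∑ j, (1 : Matrix J J F) i j * x j = x i := by
      simp [Matrix.one_apply]
    rw [this]
    simp [Matrix.mulVec, dotProduct]
  have hlt : valuation F (∑ j, (g i j - (1 : Matrix J J F) i j) * x j) < valuation F (x i) := by
    refine Valuation.map_sum_lt _ hne fun j _ => ?_
    rw [map_mul]
    rcases (hmax j).lt_or_eq with hj | hj
    · exact (mul_le_of_le_one_left' (valuation_sub_one_le (h1 i j))).trans_lt hj
    · rw [hj]
      exact mul_lt_of_lt_one_left (zero_lt_iff.2 hne) (h2 i j (hs j hj))
  intro h0
  have h3 := Valuation.map_add_eq_of_lt_left (v := valuation F) hlt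
  rw [← hsum, h0, map_zero] at h3
  exact hne h3.symm

/-- The Iwahori factorization `I = (T ∩ I) (U ∩ I) (U⁻ ∩ I)`. -/
theorem exists_iwahori_factorization [P.IsReduced] {b : P.Base}
    {g : Matrix.GeneralLinearGroup J F} (hg : g ∈ V.iwahoriGL b F) (hgp : g ∈ V.points F) :
    ∃ t, V.torusHom F t ∈ V.iwahoriGL b F ∧ ∃ u ∈ V.unipotent b F, u ∈ V.iwahoriGL b F ∧
      ∃ n ∈ V.oppUnipotent b F, n ∈ V.iwahoriGL b F ∧ g = V.torusHom F t * u * n := by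
  obtain ⟨t, u, hu, l, hl, n, hn, e⟩ := V.exists_birkhoff b hgp
  have hu' := V.isUnitri_unipotent hu
  have hn' := V.isUnitri_oppUnipotent (inv_mem hn)
  have hg1 := fun i j => V.valuation_apply_le_one hg i j
  have hg2 : ∀ i j, ht b (V.wt i) ≤ ht b (V.wt j) → _ := fun i j hij =>
    V.valuation_apply_sub_lt_one hg hij
  -- the columns of `n⁻¹`
  let x : J → J → F := fun j i =>
    ((n⁻¹ : Matrix.GeneralLinearGroup J F) : Matrix J J F) i j
  have hxx : ∀ j, x j j = 1 := fun j => (hn' j j le_rfl).trans (Matrix.one_apply_eq j)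
  have hx0 : ∀ j i, x j i ≠ 0 → i ≠ j → ht b (V.wt i) < ht b (V.wt j) := by
    intro j i h0 hij
    by_contra hle
    refine h0 ((hn' i j ?_).trans (Matrix.one_apply_ne hij))
    simpa using hle
  have hxne : ∀ j, x j ≠ 0 := fun j h0 => one_ne_zero ((hxx j).symm.trans (congrFun h0 j))
  have hmulVec : ∀ (A : Matrix.GeneralLinearGroup J F), g = A * n → ∀ i j,
      (g : Matrix J J F).mulVec (x j) i = (A : Matrix J J F) i j := by
    intro A hA i j
    have h1 : A = g * n⁻¹ := by rw [hA, mul_inv_cancel_right]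
    rw [h1, Units.val_mul, Matrix.mul_apply]
    rfl
  obtain ⟨t', ht'⟩ := V.weylWord_mem_range_torusHom_of_le (F := F) b l hl fun j => by
    obtain ⟨i, hi, hxi, -, -⟩ := exists_mulVec_apply_ne_zero (s := fun j => ht b (V.wt j))
      hg1 hg2 (hxne j)
    rw [hmulVec (V.torusHom F t * u * V.weylWord F l) (by rw [e]; group), Units.val_mul,
      Matrix.mul_apply] at hi
    obtain ⟨m, -, hm⟩ := Finset.exists_ne_zero_of_sum_ne_zero hi
    rw [← V.wt_of_weylWord l (right_ne_zero_of_mul hm)]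
    have h1 : ht b (V.wt m) ≤ ht b (V.wt i) := by
      by_contra hlt
      have h2 := left_ne_zero_of_mul hm
      rw [Units.val_mul, torusHom_mul_apply, hu' i m (by lia), Matrix.one_apply_ne, mul_zero] at h2
      · exact h2 rfl
      · rintro rfl
        exact hlt le_rfl
    rcases eq_or_ne i j with rfl | hij
    · exact h1
    · exact h1.trans (hx0 j i hxi hij).le
  -- thus `g = (t t') u' n`
  set u' := V.torusHom F t'⁻¹ * u * (V.torusHom F t'⁻¹)⁻¹ with hu'_def
  have hu'U : u' ∈ V.unipotent b F := V.torusHom_conj_mem_rootGroup t'⁻¹ hu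
  have hu'T := V.isUnitri_unipotent hu'U
  have e' : g = V.torusHom F (t * t') * u' * n := by
    rw [e, ht', hu'_def, map_mul, torus_map_inv]
    group
  have hcol : ∀ i j, i ≠ j → valuation F (x j i) < 1 := by
    intro i j hij
    obtain ⟨m, hm, hxm, hmax, hmin⟩ := exists_mulVec_apply_ne_zero
      (s := fun j => ht b (V.wt j)) hg1 hg2 (hxne j)
    have hmj : m = j := by
      by_contra hmj
      rw [hmulVec _ e', Units.val_mul, torusHom_mul_apply, hu'T m j (hx0 j m hxm hmj).le,
        Matrix.one_apply_ne hmj, mul_zero] at hm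
      exact hm rfl
    subst hmj
    have h1 := hmax i
    rw [hxx, map_one] at h1
    refine lt_of_le_of_ne h1 fun h2 => ?_
    have h3 := hmin i (by rw [hxx, map_one, h2])
    have h4 := hx0 m i (fun h0 => by rw [h0, map_zero] at h2; exact zero_ne_one h2) hij
    exact absurd h3 (not_le.2 h4)
  have hninv : n⁻¹ ∈ V.iwahoriGL b F := by
    refine V.mem_iwahoriGL_of_valuation_lt_one b fun i j => ?_
    by_cases hij : i = j
    · subst hij
      have := hxx i
      simp only [x] at this
      rw [this, Matrix.one_apply_eq, sub_self, map_zero]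
      exact zero_lt_one
    · rw [Matrix.one_apply_ne hij, sub_zero]
      exact hcol i j hij
  have hnI := (Subgroup.inv_mem_iff _).1 hninv
  have htu : V.torusHom F (t * t') * u' ∈ V.iwahoriGL b F := by
    have : V.torusHom F (t * t') * u' = g * n⁻¹ := by rw [e', mul_inv_cancel_right]
    rw [this]
    exact mul_mem hg hninv
  have htI : V.torusHom F (t * t') ∈ V.iwahoriGL b F := by
    refine V.mem_iwahoriGL_of_valuation_lt_one b fun i j => ?_
    by_cases hij : i = j
    · subst hij
      have h1 := V.valuation_apply_sub_lt_one htu (le_refl (ht b (V.wt i)))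
      rw [Units.val_mul, torusHom_mul_apply, hu'T i i le_rfl, Matrix.one_apply_eq, mul_one] at h1
      rw [torusHom_apply, if_pos rfl, Matrix.one_apply_eq]
      exact h1
    · rw [torusHom_apply, if_neg hij, Matrix.one_apply_ne hij, sub_zero, map_zero]
      exact zero_lt_one
  exact ⟨_, htI, u', hu'U, (Subgroup.mul_mem_cancel_left _ htI).1 htu, n, hn, hnI, e'⟩

end ChevalleyLattice

namespace ChevalleyLattice

open ValuativeRel (valuation)

variable {ι X Y : Type*} [Finite ι] [AddCommGroup X] [AddCommGroup Y] {P : RootDatum ι X Y}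
  {J : Type*} [Fintype J] [DecidableEq J] (V : ChevalleyLattice P J)
  {F : Type*} [Field F]

/-! ### Subgroups of the group of points -/

/-- The subgroup `U⁻` of `G` opposite to `U`. -/
def oppPoints (F : Type*) [Field F] (b : P.Base) : Subgroup (V.points F) :=
  (V.oppUnipotent b F).subgroupOf (V.points F)

lemma coe_torusPoints (t : Torus X F) :
    (V.torusPoints F t : Matrix.GeneralLinearGroup J F) = V.torusHom F t := rfl

lemma unipotent_le_points (b : P.Base) : V.unipotent b F ≤ V.points F := by
  refine (Subgroup.closure_le _).2 ?_
  rintro g ⟨α, -, u, hg⟩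
  exact Subgroup.subset_closure (Or.inr ⟨α, u, hg⟩)

lemma oppUnipotent_le_points (b : P.Base) : V.oppUnipotent b F ≤ V.points F := by
  refine (Subgroup.closure_le _).2 ?_
  rintro g ⟨α, -, u, hg⟩
  exact Subgroup.subset_closure (Or.inr ⟨α, u, hg⟩)

variable {V} {b : P.Base}

lemma torusPoints_conj_mem_unipotentPoints (t : Torus X F) {u : V.points F}
    (hu : u ∈ V.unipotentPoints F b) :
    V.torusPoints F t * u * (V.torusPoints F t)⁻¹ ∈ V.unipotentPoints F b :=
  V.torusHom_conj_mem_rootGroup (p := b.IsPos) t hu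

variable [ValuativeRel F]

variable (V F) in
/-- The maximal compact subgroup `K = G ∩ GL_J(𝒪)` of `G`. -/
noncomputable def intPoints : Subgroup (V.points F) := (intGL J F).subgroupOf (V.points F)

lemma iwahori_le_intPoints : V.iwahori F b ≤ V.intPoints F := fun _ hg =>
  V.iwahoriGL_le_intGL b hg

lemma mem_iwahori_of_valuation_lt_one {g : V.points F}
    (h : ∀ i j, valuation F ((g.1 : Matrix J J F) i j - (1 : Matrix J J F) i j) < 1) :
    g ∈ V.iwahori F b := V.mem_iwahoriGL_of_valuation_lt_one b h

lemma exists_eq_mul_of_mem_iwahori [P.IsReduced] {g : V.points F} (hg : g ∈ V.iwahori F b) :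
    ∃ t, V.torusPoints F t ∈ V.iwahori F b ∧ ∃ u ∈ V.unipotentPoints F b, u ∈ V.iwahori F b ∧
      ∃ n ∈ V.oppPoints F b, n ∈ V.iwahori F b ∧ g = V.torusPoints F t * u * n := by
  obtain ⟨t, ht, u, hu, hu', n, hn, hn', e⟩ := V.exists_iwahori_factorization hg g.2
  exact ⟨t, ht, ⟨u, V.unipotent_le_points b hu⟩, hu, hu', ⟨n, V.oppUnipotent_le_points b hn⟩, hn,
    hn', Subtype.ext e⟩

lemma torusPoints_mem_iwahori [P.IsReduced] {t : Torus X F} {u : V.points F}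
    (hu : u ∈ V.unipotentPoints F b) (h : V.torusPoints F t * u ∈ V.iwahori F b) :
    V.torusPoints F t ∈ V.iwahori F b := by
  have hu' := V.isUnitri_unipotent (b := b) (g := u.1) hu
  refine mem_iwahori_of_valuation_lt_one fun i j => ?_
  by_cases hij : i = j
  · subst hij
    have h1 := V.valuation_apply_sub_lt_one (g := (V.torusPoints F t * u).1) h
      (le_refl (ht b (V.wt i)))
    have h2 : ((V.torusPoints F t * u).1 : Matrix J J F) i i =
        t (Multiplicative.ofAdd (V.wt i)) * (u.1 : Matrix J J F) i i :=
      V.torusHom_mul_apply t _ i i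
    rw [h2, hu' i i le_rfl, Matrix.one_apply_eq, mul_one] at h1
    rw [coe_torusPoints, torusHom_apply, if_pos rfl, Matrix.one_apply_eq]
    exact h1
  · rw [coe_torusPoints, torusHom_apply, if_neg hij, Matrix.one_apply_ne hij, sub_zero, map_zero]
    exact zero_lt_one

/-- The characters on which `t` takes integral values. -/
def integralCharacters (t : Torus X F) : AddSubmonoid X where
  carrier := {x | valuation F (t (Multiplicative.ofAdd x) : F) ≤ 1}
  zero_mem' := by simp
  add_mem' {x y} hx hy := by
    change valuation F (t (Multiplicative.ofAdd (x + y)) : F) ≤ 1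
    rw [ofAdd_add, map_mul, Units.val_mul, map_mul]
    exact mul_le_one' hx hy

/-- Conjugation by an antidominant element contracts `U ∩ I`. -/
lemma torusPoints_conj_mem_iwahori {t : Torus X F} (ht : IsAntidominant (P := P) b t)
    {u : V.points F} (hu : u ∈ V.unipotentPoints F b) (huI : u ∈ V.iwahori F b) :
    V.torusPoints F t * u * (V.torusPoints F t)⁻¹ ∈ V.iwahori F b := by
  classical
  obtain ⟨A, hA, h, hh, e⟩ := V.mem_iwahoriGL_iff.1 huI
  let χ : X → 𝒪[F] := fun x =>
    if hx : x ∈ integralCharacters t then ⟨t (Multiplicative.ofAdd x), hx⟩ else 0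
  have hχ : ∀ x ∈ integralCharacters t, (χ x : F) = t (Multiplicative.ofAdd x) := by
    intro x hx
    simp only [χ, dif_pos hx]
  have hχ0 : χ 0 = 1 := Subtype.ext (by rw [hχ 0 (zero_mem _)]; simp)
  have hχm : ∀ x ∈ integralCharacters t, ∀ y ∈ integralCharacters t,
      χ (x + y) = χ x * χ y := by
    intro x hx y hy
    refine Subtype.ext ?_
    rw [hχ _ (add_mem hx hy), Subring.coe_mul, hχ x hx, hχ y hy, ofAdd_add, map_mul, Units.val_mul]
  have hsupp := suppIn_of_mem_rootGroup (V := V) (p := b.IsPos) (M := integralCharacters t)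
    (fun α hα => ht α hα) (g := u.1) hu
  obtain ⟨h', hh', e'⟩ := exists_eq_twist_of_mem_rootGroup (V := V) (p := b.IsPos)
    (M := integralCharacters t) (χ := fun x => IsLocalRing.residue 𝒪[F] (χ x))
    (by rw [hχ0, map_one]) (fun x hx y hy => by rw [hχm x hx y hy, map_mul]) (fun α hα => ht α hα)
    (g := h) hh
  refine V.mem_iwahori_iff.2 (V.mem_iwahoriGL_iff.2 ⟨V.twist χ A, ?_, h', hh', ?_⟩)
  · ext i j
    have h1 : ((V.torusPoints F t * u * (V.torusPoints F t)⁻¹).1 : Matrix J J F) i j =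
        t (Multiplicative.ofAdd (V.wt i - V.wt j)) * (u.1 : Matrix J J F) i j :=
      V.torusHom_conj_apply t _ i j
    rw [h1, Matrix.map_apply]
    change _ = ((χ (V.wt i - V.wt j) * A i j : 𝒪[F]) : F)
    have h2 : (u.1 : Matrix J J F) i j = A i j := congrFun (congrFun hA i) j
    rw [Subring.coe_mul, ← h2]
    by_cases h0 : (u.1 : Matrix J J F) i j = 0
    · rw [h0, mul_zero, mul_zero]
    · rw [hχ _ (hsupp i j h0)]
  · rw [e', ← e]
    ext i j
    simp [twist]

/-- The entries of an element of `U⁻ ∩ I` outside the diagonal lie in the maximal ideal. -/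
lemma valuation_sub_one_lt_of_mem_oppPoints [P.IsReduced] {n : V.points F}
    (hn : n ∈ V.oppPoints F b) (hnI : n ∈ V.iwahori F b) (i j : J) :
    valuation F ((n.1 : Matrix J J F) i j - (1 : Matrix J J F) i j) < 1 := by
  rcases le_total (ht b (V.wt i)) (ht b (V.wt j)) with h | h
  · exact V.valuation_apply_sub_lt_one hnI h
  · have h1 := V.isUnitri_oppUnipotent (b := b) (g := n.1) hn i j (by simpa using h)
    rw [h1, sub_self, map_zero]
    exact zero_lt_one

/-- Conjugation by the inverse of an antidominant element contracts `U⁻ ∩ I`. -/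
lemma torusPoints_inv_conj_mem_iwahori [P.IsReduced] {t : Torus X F}
    (ht : IsAntidominant (P := P) b t) {n : V.points F} (hn : n ∈ V.oppPoints F b)
    (hnI : n ∈ V.iwahori F b) :
    (V.torusPoints F t)⁻¹ * n * V.torusPoints F t ∈ V.iwahori F b := by
  have hsupp := suppIn_of_mem_rootGroup (V := V) (p := fun α => ¬ b.IsPos α)
    (M := integralCharacters t⁻¹) (fun α hα => ?_) (g := n.1) hn
  · refine mem_iwahori_of_valuation_lt_one fun i j => ?_
    have h1 : (((V.torusPoints F t)⁻¹ * n * V.torusPoints F t).1 : Matrix J J F) i j =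
        t⁻¹ (Multiplicative.ofAdd (V.wt i - V.wt j)) * (n.1 : Matrix J J F) i j := by
      rw [← V.torusHom_conj_apply t⁻¹, torus_map_inv, inv_inv]
      rfl
    have h2 := valuation_sub_one_lt_of_mem_oppPoints hn hnI i j
    rw [h1]
    by_cases hij : i = j
    · subst hij
      simpa using h2
    · rw [Matrix.one_apply_ne hij, sub_zero] at h2 ⊢
      by_cases h0 : (n.1 : Matrix J J F) i j = 0
      · rw [h0, mul_zero, map_zero]
        exact zero_lt_one
      · rw [map_mul]
        exact (mul_le_of_le_one_left' (hsupp i j h0)).trans_lt h2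
  · have h1 := ht (negRoot P α) ((isPos_negRoot b α).2 hα)
    rw [root_negRoot, ofAdd_neg, map_inv] at h1
    exact h1

/-! ### The torus and the maximal compact subgroup -/

lemma mem_intPoints_iff {g : V.points F} :
    g ∈ V.intPoints F ↔ (∀ i j, valuation F ((g.1 : Matrix J J F) i j) ≤ 1) ∧
      ∀ i j, valuation F (((g⁻¹ : V.points F).1 : Matrix J J F) i j) ≤ 1 :=
  mem_intGL_iff

lemma torusPoints_mem_intPoints [P.IsReduced] {t : Torus X F} {u : V.points F}
    (hu : u ∈ V.unipotentPoints F b) (h : V.torusPoints F t * u ∈ V.intPoints F) :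
    V.torusPoints F t ∈ V.intPoints F := by
  have hu' := V.isUnitri_unipotent (b := b) (g := u.1) hu
  have hu'' := V.isUnitri_unipotent (b := b) (g := (u⁻¹).1) (inv_mem hu)
  rw [mem_intPoints_iff] at h
  rw [mem_intPoints_iff, ← map_inv]
  constructor <;> intro i j <;> rw [coe_torusPoints, torusHom_apply] <;> split_ifs with hij
  · have h1 : ((V.torusPoints F t * u).1 : Matrix J J F) i i =
        t (Multiplicative.ofAdd (V.wt i)) * (u.1 : Matrix J J F) i i :=
      V.torusHom_mul_apply t _ i i
    have h2 := h.1 i i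
    rwa [h1, hu' i i le_rfl, Matrix.one_apply_eq, mul_one] at h2
  · simp
  · have h1 : (((V.torusPoints F t * u)⁻¹ : V.points F).1 : Matrix J J F) i i =
        ((u⁻¹ : V.points F).1 : Matrix J J F) i i * t⁻¹ (Multiplicative.ofAdd (V.wt i)) := by
      rw [← mul_torusHom_apply, mul_inv_rev, ← map_inv]
      rfl
    have h2 := h.2 i i
    rwa [h1, hu'' i i le_rfl, Matrix.one_apply_eq, one_mul] at h2
  · simp

lemma valuation_eq_one_of_mem_intPoints {t : Torus X F} (h : V.torusPoints F t ∈ V.intPoints F)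
    (x : X) : valuation F (t (Multiplicative.ofAdd x) : F) = 1 := by
  have hx : x ∈ AddSubgroup.closure (Set.range V.wt) := by rw [V.closure_wt]; trivial
  rw [mem_intPoints_iff, ← map_inv] at h
  induction hx using AddSubgroup.closure_induction with
  | mem x hx =>
    obtain ⟨j, rfl⟩ := hx
    have h1 := h.1 j j
    have h2 := h.2 j j
    rw [coe_torusPoints, torusHom_apply, if_pos rfl] at h1 h2
    rw [MonoidHom.inv_apply, Units.val_inv_eq_inv_val, map_inv₀] at h2
    refine le_antisymm h1 ?_
    by_contra hlt
    have hne : valuation F (t (Multiplicative.ofAdd (V.wt j)) : F) ≠ 0 := by simp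
    exact hlt ((inv_le_one₀ (zero_lt_iff.2 hne)).1 h2)
  | zero => simp
  | add x y _ _ hx hy => rw [ofAdd_add, map_mul, Units.val_mul, map_mul, hx, hy, one_mul]
  | neg x _ hx => rw [ofAdd_neg, map_inv, Units.val_inv_eq_inv_val, map_inv₀, hx, inv_one]

lemma isAntidominant_of_mem_intPoints {t : Torus X F}
    (h : V.torusPoints F t ∈ V.intPoints F) : IsAntidominant (P := P) b t := fun α _ =>
  (valuation_eq_one_of_mem_intPoints h (P.root α)).le

omit [Finite ι] in
lemma IsAntidominant.mul {t t' : Torus X F} (h : IsAntidominant (P := P) b t)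
    (h' : IsAntidominant (P := P) b t') : IsAntidominant (P := P) b (t * t') := fun α hα => by
  rw [MonoidHom.mul_apply, Units.val_mul, map_mul]
  exact mul_le_one' (h α hα) (h' α hα)

omit [Finite ι] in
lemma isAntidominant_one : IsAntidominant (P := P) b (1 : Torus X F) := fun α _ => by simp

lemma rootUnit_mem_intGL {α : ι} {v : F} (hv : valuation F v ≤ 1) :
    V.rootUnit α v ∈ intGL J F :=
  ⟨V.rootUnit α (⟨v, hv⟩ : 𝒪[F]), Units.ext (V.rootMatrix_map 𝒪[F].subtype α ⟨v, hv⟩)⟩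

variable (b) in
/-- The Iwasawa decomposition `G = T U K`. -/
theorem exists_iwasawa [P.IsReduced] (g : V.points F) :
    ∃ t, ∃ u ∈ V.unipotentPoints F b, ∃ κ ∈ V.intPoints F, g = V.torusPoints F t * u * κ := by
  have hweyl : ∀ α, V.weylUnit F α ∈ intGL J F := fun α =>
    mul_mem (mul_mem (rootUnit_mem_intGL (by simp)) (rootUnit_mem_intGL (by simp)))
      (rootUnit_mem_intGL (by simp))
  have step : ∀ α ∈ b.support, ∀ (v : F) r, r ∈ intGL J F →
      V.weylUnit F α * V.rootUnit α v * r ∈ intGL J F ∨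
      ∃ w : Fˣ, (w : F) = v ∧ V.rootUnit (negRoot P α) ((w⁻¹ : Fˣ) : F) * r ∈ intGL J F := by
    intro α hα v r hr
    by_cases hv : valuation F v ≤ 1
    · exact Or.inl (mul_mem (mul_mem (hweyl α) (rootUnit_mem_intGL hv)) hr)
    · have hv0 : v ≠ 0 := by
        rintro rfl
        simp at hv
      refine Or.inr ⟨Units.mk0 v hv0, rfl, mul_mem (rootUnit_mem_intGL ?_) hr⟩
      rw [Units.val_inv_eq_inv_val, Units.val_mk0, map_inv₀]
      exact inv_le_one_of_one_le₀ (not_le.1 hv).le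
  obtain ⟨t, u, hu, r, hr, e⟩ := V.exists_eq_torus_mul_unipotent_mul b
    (Q := fun r => r ∈ intGL J F) (one_mem _) step g.2
  have hrp : r ∈ V.points F := by
    have : r = (V.torusHom F t * u)⁻¹ * g.1 := by rw [e]; group
    rw [this]
    exact mul_mem (inv_mem (mul_mem (V.torusPoints F t).2 (V.unipotent_le_points b hu))) g.2
  exact ⟨t, ⟨u, V.unipotent_le_points b hu⟩, hu, ⟨r, hrp⟩, hr, Subtype.ext e⟩

/-! ### A strictly antidominant element -/

variable (b) in
/-- The element `2ρ^∨(ϖ)` of the torus, `2ρ^∨` being the sum of the positive coroots. It is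
strictly antidominant when `v(ϖ) < 1`. -/
noncomputable def heightTorus (ϖ : Fˣ) : Torus X F where
  toFun x := ϖ ^ ht b x.toAdd
  map_one' := by simp
  map_mul' x y := by simp [zpow_add]

omit [ValuativeRel F] in
lemma heightTorus_pow_apply (ϖ : Fˣ) (m : ℕ) (x : X) :
    (heightTorus b ϖ ^ m) (Multiplicative.ofAdd x) = ϖ ^ (m * ht b x) := by
  rw [MonoidHom.pow_apply, mul_comm, zpow_mul, zpow_natCast]
  rfl

lemma valuation_heightTorus_pow_le {ϖ : Fˣ} (hϖ : valuation F (ϖ : F) < 1) (m : ℕ) {x : X}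
    (hx : 0 < ht b x) :
    valuation F ((heightTorus b ϖ ^ m) (Multiplicative.ofAdd x) : F) ≤ valuation F (ϖ : F) ^ m := by
  obtain ⟨r, hr⟩ : ∃ r : ℕ, ht b x = r := ⟨(ht b x).toNat, by lia⟩
  rw [heightTorus_pow_apply, hr]
  have h1 : ((ϖ ^ ((m : ℤ) * r) : Fˣ) : F) = (ϖ : F) ^ (m * r) := by
    rw [← Nat.cast_mul, zpow_natCast, Units.val_pow_eq_pow_val]
  rw [h1, map_pow]
  exact pow_le_pow_right_of_le_one' hϖ.le (Nat.le_mul_of_pos_right m (by lia))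

lemma isAntidominant_heightTorus_pow [P.IsReduced] {ϖ : Fˣ} (hϖ : valuation F (ϖ : F) < 1)
    (m : ℕ) : IsAntidominant (P := P) b (heightTorus b ϖ ^ m) := fun α hα =>
  (valuation_heightTorus_pow_le hϖ m ((isPos_iff_ht b α).1 hα)).trans (pow_le_one' hϖ.le m)

/-- Conjugation by a strictly antidominant element contracts `U`. -/
lemma heightTorus_conj_mem_iwahori [P.IsReduced] {ϖ : Fˣ} (hϖ : valuation F (ϖ : F) < 1) {m : ℕ}
    {u : V.points F} (hu : u ∈ V.unipotentPoints F b)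
    (hm : ∀ i j, valuation F (ϖ : F) ^ m * valuation F ((u.1 : Matrix J J F) i j) < 1) :
    V.torusPoints F (heightTorus b ϖ ^ m) * u * (V.torusPoints F (heightTorus b ϖ ^ m))⁻¹ ∈
      V.iwahori F b := by
  have hu' := V.isUnitri_unipotent (b := b) (g := u.1) hu
  refine mem_iwahori_of_valuation_lt_one fun i j => ?_
  have h1 : ((V.torusPoints F (heightTorus b ϖ ^ m) * u *
      (V.torusPoints F (heightTorus b ϖ ^ m))⁻¹).1 : Matrix J J F) i j =
      (heightTorus b ϖ ^ m) (Multiplicative.ofAdd (V.wt i - V.wt j)) * (u.1 : Matrix J J F) i j :=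
    V.torusHom_conj_apply _ _ i j
  rw [h1]
  by_cases hij : ht b (V.wt i) ≤ ht b (V.wt j)
  · rw [hu' i j hij]
    by_cases h : i = j
    · subst h
      simp
    · rw [Matrix.one_apply_ne h, mul_zero, sub_zero, map_zero]
      exact zero_lt_one
  · rw [Matrix.one_apply_ne (by rintro rfl; exact hij le_rfl), sub_zero, map_mul]
    refine (mul_le_mul_left ?_ _).trans_lt (hm i j)
    exact valuation_heightTorus_pow_le hϖ m (by rw [map_sub]; lia)

/-- Conjugation by the inverse of a strictly antidominant element contracts `U⁻ ∩ I`. -/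
lemma valuation_heightTorus_inv_conj_le [P.IsReduced] {ϖ : Fˣ} (hϖ : valuation F (ϖ : F) < 1)
    (m : ℕ) {n : V.points F} (hn : n ∈ V.oppPoints F b) (hnI : n ∈ V.iwahori F b) (i j : J) :
    valuation F ((((V.torusPoints F (heightTorus b ϖ ^ m))⁻¹ * n *
      V.torusPoints F (heightTorus b ϖ ^ m)).1 : Matrix J J F) i j - (1 : Matrix J J F) i j) ≤
      valuation F (ϖ : F) ^ m := by
  have hn' := V.isUnitri_oppUnipotent (b := b) (g := n.1) hn
  have h1 : (((V.torusPoints F (heightTorus b ϖ ^ m))⁻¹ * n *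
      V.torusPoints F (heightTorus b ϖ ^ m)).1 : Matrix J J F) i j =
      (heightTorus b ϖ ^ m) (Multiplicative.ofAdd (V.wt j - V.wt i)) *
        (n.1 : Matrix J J F) i j := by
    have h2 : (heightTorus b ϖ ^ m) (Multiplicative.ofAdd (V.wt j - V.wt i)) =
        (heightTorus b ϖ ^ m)⁻¹ (Multiplicative.ofAdd (V.wt i - V.wt j)) := by
      rw [MonoidHom.inv_apply, ← map_inv, ← ofAdd_neg, neg_sub]
    rw [h2, ← V.torusHom_conj_apply (heightTorus b ϖ ^ m)⁻¹, torus_map_inv, inv_inv]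
    rfl
  rw [h1]
  by_cases hij : ht b (V.wt j) ≤ ht b (V.wt i)
  · rw [hn' i j (by simpa using hij)]
    by_cases h : i = j
    · subst h
      simp
    · rw [Matrix.one_apply_ne h, mul_zero, sub_zero, map_zero]
      exact zero_le
  · rw [Matrix.one_apply_ne (by rintro rfl; exact hij le_rfl), sub_zero, map_mul]
    refine (mul_le_of_le_one_right' (V.valuation_apply_le_one hnI i j)).trans ?_
    exact valuation_heightTorus_pow_le hϖ m (by rw [map_sub]; lia)

end ChevalleyLattice

namespace ChevalleyLattice

open ValuativeRel (valuation)

variable {ι X Y : Type*} [Finite ι] [AddCommGroup X] [AddCommGroup Y] {P : RootDatum ι X Y}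
  {J : Type*} [Fintype J] [DecidableEq J] {V : ChevalleyLattice P J} {b : P.Base}
  {F : Type*} [Field F] [ValuativeRel F]

/-! ### Finiteness and topology -/

section

variable [Finite 𝓀[F]]

variable (V F b) in
/-- `I` has finite index in `K`. -/
lemma exists_finset_intPoints :
    ∃ s : Finset (V.points F), ∀ κ ∈ V.intPoints F, ∃ x ∈ s, κ * x⁻¹ ∈ V.iwahori F b := by
  classical
  have hlift : ∀ κ : V.intPoints F, ∃ g : Matrix.GeneralLinearGroup J 𝒪[F],
      Matrix.GeneralLinearGroup.map 𝒪[F].subtype g = κ.1.1 := fun κ => κ.2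
  choose l hl using hlift
  let ψ : V.intPoints F → Matrix.GeneralLinearGroup J 𝓀[F] := fun κ =>
    Matrix.GeneralLinearGroup.map (IsLocalRing.residue 𝒪[F]) (l κ)
  have hr : ∀ q : Set.range ψ, ∃ κ, ψ κ = q := fun q => q.2
  choose r hr using hr
  have hfin : Finite (Set.range ψ) := by
    have : Finite (Matrix J J 𝓀[F]) := inferInstanceAs (Finite (J → J → 𝓀[F]))
    have : Finite (Matrix.GeneralLinearGroup J 𝓀[F]) := inferInstance
    infer_instance
  refine ⟨(Set.range fun q => (r q : V.points F)).toFinite.toFinset, fun κ hκ => ?_⟩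
  refine ⟨r ⟨ψ ⟨κ, hκ⟩, ⟨κ, hκ⟩, rfl⟩, by simp, ?_⟩
  set κ' := r ⟨ψ ⟨κ, hκ⟩, ⟨κ, hκ⟩, rfl⟩ with hκ'
  have h1 : ψ κ' = ψ ⟨κ, hκ⟩ := hr ⟨ψ ⟨κ, hκ⟩, ⟨κ, hκ⟩, rfl⟩
  refine V.mem_iwahori_iff.2 ⟨l ⟨κ, hκ⟩ * (l κ')⁻¹, ?_, ?_⟩
  · change Matrix.GeneralLinearGroup.map (IsLocalRing.residue 𝒪[F]) (l ⟨κ, hκ⟩ * (l κ')⁻¹) ∈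
      V.unipotent b 𝓀[F]
    have h2 : Matrix.GeneralLinearGroup.map (IsLocalRing.residue 𝒪[F]) (l ⟨κ, hκ⟩ * (l κ')⁻¹) =
        1 := by
      rw [map_mul, map_inv]
      change ψ ⟨κ, hκ⟩ * (ψ κ')⁻¹ = 1
      rw [h1, mul_inv_cancel]
    rw [h2]
    exact one_mem _
  · rw [map_mul, map_inv, hl, hl]
    rfl

end

variable [TopologicalSpace F] [IsNonarchimedeanLocalField F]

variable (F) in
lemma exists_valuation_lt_one : ∃ ϖ : Fˣ, valuation F (ϖ : F) < 1 := by
  obtain ⟨x, h0, h1⟩ := Valuation.IsNontrivial.exists_lt_one (v := valuation F)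
  exact ⟨Units.mk0 x h0, h1⟩

lemma eventually_valuation_pow_lt {ϖ : Fˣ} (hϖ : valuation F (ϖ : F) < 1)
    {γ : ValuativeRel.ValueGroupWithZero F} (hγ : γ ≠ 0) :
    ∀ᶠ m : ℕ in Filter.atTop, valuation F (ϖ : F) ^ m < γ := by
  have : MulArchimedean (ValuativeRel.ValueGroupWithZero F) :=
    (ValuativeRel.isRankLeOne_iff_mulArchimedean (R := F)).1 inferInstance
  obtain ⟨n, hn⟩ := exists_pow_lt₀ hϖ (Units.mk0 γ hγ)
  filter_upwards [Filter.eventually_ge_atTop n] with m hm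
  exact (pow_le_pow_right_of_le_one' hϖ.le hm).trans_lt hn

lemma eventually_valuation_pow_mul_lt_one {ϖ : Fˣ} (hϖ : valuation F (ϖ : F) < 1) (a : F) :
    ∀ᶠ m : ℕ in Filter.atTop, valuation F (ϖ : F) ^ m * valuation F a < 1 := by
  by_cases ha : valuation F a = 0
  · simp [ha]
  · filter_upwards [eventually_valuation_pow_lt hϖ (inv_ne_zero ha)] with m hm
    exact (lt_div_iff₀ (zero_lt_iff.2 ha)).1 (by rwa [one_div])

/-- Every element of the torus becomes antidominant after multiplication by a power of a strictly
antidominant element. -/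
lemma eventually_isAntidominant [P.IsReduced] {ϖ : Fˣ} (hϖ : valuation F (ϖ : F) < 1)
    (t : Torus X F) :
    ∀ᶠ m : ℕ in Filter.atTop, IsAntidominant (P := P) b (heightTorus b ϖ ^ m * t) := by
  have h : ∀ᶠ m : ℕ in Filter.atTop, ∀ α, valuation F (ϖ : F) ^ m *
      valuation F (t (Multiplicative.ofAdd (P.root α)) : F) < 1 :=
    Filter.eventually_all.2 fun α => eventually_valuation_pow_mul_lt_one hϖ _
  filter_upwards [h] with m hm α hα
  rw [MonoidHom.mul_apply, Units.val_mul, map_mul]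
  exact (mul_le_mul_left (valuation_heightTorus_pow_le hϖ m ((isPos_iff_ht b α).1 hα)) _).trans
    (hm α).le

lemma eventually_heightTorus_conj_mem_iwahori [P.IsReduced] {ϖ : Fˣ}
    (hϖ : valuation F (ϖ : F) < 1) {u : V.points F} (hu : u ∈ V.unipotentPoints F b) :
    ∀ᶠ m : ℕ in Filter.atTop, V.torusPoints F (heightTorus b ϖ ^ m) * u *
      (V.torusPoints F (heightTorus b ϖ ^ m))⁻¹ ∈ V.iwahori F b := by
  have h : ∀ᶠ m : ℕ in Filter.atTop, ∀ i j, valuation F (ϖ : F) ^ m *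
      valuation F ((u.1 : Matrix J J F) i j) < 1 :=
    Filter.eventually_all.2 fun i => Filter.eventually_all.2 fun j =>
      eventually_valuation_pow_mul_lt_one hϖ _
  filter_upwards [h] with m hm
  exact heightTorus_conj_mem_iwahori hϖ hu hm

variable (V F b) in
lemma isOpen_iwahori : IsOpen (V.iwahori F b : Set (V.points F)) := by
  refine Subgroup.isOpen_of_mem_nhds _ (g := 1) ?_
  have hcont : ∀ i j, Continuous fun g : V.points F => (g.1 : Matrix J J F) i j := fun i j =>
    (Units.continuous_val.comp continuous_subtype_val).matrix_elem i j
  have h : ∀ᶠ g : V.points F in nhds 1, ∀ i j,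
      valuation F ((g.1 : Matrix J J F) i j - (1 : Matrix J J F) i j) < 1 := by
    refine Filter.eventually_all.2 fun i => Filter.eventually_all.2 fun j => ?_
    have h1 : ∀ᶠ y in nhds (((1 : V.points F).1 : Matrix J J F) i j),
        valuation F (y - (1 : Matrix J J F) i j) < 1 :=
      (IsValuativeTopology.hasBasis_nhds' ((1 : Matrix J J F) i j)).mem_of_mem
        (one_ne_zero (α := ValuativeRel.ValueGroupWithZero F))
    exact ((hcont i j).tendsto 1).eventually h1
  filter_upwards [h] with g hg
  exact mem_iwahori_of_valuation_lt_one hg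

lemma tendsto_points_one {A : Type*} {l : Filter A} {f : A → V.points F}
    (h : ∀ i j, ∀ γ : ValuativeRel.ValueGroupWithZero F, γ ≠ 0 → ∀ᶠ a in l,
      valuation F (((f a).1 : Matrix J J F) i j - (1 : Matrix J J F) i j) < γ)
    (h' : ∀ i j, ∀ γ : ValuativeRel.ValueGroupWithZero F, γ ≠ 0 → ∀ᶠ a in l,
      valuation F ((((f a)⁻¹).1 : Matrix J J F) i j - (1 : Matrix J J F) i j) < γ) :
    Filter.Tendsto f l (nhds 1) := by
  rw [tendsto_subtype_rng, (Units.isInducing_embedProduct).tendsto_nhds_iff]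
  refine Filter.Tendsto.prodMk_nhds ?_ ?_
  · refine tendsto_pi_nhds.2 fun i => tendsto_pi_nhds.2 fun j => ?_
    exact (IsValuativeTopology.hasBasis_nhds' _).tendsto_right_iff.2 fun γ hγ => h i j γ hγ
  · refine (MulOpposite.continuous_op.tendsto _).comp ?_
    refine tendsto_pi_nhds.2 fun i => tendsto_pi_nhds.2 fun j => ?_
    exact (IsValuativeTopology.hasBasis_nhds' _).tendsto_right_iff.2 fun γ hγ => h' i j γ hγ

/-- The conjugates of `U⁻ ∩ I` by `κ⁻¹ c⁻ᵐ`, for `c` strictly antidominant and `κ ∈ K`, shrink to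
`1`, uniformly in `κ`. -/
lemma eventually_conj_mem_of_isOpen [P.IsReduced] {ϖ : Fˣ} (hϖ : valuation F (ϖ : F) < 1)
    {W : Set (V.points F)} (hW : IsOpen W) (h1 : 1 ∈ W) :
    ∀ᶠ m : ℕ in Filter.atTop, ∀ n ∈ V.oppPoints F b, n ∈ V.iwahori F b → ∀ κ ∈ V.intPoints F,
      κ⁻¹ * ((V.torusPoints F (heightTorus b ϖ ^ m))⁻¹ * n *
        V.torusPoints F (heightTorus b ϖ ^ m)) * κ ∈ W := by
  let A := ℕ × {n : V.points F // n ∈ V.oppPoints F b ∧ n ∈ V.iwahori F b} × V.intPoints F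
  let l : Filter A := Filter.comap Prod.fst Filter.atTop
  let f : A → V.points F := fun a => a.2.2.1⁻¹ * ((V.torusPoints F (heightTorus b ϖ ^ a.1))⁻¹ *
    a.2.1.1 * V.torusPoints F (heightTorus b ϖ ^ a.1)) * a.2.2.1
  have hbound : ∀ a : A, ∀ i j, valuation F (((f a).1 : Matrix J J F) i j -
      (1 : Matrix J J F) i j) ≤ valuation F (ϖ : F) ^ a.1 := by
    rintro ⟨m, ⟨n, hn, hnI⟩, ⟨κ, hκ⟩⟩ i j
    obtain ⟨hκ1, hκ2⟩ := mem_intPoints_iff.1 hκ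
    set y := (V.torusPoints F (heightTorus b ϖ ^ m))⁻¹ * n *
      V.torusPoints F (heightTorus b ϖ ^ m) with hy
    have hy' : ∀ i j, valuation F ((y.1 : Matrix J J F) i j - (1 : Matrix J J F) i j) ≤
        valuation F (ϖ : F) ^ m := fun i j => valuation_heightTorus_inv_conj_le hϖ m hn hnI i j
    have e : ((κ⁻¹ * y * κ).1 : Matrix J J F) - 1 =
        ((κ⁻¹ : V.points F).1 : Matrix J J F) * ((y.1 : Matrix J J F) - 1) *
          (κ.1 : Matrix J J F) := by
      rw [mul_sub, sub_mul, mul_one]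
      congr 1
      have := congrArg (fun g : V.points F => (g.1 : Matrix J J F)) (inv_mul_cancel κ)
      exact this.symm
    change valuation F (((κ⁻¹ * y * κ).1 : Matrix J J F) i j - (1 : Matrix J J F) i j) ≤ _
    rw [← Matrix.sub_apply, e, Matrix.mul_apply]
    refine Valuation.map_sum_le _ fun k _ => ?_
    rw [Matrix.mul_apply, map_mul]
    refine (mul_le_of_le_one_right' (hκ1 k j)).trans (Valuation.map_sum_le _ fun r _ => ?_)
    rw [map_mul]
    exact (mul_le_of_le_one_left' (hκ2 i r)).trans (hy' r k)
  have hinv : ∀ a : A, ∃ a' : A, a'.1 = a.1 ∧ (f a)⁻¹ = f a' := by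
    rintro ⟨m, ⟨n, hn, hnI⟩, κ⟩
    exact ⟨⟨m, ⟨n⁻¹, inv_mem hn, inv_mem hnI⟩, κ⟩, rfl, by simp only [f]; group⟩
  have hev : ∀ γ : ValuativeRel.ValueGroupWithZero F, γ ≠ 0 → ∀ᶠ a in l,
      valuation F (ϖ : F) ^ a.1 < γ := fun γ hγ =>
    Filter.tendsto_comap.eventually (eventually_valuation_pow_lt hϖ hγ)
  have ht : Filter.Tendsto f l (nhds 1) := by
    refine tendsto_points_one (fun i j γ hγ => ?_) fun i j γ hγ => ?_
    · filter_upwards [hev γ hγ] with a ha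
      exact (hbound a i j).trans_lt ha
    · filter_upwards [hev γ hγ] with a ha
      obtain ⟨a', h, e⟩ := hinv a
      rw [e]
      exact (hbound a' i j).trans_lt (h ▸ ha)
  have h2 := Filter.eventually_comap.1 (ht.eventually (hW.mem_nhds h1))
  filter_upwards [h2] with m hm n hn hnI κ hκ
  exact hm (m, ⟨n, hn, hnI⟩, ⟨κ, hκ⟩) rfl

end ChevalleyLattice

/-! ### A criterion for freeness -/

section Free

variable {Ω R M : Type*} [CommRing R] [AddCommGroup M] [Module R M]

/-- A module `M` of functions on `Ω` which is exhausted by an increasing sequence of submodules,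
the `m`-th one being spanned by vectors `x m κ` that are, up to units, the characteristic functions
of the classes of finer and finer equivalence relations on `Ω`, is free. A basis is obtained by
choosing in each class its least element for a well-order of `Ω` and keeping, for each `κ` so
chosen, the vector `x m κ` for the first `m` such that `κ` is chosen. -/
theorem injective_and_free_of_refining (Ψ : M →ₗ[R] (Ω → R)) (x : ℕ → Ω → M)
    (hunit : ∀ m κ, IsUnit (Ψ (x m κ) κ))
    (hprop : ∀ m κ κ', Ψ (x m κ) κ' ≠ 0 → ∃ r : Rˣ, x m κ' = r • x m κ)
    (hmono : ∀ m κ, x m κ ∈ Submodule.span R (Set.range (x (m + 1))))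
    (hspan : ⨆ m, Submodule.span R (Set.range (x m)) = ⊤) :
    Function.Injective Ψ ∧ Module.Free R M := by
  classical
  cases subsingleton_or_nontrivial R
  · have := Module.subsingleton R M
    exact ⟨Function.injective_of_subsingleton _, inferInstance⟩
  -- the relation `κ ~ κ'` at level `m`
  let S : ℕ → Ω → Ω → Prop := fun m κ κ' => ∃ r : Rˣ, x m κ' = r • x m κ
  have S_refl : ∀ m κ, S m κ κ := fun m κ => ⟨1, (one_smul _ _).symm⟩
  have S_symm : ∀ m κ κ', S m κ κ' → S m κ' κ := by
    rintro m κ κ' ⟨r, hr⟩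
    exact ⟨r⁻¹, by rw [hr, inv_smul_smul]⟩
  have S_trans : ∀ m κ κ' κ'', S m κ κ' → S m κ' κ'' → S m κ κ'' := by
    rintro m κ κ' κ'' ⟨r, hr⟩ ⟨s, hs⟩
    exact ⟨s * r, by rw [hs, hr, smul_smul]⟩
  have unit_of_S : ∀ m κ κ', S m κ κ' → IsUnit (Ψ (x m κ) κ') := by
    intro m κ κ' h
    obtain ⟨r, hr⟩ := S_symm m κ κ' h
    rw [hr, Units.smul_def, map_smul, Pi.smul_apply, smul_eq_mul]
    exact r.isUnit.mul (hunit m κ')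
  have zero_of_not : ∀ m κ κ', ¬ S m κ κ' → Ψ (x m κ) κ' = 0 := fun m κ κ' h => by
    by_contra h'
    exact h (hprop m κ κ' h')
  -- the relations get finer
  have S_succ : ∀ m κ κ', S (m + 1) κ κ' → S m κ κ' := by
    intro m κ κ' h
    obtain ⟨u, hu⟩ := hunit (m + 1) κ
    obtain ⟨v, hv⟩ := unit_of_S _ _ _ h
    have key : ∀ z ∈ Submodule.span R (Set.range (x (m + 1))),
        Ψ z κ' = (v * u⁻¹ : Rˣ) * Ψ z κ := by
      intro z hz
      induction hz using Submodule.span_induction with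
      | mem z hz =>
        obtain ⟨μ, rfl⟩ := hz
        by_cases hμ : S (m + 1) κ μ
        · obtain ⟨r, hr⟩ := hμ
          rw [hr, Units.smul_def, map_smul, Pi.smul_apply, Pi.smul_apply, ← hu, ← hv]
          simp only [smul_eq_mul, ← Units.val_mul]
          congr 1
          rw [mul_comm r u, mul_assoc, inv_mul_cancel_left, mul_comm]
        · rw [zero_of_not _ μ κ fun h' => hμ (S_symm _ _ _ h'),
            zero_of_not _ μ κ' fun h' => hμ (S_trans _ _ _ _ h (S_symm _ _ _ h')), mul_zero]
      | zero => simp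
      | add z z' _ _ h1 h2 => rw [map_add, Pi.add_apply, Pi.add_apply, h1, h2, mul_add]
      | smul r z _ h1 =>
        rw [map_smul, Pi.smul_apply, Pi.smul_apply, h1, smul_eq_mul, smul_eq_mul, mul_left_comm]
    by_contra h'
    have h2 := key _ (hmono m κ)
    rw [zero_of_not _ _ _ h'] at h2
    exact ((v * u⁻¹).isUnit.mul (hunit m κ)).ne_zero h2.symm
  -- the least elements of the classes
  let E : ℕ → Set Ω := fun m => {κ | ∀ κ', S m κ' κ → ¬ WellOrderingRel κ' κ}
  have E_succ : ∀ m κ, κ ∈ E m → κ ∈ E (m + 1) := fun m κ hκ κ' h => hκ κ' (S_succ _ _ _ h)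
  have E_mono : Monotone E := monotone_nat_of_le_succ fun m κ => E_succ m κ
  have E_unique : ∀ m κ κ', κ ∈ E m → κ' ∈ E m → S m κ κ' → κ = κ' := by
    intro m κ κ' hκ hκ' h
    by_contra hne
    exact (Std.Trichotomous.rel_or_eq_or_rel_swap (r := WellOrderingRel) (a := κ) (b := κ')).elim
      (hκ' κ h) fun h' => h'.elim hne (hκ κ' (S_symm _ _ _ h))
  have E_exists : ∀ m κ, ∃ e ∈ E m, S m e κ := by
    intro m κ
    have hwf : WellFounded (WellOrderingRel (α := Ω)) := WellOrderingRel.isWellOrder.wf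
    have hne : {κ' | S m κ' κ}.Nonempty := ⟨κ, S_refl m κ⟩
    exact ⟨hwf.min _ hne, fun κ' h => hwf.not_lt_min _ (S_trans _ _ _ _ h (hwf.min_mem _ hne)),
      hwf.min_mem _ hne⟩
  have span_E : ∀ m, Submodule.span R (Set.range (x m)) ≤ Submodule.span R (x m '' E m) := by
    intro m
    rw [Submodule.span_le]
    rintro _ ⟨κ, rfl⟩
    obtain ⟨e, he, r, hr⟩ := E_exists m κ
    rw [hr]
    exact Submodule.smul_mem _ (r : R) (Submodule.subset_span ⟨e, he, rfl⟩)
  -- the basis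
  let I := {κ : Ω // ∃ m, κ ∈ E m}
  let d : I → ℕ := fun κ => Nat.find κ.2
  have hd : ∀ κ : I, κ.1 ∈ E (d κ) := fun κ => Nat.find_spec κ.2
  let B : I → M := fun κ => x (d κ) κ.1
  have hB : ∀ κ κ' : I, d κ' ≤ d κ → κ ≠ κ' → Ψ (B κ) κ'.1 = 0 := by
    intro κ κ' h hne
    exact zero_of_not _ _ _ fun hS =>
      hne (Subtype.ext (E_unique _ _ _ (hd κ) (E_mono h (hd κ')) hS))
  have hli : LinearIndependent R (fun κ => Ψ (B κ)) := by
    rw [linearIndependent_iff']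
    intro s g hg κ hκ
    by_contra hne
    have hs : (s.filter fun κ => g κ ≠ 0).Nonempty := ⟨κ, Finset.mem_filter.2 ⟨hκ, hne⟩⟩
    obtain ⟨e, he, hmin⟩ := Finset.exists_min_image _ d hs
    have h := congrFun hg e.1
    rw [Finset.sum_apply, Finset.sum_eq_single_of_mem e (Finset.mem_filter.1 he).1] at h
    · exact (Finset.mem_filter.1 he).2
        ((hunit (d e) e.1).mul_left_eq_zero.1 (by simpa using h))
    · intro κ' hκ' hne'
      by_cases h0 : g κ' = 0
      · simp [h0]
      · rw [Pi.smul_apply, hB κ' e (hmin κ' (Finset.mem_filter.2 ⟨hκ', h0⟩)) hne', smul_zero]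
  have hmem : ∀ m, ∀ κ ∈ E m, x m κ ∈ Submodule.span R (Set.range B) := by
    intro m
    induction m with
    | zero =>
      intro κ hκ
      have h0 : d ⟨κ, 0, hκ⟩ = 0 := (Nat.find_eq_zero _).2 hκ
      exact Submodule.subset_span ⟨⟨κ, 0, hκ⟩, by simp only [B, h0]⟩
    | succ m ih =>
      have hnew : ∀ κ ∈ E (m + 1), κ ∉ E m → x (m + 1) κ ∈ Submodule.span R (Set.range B) := by
        intro κ hκ hκ'
        have h0 : d ⟨κ, m + 1, hκ⟩ = m + 1 := by
          refine (Nat.find_eq_iff _).2 ⟨hκ, fun n hn h => hκ' (E_mono (Nat.le_of_lt_succ hn) h)⟩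
        exact Submodule.subset_span ⟨⟨κ, m + 1, hκ⟩, by simp only [B, h0]⟩
      intro κ hκ
      by_cases hκ' : κ ∈ E m
      swap
      · exact hnew κ hκ hκ'
      obtain ⟨l, hl, hlx⟩ :=
        (Finsupp.mem_span_image_iff_linearCombination R).1 (span_E (m + 1) (hmono m κ))
      have hval : ∀ e ∈ E (m + 1), Ψ (x m κ) e = l e * Ψ (x (m + 1) e) e := by
        intro e he
        rw [← hlx, Finsupp.linearCombination_apply, Finsupp.sum, map_sum, Finset.sum_apply,
          Finset.sum_eq_single e]
        · simp
        · intro e' he' hne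
          have he'' : e' ∈ E (m + 1) := hl he'
          rw [map_smul, Pi.smul_apply,
            zero_of_not _ _ _ fun hS => hne (E_unique _ _ _ he'' he hS), smul_zero]
        · intro h
          rw [Finsupp.notMem_support_iff.1 h]
          simp
      have hlκ : IsUnit (l κ) := by
        have h := hval κ hκ
        have h2 := hunit m κ
        rw [h] at h2
        exact isUnit_of_mul_isUnit_left h2
      obtain ⟨v, hv⟩ := hlκ
      have hrest : x m κ - l κ • x (m + 1) κ ∈ Submodule.span R (Set.range B) := by
        have e1 : x m κ - l κ • x (m + 1) κ = ∑ e ∈ l.support.erase κ, l e • x (m + 1) e := by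
          have hκl : κ ∈ l.support := Finsupp.mem_support_iff.2 (hv ▸ v.ne_zero)
          have h := Finset.add_sum_erase l.support (fun e => l e • x (m + 1) e) hκl
          rw [sub_eq_iff_eq_add', h, ← hlx, Finsupp.linearCombination_apply, Finsupp.sum]
        rw [e1]
        refine Submodule.sum_mem _ fun e he => Submodule.smul_mem _ _ ?_
        have he1 : e ∈ E (m + 1) := hl (Finset.mem_of_mem_erase he)
        refine hnew e he1 fun he2 => Finset.ne_of_mem_erase he ?_
        by_contra hne
        have h0 : Ψ (x m κ) e = 0 :=
          zero_of_not _ _ _ fun hS => hne (E_unique _ _ _ hκ' he2 hS).symm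
        rw [hval e he1] at h0
        exact Finsupp.mem_support_iff.1 (Finset.mem_of_mem_erase he)
          ((hunit (m + 1) e).mul_left_eq_zero.1 h0)
      have h1 := Submodule.sub_mem _ (ih κ hκ') hrest
      rw [sub_sub_cancel, ← hv] at h1
      have h2 := Submodule.smul_mem _ ((v⁻¹ : Rˣ) : R) h1
      rwa [smul_smul, Units.inv_mul, one_smul] at h2
  have htop : ⊤ ≤ Submodule.span R (Set.range B) := by
    rw [← hspan]
    refine iSup_le fun m => (span_E m).trans (Submodule.span_le.2 ?_)
    rintro _ ⟨κ, hκ, rfl⟩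
    exact hmem m κ hκ
  have hliB : LinearIndependent R B := LinearIndependent.of_comp Ψ hli
  refine ⟨?_, Module.Free.of_basis (Module.Basis.mk hliB htop)⟩
  rw [injective_iff_map_eq_zero]
  intro z hz
  obtain ⟨c, rfl⟩ := (Finsupp.mem_span_range_iff_exists_finsupp).1 (htop (Submodule.mem_top (x := z)))
  have : c = 0 := (linearIndependent_iff.1 hli) c (by
    rw [Finsupp.linearCombination_apply, ← hz, Finsupp.sum, Finsupp.sum, map_sum]
    simp)
  simp [this]

/-- If the vectors `x κ` are, up to units, the characteristic functions of the classes of an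
equivalence relation on `Ω` with finitely many classes, then every function on `Ω` that is
proportional to `x κ` on the class of `κ` is a linear combination of them. -/
theorem exists_eq_of_proportional (Ψ : M →ₗ[R] (Ω → R)) (x : Ω → M)
    (hunit : ∀ κ, IsUnit (Ψ (x κ) κ))
    (hprop : ∀ κ κ', Ψ (x κ) κ' ≠ 0 → ∃ r : Rˣ, x κ' = r • x κ) (hfin : (Set.range x).Finite)
    {g : Ω → R} (hg : ∀ κ κ', Ψ (x κ) κ' ≠ 0 → g κ' * Ψ (x κ) κ = g κ * Ψ (x κ) κ') :
    ∃ z, Ψ z = g := by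
  classical
  cases subsingleton_or_nontrivial R
  · exact ⟨0, Subsingleton.elim _ _⟩
  let s : Setoid Ω :=
    { r := fun κ κ' => ∃ r : Rˣ, x κ' = r • x κ
      iseqv :=
        { refl := fun κ => ⟨1, (one_smul _ _).symm⟩
          symm := by
            rintro κ κ' ⟨r, hr⟩
            exact ⟨r⁻¹, by rw [hr, inv_smul_smul]⟩
          trans := by
            rintro κ κ' κ'' ⟨r, hr⟩ ⟨s, hs⟩
            exact ⟨s * r, by rw [hs, hr, smul_smul]⟩ } }
  have hfin' : Finite (Set.range x) := hfin
  have hq : Finite (Quotient s) := by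
    refine Finite.of_injective (fun q : Quotient s => (⟨x q.out, q.out, rfl⟩ : Set.range x)) ?_
    intro q q' h
    have h' : x q.out = x q'.out := congrArg Subtype.val h
    rw [← q.out_eq, ← q'.out_eq]
    exact Quotient.sound ⟨1, by rw [h', one_smul]⟩
  have := Fintype.ofFinite (Quotient s)
  choose u hu using hunit
  refine ⟨∑ q : Quotient s, (g q.out * (u q.out)⁻¹) • x q.out, ?_⟩
  funext κ
  rw [map_sum, Finset.sum_apply, Finset.sum_eq_single (Quotient.mk s κ)]
  · obtain ⟨r, hr⟩ := Quotient.mk_out (s := s) κ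
    set e := (Quotient.mk s κ).out
    have h1 : Ψ (x e) κ ≠ 0 := by
      intro h0
      have h2 := (u κ).ne_zero
      rw [hu, hr, Units.smul_def, map_smul, Pi.smul_apply, h0, smul_zero] at h2
      exact h2 rfl
    have h2 := hg e κ h1
    rw [← hu] at h2
    rw [map_smul, Pi.smul_apply, smul_eq_mul, mul_right_comm, ← h2, Units.mul_inv_cancel_right]
  · intro q _ hq
    rw [map_smul, Pi.smul_apply]
    by_cases h0 : Ψ (x q.out) κ = 0
    · rw [h0, smul_zero]
    · refine absurd ?_ hq
      rw [← q.out_eq]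
      exact Quotient.sound (hprop _ _ h0)
  · exact fun h => absurd (Finset.mem_univ _) h

end Free

/-- A homomorphism to a group from a submonoid of a commutative group which contains a positive
multiple of every element, up to powers of one of its elements, extends to the group. -/
lemma Submonoid.exists_monoidHom_extend {T A : Type*} [CommGroup T] [CommGroup A]
    {M : Submonoid T} {c : T} (hc : c ∈ M) (hM : ∀ t, ∃ m : ℕ, c ^ m * t ∈ M) (ψ : M →* A) :
    ∃ φ : T →* A, ∀ t : M, φ t = ψ t := by
  choose m hm using hM
  let C : M := ⟨c, hc⟩
  have key : ∀ (t : T) (n : ℕ) (hn : c ^ n * t ∈ M),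
      ψ ⟨c ^ m t * t, hm t⟩ * (ψ C ^ m t)⁻¹ = ψ ⟨c ^ n * t, hn⟩ * (ψ C ^ n)⁻¹ := by
    intro t n hn
    rw [mul_inv_eq_iff_eq_mul, mul_assoc, mul_comm _ (ψ C ^ m t), ← mul_assoc,
      eq_mul_inv_iff_mul_eq, ← map_pow, ← map_pow, ← map_mul, ← map_mul]
    congr 1
    ext
    simp only [C, Submonoid.coe_mul, SubmonoidClass.coe_pow]
    rw [mul_right_comm, mul_right_comm (c ^ n), mul_comm (c ^ n)]
  refine ⟨MonoidHom.mk' (fun t => ψ ⟨c ^ m t * t, hm t⟩ * (ψ C ^ m t)⁻¹) fun t t' => ?_,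
    fun t => ?_⟩
  · have h : c ^ (m t + m t') * (t * t') ∈ M := by
      rw [pow_add, mul_mul_mul_comm]
      exact mul_mem (hm t) (hm t')
    rw [key _ _ h, mul_mul_mul_comm, ← mul_inv, ← pow_add, ← map_mul]
    congr 2
    ext
    simp only [Submonoid.coe_mul]
    rw [pow_add, mul_mul_mul_comm]
  · change ψ ⟨c ^ m (t : T) * t, hm t⟩ * (ψ C ^ m (t : T))⁻¹ = ψ t
    have h : c ^ 0 * (t : T) ∈ M := by simp
    have e : (⟨c ^ 0 * (t : T), h⟩ : M) = t := Subtype.ext (by simp)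
    rw [key _ 0 h, e, pow_zero (ψ C), inv_one, mul_one]

/-! ### The functions `1_{I g}` and convolution -/

namespace Hecke

variable {k : Type*} [CommRing k] {Γ : Type*} [Group Γ] {I : Subgroup Γ}

variable (k I) in
open Classical in
/-- The characteristic function of the coset `I g`. -/
noncomputable def delta (g : Γ) : universalModule k I :=
  ⟨fun x => if x * g⁻¹ ∈ I then 1 else 0, fun i hi x => if_congr (by
      rw [mul_assoc, I.mul_mem_cancel_left hi]) rfl rfl, {g}, fun x hx => by
      have h : x * g⁻¹ ∈ I := by by_contra h; simp [h] at hx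
      exact ⟨g, by simp, x * g⁻¹, h, by group⟩⟩

open Classical in
lemma delta_apply (g x : Γ) : (delta k I g).1 x = if x * g⁻¹ ∈ I then 1 else 0 := rfl

lemma delta_mul_left {i : Γ} (hi : i ∈ I) (g : Γ) : delta k I (i * g) = delta k I g := by
  refine Subtype.ext (funext fun x => ?_)
  rw [delta_apply, delta_apply, mul_inv_rev, ← mul_assoc, I.mul_mem_cancel_right (inv_mem hi)]

lemma smul_val (h : HeckeAlgebra k I) (f : universalModule k I) : (h • f).1 = conv I h.1 f.1 := rfl

lemma smul_delta_apply (h : HeckeAlgebra k I) (g x : Γ) :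
    (h • delta k I g).1 x = h.1 (x * g⁻¹) := by
  have e := congrFun (conv_char (I := I) h.2.2.1) (x * g⁻¹)
  rw [← e, smul_val]
  unfold conv
  refine finsum_congr fun y => ?_
  rw [delta_apply, mul_assoc]

/-- A function supported on `I A` is a linear combination of characteristic functions of cosets
`I a` with `a ∈ A`. -/
lemma mem_span_delta {A : Set Γ} (f : universalModule k I)
    (hf : ∀ x, f.1 x ≠ 0 → ∃ i ∈ I, ∃ a ∈ A, x = i * a) :
    f ∈ Submodule.span k (delta k I '' A) := by
  classical
  obtain ⟨S, hS⟩ := f.2.2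
  induction S using Finset.induction generalizing f with
  | empty =>
    have : f = 0 := by
      refine Subtype.ext (funext fun x => ?_)
      by_contra h
      obtain ⟨s, hs, -⟩ := hS x h
      simp at hs
    rw [this]
    exact zero_mem _
  | insert s S _ ih =>
    by_cases h0 : f.1 s = 0
    · refine ih f hf fun x hx => ?_
      obtain ⟨s', hs', i, hi, e⟩ := hS x hx
      rcases Finset.mem_insert.1 hs' with rfl | hs'
      · rw [e, f.2.1 i hi] at hx
        exact absurd h0 hx
      · exact ⟨s', hs', i, hi, e⟩
    · obtain ⟨i, hi, a, ha, hsa⟩ := hf s h0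
      have hδ : ∀ x, (f - f.1 s • delta k I a).1 x =
          if x * a⁻¹ ∈ I then 0 else f.1 x := by
        intro x
        change f.1 x - f.1 s * (delta k I a).1 x = _
        rw [delta_apply]
        split_ifs with hx
        · have e1 : f.1 x = f.1 a := by
            rw [← f.2.1 _ hx a, inv_mul_cancel_right]
          rw [hsa, f.2.1 i hi, e1]
          ring
        · simp
      have h1 : f - f.1 s • delta k I a ∈ Submodule.span k (delta k I '' A) := by
        refine ih _ (fun x hx => hf x fun h => hx (by simp [hδ, h])) fun x hx => ?_
        rw [hδ] at hx
        split_ifs at hx with hxa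
        · exact absurd rfl hx
        obtain ⟨s', hs', i', hi', e⟩ := hS x hx
        rcases Finset.mem_insert.1 hs' with rfl | hs'
        · refine absurd ?_ hxa
          rw [e, hsa, ← mul_assoc, mul_inv_cancel_right]
          exact mul_mem hi' hi
        · exact ⟨s', hs', i', hi', e⟩
      have h2 := Submodule.add_mem _ h1
        (Submodule.smul_mem _ (f.1 s) (Submodule.subset_span ⟨a, ha, rfl⟩))
      rwa [sub_add_cancel] at h2

variable (k I) in
lemma span_delta : Submodule.span k (Set.range (delta k I)) = ⊤ := by
  rw [eq_top_iff, ← Set.image_univ]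
  exact fun f _ => mem_span_delta f fun x _ => ⟨1, one_mem _, x, trivial, (one_mul x).symm⟩

section

variable (hI : FiniteDoubleCosets I)

open Classical in
lemma tau_apply (g x : Γ) :
    (tau k hI g).1 x = if ∃ i ∈ I, ∃ j ∈ I, x = i * g * j then 1 else 0 := rfl

lemma tau_eq_one {g : Γ} (hg : g ∈ I) : tau k hI g = 1 := by
  classical
  refine Subtype.ext (funext fun x => ?_)
  change _ = if x ∈ I then (1 : k) else 0
  rw [tau_apply]
  refine if_congr ⟨?_, fun hx => ⟨x * g⁻¹, mul_mem hx (inv_mem hg), 1, one_mem _, by simp⟩⟩ rfl rfl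
  rintro ⟨i, hi, j, hj, rfl⟩
  exact mul_mem (mul_mem hi hg) hj

end

variable {R : Type*} [CommRing R] [Algebra k R]

lemma finite_support_conv (F : Γ → R) (f : universalModule k I) (y : Γ) :
    (Function.support fun z : Γ ⧸ I => F z.out * algebraMap k R (f.1 (z.out⁻¹ * y))).Finite := by
  classical
  obtain ⟨S, hS⟩ := f.2.2
  refine (S.image fun s => ((y * s⁻¹ : Γ) : Γ ⧸ I)).finite_toSet.subset fun z hz => ?_
  have h0 : f.1 (z.out⁻¹ * y) ≠ 0 := fun h => hz (by simp [h])
  obtain ⟨s, hs, i, hi, e⟩ := hS _ h0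
  refine Finset.mem_coe.2 (Finset.mem_image.2 ⟨s, hs, ?_⟩)
  rw [← QuotientGroup.out_eq' z]
  refine (QuotientGroup.eq).2 ?_
  have : (y * s⁻¹)⁻¹ * z.out = i⁻¹ := by
    have e' : y = z.out * (i * s) := by rw [← e, mul_inv_cancel_left]
    rw [e']
    group
  rw [this]
  exact inv_mem hi

/-- Convolution on the left with a function `F` on `Γ`. -/
noncomputable def convMap (F : Γ → R) : universalModule k I →ₗ[k] (Γ → R) where
  toFun f := conv I F fun x => algebraMap k R (f.1 x)
  map_add' f f' := by
    funext y
    change conv I F _ y = conv I F _ y + conv I F _ y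
    unfold conv
    rw [← finsum_add_distrib (finite_support_conv F f y) (finite_support_conv F f' y)]
    refine finsum_congr fun z => ?_
    rw [← mul_add, ← map_add]
    rfl
  map_smul' c f := by
    funext y
    change conv I F _ y = c • conv I F _ y
    unfold conv
    rw [Algebra.smul_def, ← smul_eq_mul, smul_finsum' _ (finite_support_conv F f y)]
    refine finsum_congr fun z => ?_
    rw [smul_eq_mul, mul_left_comm, ← map_mul]
    rfl

lemma convMap_apply (F : Γ → R) (f : universalModule k I) (y : Γ) :
    convMap F f y = ∑ᶠ z : Γ ⧸ I, F z.out * algebraMap k R (f.1 (z.out⁻¹ * y)) := rfl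

lemma convMap_translate (F : Γ → R) (g : Γ) (f : universalModule k I) (y : Γ) :
    convMap F (translate k I g f) y = convMap F f (y * g) := by
  rw [convMap_apply, convMap_apply]
  refine finsum_congr fun z => ?_
  rw [← mul_assoc]
  rfl

lemma convMap_smul_delta (F : Γ → R) (h : HeckeAlgebra k I) (g y : Γ) :
    convMap F (h • delta k I g) y = conv I F (fun x => algebraMap k R (h.1 x)) (y * g⁻¹) := by
  rw [convMap_apply]
  unfold conv
  refine finsum_congr fun z => ?_
  rw [smul_delta_apply, mul_assoc]

lemma convMap_delta {F : Γ → R} (hF : ∀ i ∈ I, ∀ x, F (x * i) = F x) (g y : Γ) :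
    convMap F (delta k I g) y = F (y * g⁻¹) := by
  classical
  rw [← one_smul (HeckeAlgebra k I) (delta k I g), convMap_smul_delta]
  have e := congrFun (conv_char (I := I) hF) (y * g⁻¹)
  rw [← e]
  congr 1
  funext x
  change algebraMap k R (if x ∈ I then 1 else 0) = _
  split_ifs <;> simp

end Hecke

namespace ChevalleyLattice

open ValuativeRel (valuation)

variable {ι X Y : Type*} [Finite ι] [AddCommGroup X] [AddCommGroup Y] {P : RootDatum ι X Y}
  {J : Type*} [Fintype J] [DecidableEq J] {V : ChevalleyLattice P J} {b : P.Base}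
  {F : Type*} [Field F]

/-! ### Products of double cosets of antidominant elements -/

lemma torusPoints_mul_comm (s t : Torus X F) :
    V.torusPoints F s * V.torusPoints F t = V.torusPoints F t * V.torusPoints F s :=
  (map_mul _ s t).symm.trans ((congrArg (V.torusPoints F) (mul_comm s t)).trans (map_mul _ t s))

lemma torusPoints_inv_mul_comm (s t : Torus X F) :
    (V.torusPoints F s)⁻¹ * V.torusPoints F t = V.torusPoints F t * (V.torusPoints F s)⁻¹ := by
  rw [← torus_map_inv, torusPoints_mul_comm]

lemma torusPoints_inv_conj_mem_unipotentPoints (t : Torus X F) {u : V.points F}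
    (hu : u ∈ V.unipotentPoints F b) :
    (V.torusPoints F t)⁻¹ * u * V.torusPoints F t ∈ V.unipotentPoints F b := by
  have h := torusPoints_conj_mem_unipotentPoints t⁻¹ hu
  rwa [torus_map_inv, inv_inv] at h

variable (V F) in
/-- The Borel subgroup `B = T U` of `G`. -/
def borelPoints (b : P.Base) : Subgroup (V.points F) where
  carrier := {g | ∃ t, ∃ u ∈ V.unipotentPoints F b, g = V.torusPoints F t * u}
  one_mem' := ⟨1, 1, one_mem _, by simp⟩
  mul_mem' := by
    rintro _ _ ⟨t, u, hu, rfl⟩ ⟨t', u', hu', rfl⟩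
    refine ⟨t * t', _, mul_mem (torusPoints_inv_conj_mem_unipotentPoints t' hu) hu', ?_⟩
    rw [map_mul]
    group
  inv_mem' := by
    rintro _ ⟨t, u, hu, rfl⟩
    refine ⟨t⁻¹, _, torusPoints_conj_mem_unipotentPoints t (inv_mem hu), ?_⟩
    rw [torus_map_inv]
    group

lemma torusPoints_mem_borelPoints (t : Torus X F) : V.torusPoints F t ∈ V.borelPoints F b :=
  ⟨t, 1, one_mem _, (mul_one _).symm⟩

variable [ValuativeRel F] [P.IsReduced]

/-- Conjugation by an antidominant element maps `B ∩ I` into itself. -/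
lemma borel_conj_mem_iwahori {t : Torus X F} (ht : IsAntidominant (P := P) b t) {β : V.points F}
    (hβ : β ∈ V.borelPoints F b) (hβI : β ∈ V.iwahori F b) :
    V.torusPoints F t * β * (V.torusPoints F t)⁻¹ ∈ V.iwahori F b := by
  obtain ⟨t', u, hu, rfl⟩ := hβ
  have h1 := torusPoints_mem_iwahori hu hβI
  have h2 : u ∈ V.iwahori F b := ((V.iwahori F b).mul_mem_cancel_left h1).1 hβI
  have h3 := mul_mem h1 (torusPoints_conj_mem_iwahori ht hu h2)
  rwa [← mul_assoc, ← mul_assoc, torusPoints_mul_comm, mul_assoc (V.torusPoints F t)] at h3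

/-- `B ∩ t I t⁻¹ ⊂ I` for `t` antidominant. -/
lemma mem_iwahori_of_borel_inv_conj {t : Torus X F} (ht : IsAntidominant (P := P) b t)
    {β : V.points F} (hβ : β ∈ V.borelPoints F b)
    (h : (V.torusPoints F t)⁻¹ * β * V.torusPoints F t ∈ V.iwahori F b) :
    β ∈ V.iwahori F b := by
  have h1 := borel_conj_mem_iwahori ht (mul_mem (mul_mem
    (inv_mem (torusPoints_mem_borelPoints t)) hβ) (torusPoints_mem_borelPoints t)) h
  have e : V.torusPoints F t * ((V.torusPoints F t)⁻¹ * β * V.torusPoints F t) *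
      (V.torusPoints F t)⁻¹ = β := by group
  rwa [e] at h1

/-- `I t ⊂ (B ∩ I) t I` for `t` antidominant. -/
lemma exists_mul_torusPoints_eq {t : Torus X F} (ht : IsAntidominant (P := P) b t)
    {i : V.points F} (hi : i ∈ V.iwahori F b) :
    ∃ β ∈ V.borelPoints F b, β ∈ V.iwahori F b ∧ ∃ i' ∈ V.iwahori F b,
      i * V.torusPoints F t = β * V.torusPoints F t * i' := by
  obtain ⟨t', ht', u, hu, huI, n, hn, hnI, rfl⟩ := exists_eq_mul_of_mem_iwahori hi
  exact ⟨_, ⟨t', u, hu, rfl⟩, mul_mem ht' huI, _, torusPoints_inv_conj_mem_iwahori ht hn hnI,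
    by group⟩

/-- `t I s ⊂ β t s I` with `β ∈ I ∩ t I t⁻¹`, for `s` and `t` antidominant. -/
lemma exists_torusPoints_mul_eq {t s : Torus X F} (ht : IsAntidominant (P := P) b t)
    (hs : IsAntidominant (P := P) b s) {i : V.points F} (hi : i ∈ V.iwahori F b) :
    ∃ β ∈ V.iwahori F b, (V.torusPoints F t)⁻¹ * β * V.torusPoints F t ∈ V.iwahori F b ∧
      ∃ i' ∈ V.iwahori F b, V.torusPoints F t * i * V.torusPoints F s =
        β * V.torusPoints F (t * s) * i' := by
  obtain ⟨β, hβ, hβI, i', hi', e⟩ := exists_mul_torusPoints_eq hs hi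
  refine ⟨_, borel_conj_mem_iwahori ht hβ hβI, ?_, i', hi', ?_⟩
  · have e : (V.torusPoints F t)⁻¹ * (V.torusPoints F t * β * (V.torusPoints F t)⁻¹) *
      V.torusPoints F t = β := by group
    rwa [e]
  · rw [mul_assoc, e, map_mul]
    group

/-- `I ∩ t s I (t s)⁻¹ ⊂ t I t⁻¹`, for `s` and `t` antidominant. -/
lemma inv_conj_mem_iwahori_of_mul {t s : Torus X F} (ht : IsAntidominant (P := P) b t)
    (hs : IsAntidominant (P := P) b s) {i : V.points F} (hi : i ∈ V.iwahori F b)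
    (h : (V.torusPoints F (t * s))⁻¹ * i * V.torusPoints F (t * s) ∈ V.iwahori F b) :
    (V.torusPoints F t)⁻¹ * i * V.torusPoints F t ∈ V.iwahori F b := by
  obtain ⟨t', ht', u, hu, huI, n, hn, hnI, rfl⟩ := exists_eq_mul_of_mem_iwahori hi
  have key : ∀ r : Torus X F, IsAntidominant (P := P) b r →
      ((V.torusPoints F r)⁻¹ * (V.torusPoints F t' * u * n) * V.torusPoints F r ∈ V.iwahori F b ↔
        (V.torusPoints F r)⁻¹ * u * V.torusPoints F r ∈ V.iwahori F b) := by
    intro r hr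
    have e : (V.torusPoints F r)⁻¹ * (V.torusPoints F t' * u * n) * V.torusPoints F r =
        V.torusPoints F t' * ((V.torusPoints F r)⁻¹ * u * V.torusPoints F r) *
          ((V.torusPoints F r)⁻¹ * n * V.torusPoints F r) := by
      rw [← mul_assoc, ← mul_assoc, torusPoints_inv_mul_comm]
      group
    rw [e, (V.iwahori F b).mul_mem_cancel_right (torusPoints_inv_conj_mem_iwahori hr hn hnI),
      (V.iwahori F b).mul_mem_cancel_left ht']
  rw [key _ (ht.mul hs)] at h
  rw [key _ ht]
  have h1 := torusPoints_conj_mem_iwahori hs (torusPoints_inv_conj_mem_unipotentPoints _ hu) h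
  have e : V.torusPoints F s * ((V.torusPoints F (t * s))⁻¹ * u * V.torusPoints F (t * s)) *
      (V.torusPoints F s)⁻¹ = (V.torusPoints F t)⁻¹ * u * V.torusPoints F t := by
    rw [map_mul]
    group
  rwa [e] at h1

/-- Elements of `T ∩ K` normalise `I`. -/
lemma conj_mem_iwahori_of_mem_intPoints {t : Torus X F} (ht : V.torusPoints F t ∈ V.intPoints F)
    {i : V.points F} (hi : i ∈ V.iwahori F b) :
    V.torusPoints F t * i * (V.torusPoints F t)⁻¹ ∈ V.iwahori F b := by
  obtain ⟨t', ht', u, hu, huI, n, hn, hnI, rfl⟩ := exists_eq_mul_of_mem_iwahori hi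
  have ht1 : V.torusPoints F t⁻¹ ∈ V.intPoints F := by
    rw [torus_map_inv]
    exact inv_mem ht
  have h2 := torusPoints_inv_conj_mem_iwahori (isAntidominant_of_mem_intPoints ht1) hn hnI
  rw [torus_map_inv, inv_inv] at h2
  have h1 := borel_conj_mem_iwahori (isAntidominant_of_mem_intPoints ht) ⟨t', u, hu, rfl⟩
    (mul_mem ht' huI)
  have h3 := mul_mem h1 h2
  have e : V.torusPoints F t * (V.torusPoints F t' * u) * (V.torusPoints F t)⁻¹ *
      (V.torusPoints F t * n * (V.torusPoints F t)⁻¹) =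
      V.torusPoints F t * (V.torusPoints F t' * u * n) * (V.torusPoints F t)⁻¹ := by group
  rwa [e] at h3

variable [TopologicalSpace F] [IsNonarchimedeanLocalField F] {k : Type*} [Field k]

omit [P.IsReduced] in
open Classical in
lemma tau_val_apply (t : Torus X F) (x : V.points F) :
    (V.tau b k t).1 x = if ∃ i ∈ V.iwahori F b, ∃ i' ∈ V.iwahori F b,
      x = i * V.torusPoints F t * i' then 1 else 0 := rfl

omit [P.IsReduced] in
lemma exists_of_tau_ne_zero {t : Torus X F} {x : V.points F} (h : (V.tau b k t).1 x ≠ 0) :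
    ∃ i ∈ V.iwahori F b, ∃ i' ∈ V.iwahori F b, x = i * V.torusPoints F t * i' := by
  by_contra h'
  exact h (by rw [tau_val_apply, if_neg h'])

omit [P.IsReduced] in
lemma tau_apply_mul_mul (t : Torus X F) {i i' : V.points F} (hi : i ∈ V.iwahori F b)
    (hi' : i' ∈ V.iwahori F b) : (V.tau b k t).1 (i * V.torusPoints F t * i') = 1 := by
  rw [tau_val_apply, if_pos ⟨i, hi, i', hi', rfl⟩]

variable (k) in
/-- The elements `τ_t` are multiplicative in the antidominant element `t`. -/
theorem tau_mul {t s : Torus X F} (ht : IsAntidominant (P := P) b t)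
    (hs : IsAntidominant (P := P) b s) :
    V.tau b k t * V.tau b k s = V.tau b k (t * s) := by
  classical
  refine Subtype.ext (funext fun x => ?_)
  change Hecke.conv (V.iwahori F b) (V.tau b k t).1 (V.tau b k s).1 x = _
  -- if `τ_t(z) τ_s(z⁻¹ x) ≠ 0`, then `x ∈ i t s I` and `z ∈ i t I` for some `i ∈ I`
  have key : ∀ z, (V.tau b k t).1 z * (V.tau b k s).1 (z⁻¹ * x) ≠ 0 →
      ∃ i ∈ V.iwahori F b, (∃ i' ∈ V.iwahori F b, x = i * V.torusPoints F (t * s) * i') ∧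
        (i * V.torusPoints F t)⁻¹ * z ∈ V.iwahori F b := by
    intro z hz
    obtain ⟨i₁, h₁, i₂, h₂, hz1⟩ := exists_of_tau_ne_zero (left_ne_zero_of_mul hz)
    obtain ⟨i₃, h₃, i₄, h₄, hz2⟩ := exists_of_tau_ne_zero (right_ne_zero_of_mul hz)
    obtain ⟨β, hβ, hβ', i', hi', e⟩ := exists_torusPoints_mul_eq ht hs (mul_mem h₂ h₃)
    refine ⟨i₁ * β, mul_mem h₁ hβ, ⟨i' * i₄, mul_mem hi' h₄, ?_⟩, ?_⟩
    · calc x = z * (z⁻¹ * x) := by group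
        _ = i₁ * (V.torusPoints F t * (i₂ * i₃) * V.torusPoints F s) * i₄ := by
          rw [hz2, hz1]
          group
        _ = _ := by
          rw [e]
          group
    · have e2 : (i₁ * β * V.torusPoints F t)⁻¹ * z =
          ((V.torusPoints F t)⁻¹ * β * V.torusPoints F t)⁻¹ * i₂ := by
        rw [hz1]
        group
      rw [e2]
      exact mul_mem (inv_mem hβ') h₂
  have hinv := Hecke.term_inv (I := V.iwahori F b) (h := (V.tau b k t).1) (f := (V.tau b k s).1)
    (V.tau b k t).2.2.1 (V.tau b k s).2.1 x
  by_cases hx : ∃ i ∈ V.iwahori F b, ∃ i' ∈ V.iwahori F b, x = i * V.torusPoints F (t * s) * i'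
  · rw [tau_val_apply, if_pos hx]
    obtain ⟨i, hi, i', hi', e⟩ := hx
    unfold Hecke.conv
    rw [finsum_eq_single _ ((i * V.torusPoints F t : V.points F) : V.points F ⧸ V.iwahori F b)]
    · rw [Hecke.apply_out (F := fun z => (V.tau b k t).1 z * (V.tau b k s).1 (z⁻¹ * x)) hinv]
      have e1 : (V.tau b k t).1 (i * V.torusPoints F t) = 1 := by
        have h := tau_apply_mul_mul (k := k) t hi (one_mem (V.iwahori F b))
        rwa [mul_one] at h
      have e2 : (V.tau b k s).1 ((i * V.torusPoints F t)⁻¹ * x) = 1 := by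
        have h := tau_apply_mul_mul (k := k) s (one_mem (V.iwahori F b)) hi'
        have e3 : (i * V.torusPoints F t)⁻¹ * x = 1 * V.torusPoints F s * i' := by
          rw [e, map_mul]
          group
        rwa [e3]
      rw [e1, e2, one_mul]
    · intro y hy
      by_contra h0
      obtain ⟨i₁, h₁, ⟨i₂, h₂, e1⟩, e2⟩ := key _ h0
      refine hy ?_
      rw [← QuotientGroup.out_eq' y]
      refine Eq.trans (QuotientGroup.eq.2 e2).symm (QuotientGroup.eq.2 ?_)
      have e3 : (i₁ * V.torusPoints F t)⁻¹ * (i * V.torusPoints F t) =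
          (V.torusPoints F t)⁻¹ * (i₁⁻¹ * i) * V.torusPoints F t := by group
      rw [e3]
      refine inv_conj_mem_iwahori_of_mul ht hs (mul_mem (inv_mem h₁) hi) ?_
      have e4 : (V.torusPoints F (t * s))⁻¹ * (i₁⁻¹ * i) * V.torusPoints F (t * s) =
          i₂ * i'⁻¹ := by
        rw [eq_mul_inv_iff_mul_eq]
        have e5 : i₁ * V.torusPoints F (t * s) * i₂ = i * V.torusPoints F (t * s) * i' :=
          e1.symm.trans e
        calc _ = (V.torusPoints F (t * s))⁻¹ * i₁⁻¹ * (i * V.torusPoints F (t * s) * i') := by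
              group
          _ = _ := by
              rw [← e5]
              group
      rw [e4]
      exact mul_mem h₂ (inv_mem hi')
  · rw [tau_val_apply, if_neg hx]
    by_contra h0
    obtain ⟨y, hy⟩ : ∃ y : V.points F ⧸ V.iwahori F b,
        (V.tau b k t).1 y.out * (V.tau b k s).1 (y.out⁻¹ * x) ≠ 0 := by
      by_contra! h
      exact h0 (finsum_eq_zero_of_forall_eq_zero h)
    obtain ⟨i, hi, ⟨i', hi', e⟩, -⟩ := key _ hy
    exact hx ⟨i, hi, i', hi', e⟩

/-- The characteristic function of `I t I g`, for `t` antidominant, is a linear combination of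
characteristic functions of cosets in `I t (U⁻ ∩ I) g`. -/
lemma tau_smul_delta_mem_span {t : Torus X F} (ht : IsAntidominant (P := P) b t)
    (g : V.points F) :
    V.tau b k t • Hecke.delta k (V.iwahori F b) g ∈ Submodule.span k
      (Hecke.delta k (V.iwahori F b) '' {x | ∃ n ∈ V.oppPoints F b, n ∈ V.iwahori F b ∧
        x = V.torusPoints F t * n * g}) := by
  refine Hecke.mem_span_delta _ fun x hx => ?_
  rw [Hecke.smul_delta_apply] at hx
  obtain ⟨i, hi, i', hi', e⟩ := exists_of_tau_ne_zero hx
  obtain ⟨t', ht', u, hu, huI, n, hn, hnI, rfl⟩ := exists_eq_mul_of_mem_iwahori hi'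
  refine ⟨_, mul_mem hi (borel_conj_mem_iwahori ht ⟨t', u, hu, rfl⟩ (mul_mem ht' huI)), _,
    ⟨n, hn, hnI, rfl⟩, ?_⟩
  rw [mul_inv_eq_iff_eq_mul] at e
  rw [e]
  group

/-- For `t ∈ T ∩ K`, the element `τ_t` acts on the functions `1_{I g}` by translation by `t`. -/
lemma tau_smul_delta_of_mem_intPoints {t : Torus X F} (ht : V.torusPoints F t ∈ V.intPoints F)
    (g : V.points F) :
    V.tau b k t • Hecke.delta k (V.iwahori F b) g =
      Hecke.delta k (V.iwahori F b) (V.torusPoints F t * g) := by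
  classical
  refine Subtype.ext (funext fun x => ?_)
  rw [Hecke.smul_delta_apply, tau_val_apply, Hecke.delta_apply]
  refine if_congr ⟨?_, fun h => ⟨_, h, 1, one_mem _, by group⟩⟩ rfl rfl
  rintro ⟨i, hi, i', hi', e⟩
  have e2 : x * (V.torusPoints F t * g)⁻¹ =
      i * (V.torusPoints F t * i' * (V.torusPoints F t)⁻¹) := by
    rw [mul_inv_rev, ← mul_assoc, e]
    group
  rw [e2]
  exact mul_mem hi (conj_mem_iwahori_of_mem_intPoints ht hi')

end ChevalleyLattice

namespace ChevalleyLattice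

open ValuativeRel (valuation)

variable {ι X Y : Type*} [Finite ι] [AddCommGroup X] [AddCommGroup Y] {P : RootDatum ι X Y}
  {J : Type*} [Fintype J] [DecidableEq J] {V : ChevalleyLattice P J} {b : P.Base}
  {F : Type*} [Field F] [ValuativeRel F]

variable [P.IsReduced] [TopologicalSpace F] [IsNonarchimedeanLocalField F] {k : Type*} [Field k]

omit [ValuativeRel F] [TopologicalSpace F] [IsNonarchimedeanLocalField F] in
lemma torus_map_pow {A : Type*} [Group A] (φ : Torus X F →* A) (t : Torus X F) (m : ℕ) :
    φ (t ^ m) = φ t ^ m := map_pow φ t m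

/-! ### The character attached to a regular character of `A_anti` -/

variable (F b) in
/-- The monoid of antidominant elements of `T`. -/
def antidominant : Submonoid (Torus X F) where
  carrier := {t | IsAntidominant (P := P) b t}
  one_mem' := isAntidominant_one
  mul_mem' h h' := h.mul h'

variable (F b) in
lemma exists_pow_mul_mem_antidominant :
    ∃ c ∈ antidominant (P := P) b F, ∀ t, ∃ m : ℕ, c ^ m * t ∈ antidominant (P := P) b F := by
  obtain ⟨ϖ, hϖ⟩ := exists_valuation_lt_one F
  refine ⟨heightTorus b ϖ, ?_, fun t => (eventually_isAntidominant hϖ t).exists⟩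
  have h := isAntidominant_heightTorus_pow (P := P) (b := b) hϖ 1
  have e : heightTorus b ϖ ^ 1 = heightTorus b ϖ := pow_one _
  rwa [e] at h

lemma antiTau_mul {t s : Torus X F} (ht : IsAntidominant (P := P) b t)
    (hs : IsAntidominant (P := P) b s) :
    V.antiTau b k t ht * V.antiTau b k s hs = V.antiTau b k (t * s) (ht.mul hs) :=
  Subtype.ext (tau_mul k ht hs)

omit [P.IsReduced] in
lemma antiTau_eq_one {t : Torus X F} (ht : IsAntidominant (P := P) b t)
    (h : t ∈ V.torusOne b) : V.antiTau b k t ht = 1 :=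
  Subtype.ext (Hecke.tau_eq_one (V.finiteDoubleCosets_iwahori F b) h)

variable {R : Type*} [CommRing R] [Algebra k R]

/-- By multiplicativity of the `τ_t`, the map `t ↦ ξ(τ_t)` is a homomorphism on antidominant
elements. It extends to `T`. -/
theorem exists_isAttached {ξ : V.antiAlgebra F b k →ₐ[k] R} (hξ : V.IsRegular ξ) :
    ∃ φ : Torus X F →* Rˣ, V.IsAttached ξ φ := by
  let ψ : antidominant (P := P) b F →* Rˣ :=
    MonoidHom.mk' (M := antidominant (P := P) b F) (fun t => (hξ t t.2).unit) fun t s => by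
      ext
      rw [Units.val_mul, IsUnit.unit_spec, IsUnit.unit_spec, IsUnit.unit_spec, ← map_mul]
      exact congrArg ξ (antiTau_mul t.2 s.2).symm
  obtain ⟨c, hc, hM⟩ := exists_pow_mul_mem_antidominant (P := P) b F
  obtain ⟨φ, hφ⟩ := Submonoid.exists_monoidHom_extend hc hM ψ
  refine ⟨φ⁻¹, fun t ht => ?_, fun t ht => ?_⟩
  · have ht' : IsAntidominant (P := P) b t :=
      isAntidominant_of_mem_intPoints (iwahori_le_intPoints ht)
    have h1 : φ t = 1 := by
      rw [hφ ⟨t, ht'⟩]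
      ext
      change ξ (V.antiTau b k t ht') = 1
      rw [antiTau_eq_one ht' ht, map_one]
    rw [MonoidHom.inv_apply, h1, inv_one]
  · rw [MonoidHom.inv_apply, torus_map_inv, inv_inv, hφ ⟨t, ht⟩]
    rfl

theorem IsAttached.unique {ξ : V.antiAlgebra F b k →ₐ[k] R} {φ φ' : Torus X F →* Rˣ}
    (h : V.IsAttached ξ φ) (h' : V.IsAttached ξ φ') : φ' = φ := by
  obtain ⟨c, hc, hM⟩ := exists_pow_mul_mem_antidominant (P := P) b F
  have key : ∀ t ∈ antidominant (P := P) b F, φ' t = φ t := fun t ht => by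
    have h1 : φ' t⁻¹ = φ t⁻¹ := Units.ext ((h'.2 t ht).symm.trans (h.2 t ht))
    rwa [torus_map_inv, torus_map_inv, inv_inj] at h1
  ext1 t
  obtain ⟨m, hm⟩ := hM t
  have h1 := key _ hm
  rw [map_mul, map_mul, torus_map_pow, torus_map_pow, key c hc] at h1
  exact mul_left_cancel h1

/-! ### The function supported on `B I` -/

open Classical in
variable (V b) in
/-- The function with value `φ(t)` at `t u i` for `t ∈ T`, `u ∈ U` and `i ∈ I`, extended by zero
to `G`. It is well defined if `φ` is trivial on `T¹`. -/
noncomputable def borelFun (φ : Torus X F →* Rˣ) (g : V.points F) : R :=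
  if h : ∃ t, ∃ u ∈ V.unipotentPoints F b, ∃ i ∈ V.iwahori F b, g = V.torusPoints F t * u * i then
    φ h.choose else 0

variable {φ : Torus X F →* Rˣ}

omit [P.IsReduced] [TopologicalSpace F] [IsNonarchimedeanLocalField F] in
lemma exists_of_borelFun_ne_zero {g : V.points F} (h : V.borelFun b φ g ≠ 0) :
    ∃ t, ∃ u ∈ V.unipotentPoints F b, ∃ i ∈ V.iwahori F b,
      g = V.torusPoints F t * u * i := by
  by_contra h'
  exact h (dif_neg h')

section

variable (hφ : ∀ t ∈ V.torusOne b, φ t = 1)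
include hφ

omit [TopologicalSpace F] [IsNonarchimedeanLocalField F] in
lemma borelFun_apply (t : Torus X F) {u i : V.points F} (hu : u ∈ V.unipotentPoints F b)
    (hi : i ∈ V.iwahori F b) : V.borelFun b φ (V.torusPoints F t * u * i) = φ t := by
  have h : ∃ t', ∃ u' ∈ V.unipotentPoints F b, ∃ i' ∈ V.iwahori F b,
      V.torusPoints F t * u * i = V.torusPoints F t' * u' * i' := ⟨t, u, hu, i, hi, rfl⟩
  have e : V.borelFun b φ (V.torusPoints F t * u * i) = φ h.choose := dif_pos h
  obtain ⟨u', hu', i', hi', e'⟩ := h.choose_spec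
  set t' := h.choose
  rw [e]
  have h1 : V.torusPoints F (t'⁻¹ * t) *
      (((V.torusPoints F t)⁻¹ * (V.torusPoints F t' * u'⁻¹ * (V.torusPoints F t')⁻¹) *
        V.torusPoints F t) * u) ∈ V.iwahori F b := by
    have e1 : V.torusPoints F (t'⁻¹ * t) *
      (((V.torusPoints F t)⁻¹ * (V.torusPoints F t' * u'⁻¹ * (V.torusPoints F t')⁻¹) *
        V.torusPoints F t) * u) = i' * i⁻¹ := by
      have e2 : i' = (V.torusPoints F t' * u')⁻¹ * (V.torusPoints F t * u * i) := by
        rw [e']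
        group
      rw [e2, map_mul, torus_map_inv]
      group
    rw [e1]
    exact mul_mem hi' (inv_mem hi)
  have h2 := hφ _ (torusPoints_mem_iwahori (mul_mem (torusPoints_inv_conj_mem_unipotentPoints t
    (torusPoints_conj_mem_unipotentPoints t' (inv_mem hu'))) hu) h1)
  rw [map_mul, torus_map_inv, inv_mul_eq_one] at h2
  rw [h2]

omit [TopologicalSpace F] [IsNonarchimedeanLocalField F] in
lemma borelFun_mul_right {i : V.points F} (hi : i ∈ V.iwahori F b) (g : V.points F) :
    V.borelFun b φ (g * i) = V.borelFun b φ g := by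
  by_cases h : V.borelFun b φ g = 0
  · rw [h]
    by_contra h'
    obtain ⟨t, u, hu, i', hi', e⟩ := exists_of_borelFun_ne_zero h'
    have e1 : g = V.torusPoints F t * u * (i' * i⁻¹) := by
      rw [← mul_assoc, ← e, mul_inv_cancel_right]
    rw [e1, borelFun_apply hφ t hu (mul_mem hi' (inv_mem hi))] at h
    refine h' ?_
    rw [e, borelFun_apply hφ t hu hi', h]
  · obtain ⟨t, u, hu, i', hi', rfl⟩ := exists_of_borelFun_ne_zero h
    rw [mul_assoc, borelFun_apply hφ t hu hi', borelFun_apply hφ t hu (mul_mem hi' hi)]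

omit [TopologicalSpace F] [IsNonarchimedeanLocalField F] in
lemma borelFun_mul_left (t : Torus X F) {u : V.points F} (hu : u ∈ V.unipotentPoints F b)
    (g : V.points F) :
    V.borelFun b φ (V.torusPoints F t * u * g) = φ t * V.borelFun b φ g := by
  have key : ∀ (t : Torus X F) (u : V.points F), u ∈ V.unipotentPoints F b → ∀ g,
      V.borelFun b φ g ≠ 0 → V.borelFun b φ (V.torusPoints F t * u * g) =
        φ t * V.borelFun b φ g := by
    intro t u hu g hg
    obtain ⟨t', u', hu', i, hi, rfl⟩ := exists_of_borelFun_ne_zero hg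
    rw [borelFun_apply hφ t' hu' hi, ← Units.val_mul, ← map_mul φ t t', ← borelFun_apply hφ _
      (mul_mem (torusPoints_inv_conj_mem_unipotentPoints t' hu) hu') hi, map_mul]
    congr 1
    group
  by_cases h : V.borelFun b φ g = 0
  · rw [h, mul_zero]
    by_contra h'
    have h1 := key t⁻¹ _ (torusPoints_conj_mem_unipotentPoints t (inv_mem hu)) _ h'
    have e : V.torusPoints F t⁻¹ * (V.torusPoints F t * u⁻¹ * (V.torusPoints F t)⁻¹) *
        (V.torusPoints F t * u * g) = g := by
      rw [torus_map_inv]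
      group
    rw [e, h] at h1
    exact h' ((Units.mul_right_eq_zero _).1 h1.symm)
  · exact key t u hu g h

/-- The function `f₀` supported on `B I` is an eigenvector for right convolution by `τ_t`, `t`
antidominant. -/
lemma conv_borelFun_tau {t : Torus X F} (ht : IsAntidominant (P := P) b t) (x : V.points F) :
    Hecke.conv (V.iwahori F b) (V.borelFun b φ)
      (fun y => algebraMap k R ((V.tau b k t).1 y)) x = (φ t⁻¹ : Rˣ) * V.borelFun b φ x := by
  classical
  cases subsingleton_or_nontrivial R
  · exact Subsingleton.elim _ _
  -- if `f₀(z) τ_t(z⁻¹ x) ≠ 0`, then `x ∈ β t I` and `z ∈ β I` for some `β ∈ B`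
  have key : ∀ z, V.borelFun b φ z * algebraMap k R ((V.tau b k t).1 (z⁻¹ * x)) ≠ 0 →
      ∃ β ∈ V.borelPoints F b, (∃ i ∈ V.iwahori F b, x = β * V.torusPoints F t * i) ∧
        β⁻¹ * z ∈ V.iwahori F b := by
    intro z hz
    obtain ⟨t₁, u₁, h₁, i₁, hi₁, rfl⟩ := exists_of_borelFun_ne_zero (left_ne_zero_of_mul hz)
    have h0 : (V.tau b k t).1 ((V.torusPoints F t₁ * u₁ * i₁)⁻¹ * x) ≠ 0 := fun h0 => by
      rw [h0, map_zero, mul_zero] at hz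
      exact hz rfl
    obtain ⟨i₂, hi₂, i₃, hi₃, e⟩ := exists_of_tau_ne_zero h0
    obtain ⟨β, hβ, hβI, i₄, hi₄, e₄⟩ := exists_mul_torusPoints_eq ht (mul_mem hi₁ hi₂)
    refine ⟨V.torusPoints F t₁ * u₁ * β, mul_mem ⟨t₁, u₁, h₁, rfl⟩ hβ,
      ⟨i₄ * i₃, mul_mem hi₄ hi₃, ?_⟩, ?_⟩
    · rw [inv_mul_eq_iff_eq_mul] at e
      calc x = V.torusPoints F t₁ * u₁ * (i₁ * i₂ * V.torusPoints F t) * i₃ := by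
            rw [e]
            group
        _ = _ := by
            rw [e₄]
            group
    · have e5 : (V.torusPoints F t₁ * u₁ * β)⁻¹ * (V.torusPoints F t₁ * u₁ * i₁) = β⁻¹ * i₁ := by
        group
      rw [e5]
      exact mul_mem (inv_mem hβI) hi₁
  have hinv : ∀ i ∈ V.iwahori F b, ∀ z, V.borelFun b φ (z * i) *
      algebraMap k R ((V.tau b k t).1 ((z * i)⁻¹ * x)) =
        V.borelFun b φ z * algebraMap k R ((V.tau b k t).1 (z⁻¹ * x)) :=
    Hecke.term_inv (h := V.borelFun b φ) (f := fun y => algebraMap k R ((V.tau b k t).1 y))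
      (fun i hi x => borelFun_mul_right hφ hi x)
      (fun i hi y => by rw [(V.tau b k t).2.1 i hi]) x
  by_cases hx : V.borelFun b φ x = 0
  · rw [hx, mul_zero]
    by_contra h0
    obtain ⟨y, hy⟩ : ∃ y : V.points F ⧸ V.iwahori F b,
        V.borelFun b φ y.out * algebraMap k R ((V.tau b k t).1 (y.out⁻¹ * x)) ≠ 0 := by
      by_contra! h
      exact h0 (finsum_eq_zero_of_forall_eq_zero h)
    obtain ⟨β, hβ, ⟨i, hi, e⟩, -⟩ := key _ hy
    obtain ⟨t', u', hu', e'⟩ := mul_mem hβ (torusPoints_mem_borelPoints t)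
    rw [e, e', borelFun_apply hφ t' hu' hi] at hx
    exact (φ t').ne_zero hx
  · obtain ⟨t₁, u₁, h₁, i₁, hi₁, e⟩ := exists_of_borelFun_ne_zero hx
    have hβ : V.torusPoints F t₁ * u₁ * (V.torusPoints F t)⁻¹ ∈ V.borelPoints F b :=
      mul_mem ⟨t₁, u₁, h₁, rfl⟩ (inv_mem (torusPoints_mem_borelPoints t))
    have ex : x = V.torusPoints F t₁ * u₁ * (V.torusPoints F t)⁻¹ * V.torusPoints F t * i₁ := by
      rw [e]
      group
    set β := V.torusPoints F t₁ * u₁ * (V.torusPoints F t)⁻¹ with eβ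
    unfold Hecke.conv
    rw [finsum_eq_single _ (β : V.points F ⧸ V.iwahori F b)]
    · rw [Hecke.apply_out (F := fun z => V.borelFun b φ z *
        algebraMap k R ((V.tau b k t).1 (z⁻¹ * x))) hinv]
      have e1 : V.borelFun b φ β = φ (t₁ * t⁻¹) := by
        have h := borelFun_apply hφ (t₁ * t⁻¹)
          (torusPoints_conj_mem_unipotentPoints t h₁) (one_mem (V.iwahori F b))
        rw [← h, eβ, map_mul, torus_map_inv]
        congr 1
        group
      have e2 : (V.tau b k t).1 (β⁻¹ * x) = 1 := by
        have h := tau_apply_mul_mul (k := k) t (one_mem (V.iwahori F b)) hi₁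
        have e3 : β⁻¹ * x = 1 * V.torusPoints F t * i₁ := by
          rw [ex]
          group
        rwa [e3]
      rw [e1, e2, map_one, mul_one, e, borelFun_apply hφ t₁ h₁ hi₁, map_mul, Units.val_mul,
        mul_comm]
    · intro y hy
      by_contra h0
      obtain ⟨β', hβ', ⟨i', hi', e'⟩, e''⟩ := key _ h0
      refine hy ?_
      rw [← QuotientGroup.out_eq' y]
      refine Eq.trans (QuotientGroup.eq.2 e'').symm (QuotientGroup.eq.2 ?_)
      refine mem_iwahori_of_borel_inv_conj ht (mul_mem (inv_mem hβ') hβ) ?_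
      have e4 : (V.torusPoints F t)⁻¹ * (β'⁻¹ * β) * V.torusPoints F t = i' * i₁⁻¹ := by
        rw [eq_mul_inv_iff_mul_eq]
        calc _ = (V.torusPoints F t)⁻¹ * β'⁻¹ * (β * V.torusPoints F t * i₁) := by group
          _ = _ := by
            rw [← ex, e']
            group
      rw [e4]
      exact mul_mem hi' (inv_mem hi₁)

lemma translate_borelFun_mem_induced (g : V.points F) :
    (fun y => V.borelFun b φ (y * g⁻¹)) ∈ V.induced b φ := by
  refine ⟨fun t u hu y => ?_, ?_⟩
  · change V.borelFun b φ (V.torusPoints F t * u * y * g⁻¹) = _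
    rw [mul_assoc (V.torusPoints F t * u), borelFun_mul_left hφ t hu]
  · have hc : Continuous fun w : V.points F => g * w * g⁻¹ := by fun_prop
    refine isOpen_stabilizer ((V.isOpen_iwahori b F).preimage hc)
      (fun y => V.borelFun b φ (y * g⁻¹)) ?_ fun w hw y => ?_
    · simp
    · have e : y * w * g⁻¹ = y * g⁻¹ * (g * w * g⁻¹) := by group
      change V.borelFun b φ (y * w * g⁻¹) = V.borelFun b φ (y * g⁻¹)
      rw [e, borelFun_mul_right hφ hw]

lemma convMap_borelFun_mem_induced (f : V.Universal F b k) :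
    Hecke.convMap (V.borelFun b φ) f ∈ V.induced b φ := by
  have hf : f ∈ Submodule.span k (Set.range (Hecke.delta k (V.iwahori F b))) := by
    rw [Hecke.span_delta]
    trivial
  induction hf using Submodule.span_induction with
  | mem f hf =>
    obtain ⟨g, rfl⟩ := hf
    have h := translate_borelFun_mem_induced hφ g
    convert h using 1
    funext y
    exact Hecke.convMap_delta (fun i hi x => borelFun_mul_right hφ hi x) g y
  | zero =>
    rw [map_zero]
    exact zero_mem _
  | add f f' _ _ h h' =>
    rw [map_add]
    exact add_mem h h'
  | smul c f _ h =>
    rw [map_smul, ← algebraMap_smul R c]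
    exact Submodule.smul_mem _ _ h

lemma convMap_borelFun_tau_smul {t : Torus X F} (ht : IsAntidominant (P := P) b t)
    (f : V.Universal F b k) :
    Hecke.convMap (V.borelFun b φ) (V.tau b k t • f) =
      ((φ t⁻¹ : Rˣ) : R) • Hecke.convMap (V.borelFun b φ) f := by
  have hf : f ∈ Submodule.span k (Set.range (Hecke.delta k (V.iwahori F b))) := by
    rw [Hecke.span_delta]
    trivial
  induction hf using Submodule.span_induction with
  | mem f hf =>
    obtain ⟨g, rfl⟩ := hf
    funext y
    rw [Hecke.convMap_smul_delta, conv_borelFun_tau hφ ht, Pi.smul_apply,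
      Hecke.convMap_delta (fun i hi x => borelFun_mul_right hφ hi x) g y, smul_eq_mul]
  | zero => simp
  | add f f' _ _ h h' => rw [smul_add, map_add, h, h', map_add, smul_add]
  | smul c f _ h =>
    have e : V.tau b k t • c • f = c • V.tau b k t • f :=
      Subtype.ext (Hecke.conv_smul_right c f.1 (V.tau b k t).2.2.2.2)
    rw [e, map_smul, h, map_smul, smul_comm]

end

end ChevalleyLattice

namespace ChevalleyLattice

open ValuativeRel (valuation)

variable {ι X Y : Type*} [Finite ι] [AddCommGroup X] [AddCommGroup Y] {P : RootDatum ι X Y}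
  {J : Type*} [Fintype J] [DecidableEq J] {V : ChevalleyLattice P J} {b : P.Base}
  {F : Type*} [Field F] [ValuativeRel F]

variable [P.IsReduced] [TopologicalSpace F] [IsNonarchimedeanLocalField F] {k : Type*} [Field k]
  {R : Type*} [CommRing R] [Algebra k R] {ξ : V.antiAlgebra F b k →ₐ[k] R} {φ : Torus X F →* Rˣ}

/-! ### The classes of the functions `1_{I g}` in `ξ ⊗ X` -/

omit [P.IsReduced] in
lemma charTmul_add (r : R) (f f' : V.Universal F b k) :
    V.charTmul ξ r (f + f') = V.charTmul ξ r f + V.charTmul ξ r f' :=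
  congrArg Submodule.Quotient.mk (TensorProduct.tmul_add r f f')

omit [P.IsReduced] in
lemma charTmul_zero (r : R) : V.charTmul ξ r 0 = 0 :=
  congrArg Submodule.Quotient.mk (TensorProduct.tmul_zero _ r)

omit [P.IsReduced] in
lemma charTmul_eq_smul (r : R) (f : V.Universal F b k) :
    V.charTmul ξ r f = r • V.charTmul ξ 1 f := by
  have h : r • (TensorProduct.tmul k (1 : R) f) = TensorProduct.tmul k r f := by
    rw [TensorProduct.smul_tmul', smul_eq_mul, mul_one]
  exact congrArg Submodule.Quotient.mk h.symm

omit [P.IsReduced] in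
lemma charTmul_smul (c : k) (r : R) (f : V.Universal F b k) :
    V.charTmul ξ r (c • f) = algebraMap k R c • V.charTmul ξ r f := by
  have h : TensorProduct.tmul k r (c • f) = algebraMap k R c • TensorProduct.tmul k r f := by
    rw [algebraMap_smul, TensorProduct.tmul_smul]
  exact congrArg Submodule.Quotient.mk h

omit [P.IsReduced] in
lemma charTmul_antiAlgebra_smul (a : V.antiAlgebra F b k) (f : V.Universal F b k) :
    V.charTmul ξ 1 ((a : V.HeckeAlg F b k) • f) = ξ a • V.charTmul ξ 1 f := by
  rw [← charTmul_eq_smul]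
  refine ((Submodule.Quotient.eq _).2 ?_).symm
  exact Submodule.subset_span ⟨1, a, f, by rw [one_mul]⟩

omit [P.IsReduced] in
lemma charTmul_mem_span {A : Set (V.points F)} {f : V.Universal F b k}
    (hf : f ∈ Submodule.span k (Hecke.delta k (V.iwahori F b) '' A)) :
    V.charTmul ξ 1 f ∈
      Submodule.span R ((fun g => V.charTmul ξ 1 (Hecke.delta k (V.iwahori F b) g)) '' A) := by
  induction hf using Submodule.span_induction with
  | mem f hf =>
    obtain ⟨g, hg, rfl⟩ := hf
    exact Submodule.subset_span ⟨g, hg, rfl⟩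
  | zero =>
    rw [charTmul_zero]
    exact zero_mem _
  | add f f' _ _ h h' =>
    rw [charTmul_add]
    exact add_mem h h'
  | smul c f _ h =>
    rw [charTmul_smul]
    exact Submodule.smul_mem _ _ h

omit [P.IsReduced] in
lemma span_charTmul_delta :
    Submodule.span R (Set.range fun g => V.charTmul ξ 1 (Hecke.delta k (V.iwahori F b) g)) = ⊤ := by
  rw [eq_top_iff]
  rintro z -
  obtain ⟨z, rfl⟩ := Submodule.Quotient.mk_surjective _ z
  induction z using TensorProduct.induction_on with
  | zero =>
    rw [Submodule.Quotient.mk_zero]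
    exact zero_mem _
  | add z z' h h' =>
    rw [Submodule.Quotient.mk_add]
    exact add_mem h h'
  | tmul r f =>
    change V.charTmul ξ r f ∈ _
    rw [charTmul_eq_smul]
    refine Submodule.smul_mem _ _ ?_
    have h := charTmul_mem_span (ξ := ξ) (A := Set.univ) (f := f)
      (by rw [Set.image_univ, Hecke.span_delta]; trivial)
    rwa [Set.image_univ] at h

/-- Multiplication by `ξ(τ_t)`, which is a unit, maps the class of `1_{I g}` to a combination of
the classes of `1_{I t n g}` with `n ∈ U⁻ ∩ I`. -/
lemma charTmul_delta_mem_span (h : V.IsAttached ξ φ) {t : Torus X F}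
    (ht : IsAntidominant (P := P) b t) (g : V.points F) :
    V.charTmul ξ 1 (Hecke.delta k (V.iwahori F b) g) ∈
      Submodule.span R ((fun g => V.charTmul ξ 1 (Hecke.delta k (V.iwahori F b) g)) ''
        {x | ∃ n ∈ V.oppPoints F b, n ∈ V.iwahori F b ∧ x = V.torusPoints F t * n * g}) := by
  have h1 := Submodule.smul_mem _ ((φ t : Rˣ) : R)
    (charTmul_mem_span (ξ := ξ) (tau_smul_delta_mem_span (k := k) ht g))
  have h2 := charTmul_antiAlgebra_smul (ξ := ξ) (V.antiTau b k t ht)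
    (Hecke.delta k (V.iwahori F b) g)
  rw [h.apply_antiTau t ht] at h2
  have h3 : V.charTmul ξ 1 (V.tau b k t • Hecke.delta k (V.iwahori F b) g) =
      ((φ t⁻¹ : Rˣ) : R) • V.charTmul ξ 1 (Hecke.delta k (V.iwahori F b) g) := h2
  rwa [h3, smul_smul, torus_map_inv, Units.mul_inv, one_smul] at h1

/-- For `s`, `t` antidominant, the classes of `1_{I t κ}`, `κ ∈ K`, are combinations of those of
`1_{I s t κ}`. -/
lemma charTmul_delta_mul_mem_span (h : V.IsAttached ξ φ) {s t : Torus X F}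
    (hs : IsAntidominant (P := P) b s) (ht : IsAntidominant (P := P) b t) {κ : V.points F}
    (hκ : κ ∈ V.intPoints F) :
    V.charTmul ξ 1 (Hecke.delta k (V.iwahori F b) (V.torusPoints F t * κ)) ∈
      Submodule.span R (Set.range fun κ : V.intPoints F =>
        V.charTmul ξ 1 (Hecke.delta k (V.iwahori F b) (V.torusPoints F (s * t) * κ))) := by
  refine Submodule.span_mono ?_ (charTmul_delta_mem_span h hs _)
  rintro _ ⟨_, ⟨n, hn, hnI, rfl⟩, rfl⟩
  refine ⟨⟨(V.torusPoints F t)⁻¹ * n * V.torusPoints F t * κ,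
    mul_mem (iwahori_le_intPoints (torusPoints_inv_conj_mem_iwahori ht hn hnI)) hκ⟩, ?_⟩
  dsimp only
  congr 2
  rw [map_mul]
  group

lemma charTmul_delta_mul_of_mem_intPoints (h : V.IsAttached ξ φ) {t : Torus X F}
    (ht : V.torusPoints F t ∈ V.intPoints F) (g : V.points F) :
    V.charTmul ξ 1 (Hecke.delta k (V.iwahori F b) (V.torusPoints F t * g)) =
      φ t⁻¹ • V.charTmul ξ 1 (Hecke.delta k (V.iwahori F b) g) := by
  have ht' := isAntidominant_of_mem_intPoints (b := b) ht
  have h2 := charTmul_antiAlgebra_smul (ξ := ξ) (V.antiTau b k t ht')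
    (Hecke.delta k (V.iwahori F b) g)
  rw [h.apply_antiTau t ht'] at h2
  rw [← tau_smul_delta_of_mem_intPoints ht]
  exact h2

variable (V b) in
/-- The vectors of `ξ ⊗ X` which exhaust it: the classes of `1_{I cᵐ⁺¹ κ}` for `κ ∈ K`, where `c` is
the strictly antidominant element attached to `ϖ`. The exponent is positive, so that conjugation by
`cᵐ⁺¹` maps `U ∩ K` to `I`. -/
noncomputable def charVec (ξ : V.antiAlgebra F b k →ₐ[k] R) (ϖ : Fˣ) (m : ℕ)
    (κ : V.intPoints F) : V.CharTensor ξ :=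
  V.charTmul ξ 1 (Hecke.delta k (V.iwahori F b) (V.torusPoints F (heightTorus b ϖ ^ (m + 1)) * κ))

variable {ϖ : Fˣ}

lemma charVec_mem_span_succ (h : V.IsAttached ξ φ) (hϖ : valuation F (ϖ : F) < 1) (m : ℕ)
    (κ : V.intPoints F) :
    V.charVec b ξ ϖ m κ ∈ Submodule.span R (Set.range (V.charVec b ξ ϖ (m + 1))) := by
  have h1 := charTmul_delta_mul_mem_span h (isAntidominant_heightTorus_pow (b := b) hϖ 1)
    (isAntidominant_heightTorus_pow hϖ (m + 1)) κ.2
  have e : heightTorus b ϖ ^ 1 * heightTorus b ϖ ^ (m + 1) = heightTorus b ϖ ^ (m + 1 + 1) := by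
    rw [← pow_add, add_comm]
  rwa [e] at h1

/-- The vectors `charVec` span `ξ ⊗ X`. For given `g`, there are finitely many `s = t u κ`,
`t ∈ T`, `u ∈ U`, `κ ∈ K`, with `I g ⊂ ⋃ s I`. Applying `τ_{cᵐ}`, the class of `1_{I g}` is a
combination of classes of `1_{I cᵐ s i}`, and for `m` large `I cᵐ s i = I cᵐ t κ i` with `cᵐ t`
antidominant. Finally some antidominant element brings `cᵐ t` to a power of `c`. -/
lemma iSup_span_charVec (h : V.IsAttached ξ φ) (hϖ : valuation F (ϖ : F) < 1) :
    ⨆ m, Submodule.span R (Set.range (V.charVec b ξ ϖ m)) = ⊤ := by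
  rw [eq_top_iff, ← span_charTmul_delta, Submodule.span_le]
  rintro _ ⟨g, rfl⟩
  obtain ⟨S, hS⟩ := V.finiteDoubleCosets_iwahori F b g
  choose t u hu κ hκ hdec using exists_iwasawa (V := V) (F := F) b
  have ev1 : ∀ᶠ m : ℕ in Filter.atTop, ∀ s ∈ S,
      IsAntidominant (P := P) b (heightTorus b ϖ ^ m * t s) ∧
      V.torusPoints F (heightTorus b ϖ ^ m) *
        (V.torusPoints F (t s) * u s * (V.torusPoints F (t s))⁻¹) *
        (V.torusPoints F (heightTorus b ϖ ^ m))⁻¹ ∈ V.iwahori F b :=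
    (Finset.eventually_all S).2 fun s _ => (eventually_isAntidominant hϖ (t s)).and
      (eventually_heightTorus_conj_mem_iwahori hϖ
        (torusPoints_conj_mem_unipotentPoints (t s) (hu s)))
  obtain ⟨m, hm⟩ := ev1.exists
  have ev2 : ∀ᶠ n : ℕ in Filter.atTop, ∀ s ∈ S,
      IsAntidominant (P := P) b (heightTorus b ϖ ^ n * (heightTorus b ϖ ^ m * t s)⁻¹) :=
    (Finset.eventually_all S).2 fun s _ => eventually_isAntidominant hϖ _
  obtain ⟨n, hn⟩ := ((Filter.tendsto_add_atTop_nat 1).eventually ev2).exists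
  refine Submodule.mem_iSup_of_mem n ?_
  refine Submodule.span_le.2 ?_
    (charTmul_delta_mem_span h (isAntidominant_heightTorus_pow hϖ m) g)
  rintro _ ⟨_, ⟨i, hi, hiI, rfl⟩, rfl⟩
  obtain ⟨s, hs, i', hi', e⟩ := hS i hiI
  have h1 := charTmul_delta_mul_mem_span h (hn s hs) (hm s hs).1
    (mul_mem (hκ s) (iwahori_le_intPoints hi'))
  have e1 : heightTorus b ϖ ^ (n + 1) * (heightTorus b ϖ ^ m * t s)⁻¹ *
      (heightTorus b ϖ ^ m * t s) = heightTorus b ϖ ^ (n + 1) := inv_mul_cancel_right (G := Torus X F) _ _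
  rw [e1] at h1
  have e2 : V.torusPoints F (heightTorus b ϖ ^ m) * i * g =
      V.torusPoints F (heightTorus b ϖ ^ m) *
        (V.torusPoints F (t s) * u s * (V.torusPoints F (t s))⁻¹) *
        (V.torusPoints F (heightTorus b ϖ ^ m))⁻¹ *
      (V.torusPoints F (heightTorus b ϖ ^ m * t s) * (κ s * i')) := by
    calc _ = V.torusPoints F (heightTorus b ϖ ^ m) * (s * i') := by
          rw [← e]
          group
      _ = V.torusPoints F (heightTorus b ϖ ^ m) * (V.torusPoints F (t s) * u s * κ s * i') := by
          rw [← hdec]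
      _ = _ := by
          rw [map_mul]
          group
  dsimp only
  rw [e2, Hecke.delta_mul_left (hm s hs).2]
  exact h1

omit [P.IsReduced] in
lemma finite_range_charVec (m : ℕ) : (Set.range (V.charVec b ξ ϖ m)).Finite := by
  classical
  obtain ⟨S, hS⟩ := V.exists_finset_intPoints b F
  obtain ⟨S', hS'⟩ := V.finiteDoubleCosets_iwahori F b
    (V.torusPoints F (heightTorus b ϖ ^ (m + 1)))⁻¹
  refine ((S' ×ˢ S).image fun p => V.charTmul ξ 1 (Hecke.delta k (V.iwahori F b)
    (p.1⁻¹ * p.2))).finite_toSet.subset ?_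
  rintro _ ⟨κ, rfl⟩
  obtain ⟨x, hx, hi⟩ := hS κ κ.2
  obtain ⟨s, hs, i, hi', e⟩ := hS' _ (inv_mem hi)
  refine Finset.mem_coe.2 (Finset.mem_image.2 ⟨(s, x), Finset.mem_product.2 ⟨hs, hx⟩, ?_⟩)
  have e1 : V.torusPoints F (heightTorus b ϖ ^ (m + 1)) * κ = i⁻¹ * (s⁻¹ * x) := by
    calc _ = ((κ * x⁻¹)⁻¹ * (V.torusPoints F (heightTorus b ϖ ^ (m + 1)))⁻¹)⁻¹ * x := by group
      _ = _ := by
        rw [e]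
        group
  unfold charVec
  rw [e1, Hecke.delta_mul_left (inv_mem hi')]

/-! ### The isomorphism with the induced representation -/

lemma convMap_antiAlgebra_smul (h : V.IsAttached ξ φ) (a : V.antiAlgebra F b k)
    (f : V.Universal F b k) :
    Hecke.convMap (V.borelFun b φ) ((a : V.HeckeAlg F b k) • f) =
      ξ a • Hecke.convMap (V.borelFun b φ) f := by
  obtain ⟨a, ha⟩ := a
  change Hecke.convMap (V.borelFun b φ) (a • f) = _
  induction ha using Algebra.adjoin_induction generalizing f with
  | mem a ha =>
    obtain ⟨t, ht, rfl⟩ := ha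
    rw [convMap_borelFun_tau_smul h.trivial ht, ← h.apply_antiTau t ht]
    rfl
  | algebraMap c =>
    have e1 : algebraMap k (V.HeckeAlg F b k) c • f = c • f := by
      have e0 : (c • (1 : V.HeckeAlg F b k)) • f = c • ((1 : V.HeckeAlg F b k) • f) :=
        Subtype.ext (Hecke.conv_smul_left c f.1 (1 : V.HeckeAlg F b k).2.2.2.2)
      rw [Algebra.algebraMap_eq_smul_one, e0, one_smul]
    have e2 : ξ ⟨algebraMap k (V.HeckeAlg F b k) c, Subalgebra.algebraMap_mem _ c⟩ =
        algebraMap k R c := ξ.commutes c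
    rw [e1, map_smul]
    refine Eq.trans ?_ (congrArg (· • Hecke.convMap (V.borelFun b φ) f) e2.symm)
    exact (algebraMap_smul R c _).symm
  | add a a' ha ha' h1 h2 =>
    have e : ξ ⟨a + a', add_mem ha ha'⟩ = ξ ⟨a, ha⟩ + ξ ⟨a', ha'⟩ := map_add ξ ⟨a, ha⟩ ⟨a', ha'⟩
    rw [add_smul, map_add, h1, h2, ← add_smul, ← e]
  | mul a a' ha ha' h1 h2 =>
    have e : ξ ⟨a * a', mul_mem ha ha'⟩ = ξ ⟨a, ha⟩ * ξ ⟨a', ha'⟩ := map_mul ξ ⟨a, ha⟩ ⟨a', ha'⟩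
    rw [mul_smul, h1, h2, smul_smul, ← e]

/-- The map from `ξ ⊗ X` to functions on `G` which sends `r ⊗ 1_{I g}` to the right translate by
`g⁻¹` of `r f₀`, where `f₀` is the function supported on `B I`. -/
noncomputable def charMap (h : V.IsAttached ξ φ) : V.CharTensor ξ →ₗ[R] (V.points F → R) :=
  Submodule.liftQ _ ((Hecke.convMap (V.borelFun b φ)).liftBaseChange R) <| by
    rw [Submodule.span_le]
    rintro _ ⟨r, a, x, rfl⟩
    rw [SetLike.mem_coe, LinearMap.mem_ker, map_sub, LinearMap.liftBaseChange_tmul,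
      LinearMap.liftBaseChange_tmul, convMap_antiAlgebra_smul h, smul_smul, sub_self]

lemma charMap_charTmul (h : V.IsAttached ξ φ) (r : R) (f : V.Universal F b k) :
    charMap h (V.charTmul ξ r f) = r • Hecke.convMap (V.borelFun b φ) f := by
  change (Hecke.convMap (V.borelFun b φ)).liftBaseChange R (TensorProduct.tmul k r f) = _
  rw [LinearMap.liftBaseChange_tmul]

lemma charMap_charTmul_delta (h : V.IsAttached ξ φ) (g y : V.points F) :
    charMap h (V.charTmul ξ 1 (Hecke.delta k (V.iwahori F b) g)) y =
      V.borelFun b φ (y * g⁻¹) := by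
  rw [charMap_charTmul, one_smul, Hecke.convMap_delta fun i hi x =>
    borelFun_mul_right h.trivial hi x]

lemma charMap_mem_induced (h : V.IsAttached ξ φ) (z : V.CharTensor ξ) :
    charMap h z ∈ V.induced b φ := by
  obtain ⟨z, rfl⟩ := Submodule.Quotient.mk_surjective _ z
  induction z using TensorProduct.induction_on with
  | zero =>
    rw [Submodule.Quotient.mk_zero, map_zero]
    exact zero_mem _
  | add z z' h1 h2 =>
    rw [Submodule.Quotient.mk_add, map_add]
    exact add_mem h1 h2
  | tmul r f =>
    change charMap h (V.charTmul ξ r f) ∈ _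
    rw [charMap_charTmul]
    exact Submodule.smul_mem _ _ (convMap_borelFun_mem_induced h.trivial f)

/-- The restriction of `charMap` to `K`. -/
noncomputable def charMapInt (h : V.IsAttached ξ φ) :
    V.CharTensor ξ →ₗ[R] (V.intPoints F → R) :=
  (LinearMap.funLeft R R Subtype.val).comp (charMap h)

lemma charMapInt_charVec (h : V.IsAttached ξ φ) (m : ℕ) (κ κ' : V.intPoints F) :
    charMapInt h (V.charVec b ξ ϖ m κ) κ' = V.borelFun b φ
      (κ' * (V.torusPoints F (heightTorus b ϖ ^ (m + 1)) * (κ : V.points F))⁻¹) :=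
  charMap_charTmul_delta h _ _

lemma charMapInt_charVec_self (h : V.IsAttached ξ φ) (m : ℕ) (κ : V.intPoints F) :
    charMapInt h (V.charVec b ξ ϖ m κ) κ = ((φ (heightTorus b ϖ ^ (m + 1)))⁻¹ : Rˣ) := by
  rw [charMapInt_charVec, ← torus_map_inv, ← borelFun_apply h.trivial _
    (one_mem (V.unipotentPoints F b)) (one_mem (V.iwahori F b)), torus_map_inv]
  congr 1
  group

/-- If the function attached to `charVec m κ` does not vanish at `κ'`, then `κ'` lies in
`(B ∩ K) c⁻ᵐ⁻¹ (U⁻ ∩ I) cᵐ⁺¹ κ`, and the component in `T` determines the value. -/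
lemma exists_of_charMapInt_ne_zero (h : V.IsAttached ξ φ) (hϖ : valuation F (ϖ : F) < 1) {m : ℕ} {κ κ' : V.intPoints F}
    (hne : charMapInt h (V.charVec b ξ ϖ m κ) κ' ≠ 0) :
    ∃ t, V.torusPoints F t ∈ V.intPoints F ∧ ∃ u ∈ V.unipotentPoints F b, u ∈ V.intPoints F ∧
      ∃ n ∈ V.oppPoints F b, n ∈ V.iwahori F b ∧
        (κ' : V.points F) = V.torusPoints F t * u *
          ((V.torusPoints F (heightTorus b ϖ ^ (m + 1)))⁻¹ * n *
            V.torusPoints F (heightTorus b ϖ ^ (m + 1))) * κ ∧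
        charMapInt h (V.charVec b ξ ϖ m κ) κ' =
          ((φ t * (φ (heightTorus b ϖ ^ (m + 1)))⁻¹ : Rˣ) : R) := by
  rw [charMapInt_charVec] at hne ⊢
  set c := heightTorus b ϖ ^ (m + 1)
  have hc : IsAntidominant (P := P) b c := isAntidominant_heightTorus_pow hϖ (m + 1)
  obtain ⟨t₂, u₂, hu₂, i, hi, e⟩ := exists_of_borelFun_ne_zero hne
  have hval := borelFun_apply h.trivial t₂ hu₂ hi
  rw [← e] at hval
  obtain ⟨t₃, ht₃, u₃, hu₃, hu₃I, n, hn, hnI, rfl⟩ := exists_eq_mul_of_mem_iwahori hi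
  have hu : (V.torusPoints F c)⁻¹ * ((V.torusPoints F t₃)⁻¹ * u₂ * V.torusPoints F t₃ * u₃) *
      V.torusPoints F c ∈ V.unipotentPoints F b :=
    torusPoints_inv_conj_mem_unipotentPoints c
      (mul_mem (torusPoints_inv_conj_mem_unipotentPoints t₃ hu₂) hu₃)
  set u := (V.torusPoints F c)⁻¹ * ((V.torusPoints F t₃)⁻¹ * u₂ * V.torusPoints F t₃ * u₃) *
      V.torusPoints F c with eu
  have e' : (κ' : V.points F) = V.torusPoints F (t₂ * t₃ * c) * u *
      ((V.torusPoints F c)⁻¹ * n * V.torusPoints F c) * κ := by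
    calc (κ' : V.points F) = κ' * (V.torusPoints F c * (κ : V.points F))⁻¹ *
          (V.torusPoints F c * κ) := (inv_mul_cancel_right _ _).symm
      _ = _ := by
        rw [e, eu, map_mul, map_mul]
        group
  have hnK := iwahori_le_intPoints (torusPoints_inv_conj_mem_iwahori hc hn hnI)
  have htu : V.torusPoints F (t₂ * t₃ * c) * u ∈ V.intPoints F := by
    have h1 := κ'.2
    rw [e'] at h1
    rwa [(V.intPoints F).mul_mem_cancel_right κ.2, (V.intPoints F).mul_mem_cancel_right hnK] at h1
  have htK := torusPoints_mem_intPoints hu htu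
  refine ⟨t₂ * t₃ * c, htK, u, hu, ((V.intPoints F).mul_mem_cancel_left htK).1 htu, n, hn, hnI,
    e', ?_⟩
  rw [hval, map_mul, map_mul, h.trivial t₃ ht₃, mul_one, mul_inv_cancel_right]

/-- If the function attached to `charVec m κ` does not vanish at `κ'`, then `I cᵐ⁺¹ κ'` and
`I t cᵐ⁺¹ κ` agree for some `t ∈ T ∩ K`, and `1_{I t g} = τ_t 1_{I g}` for such `t`. -/
lemma charVec_eq_smul (h : V.IsAttached ξ φ) (hϖ : valuation F (ϖ : F) < 1) (m : ℕ)
    (κ κ' : V.intPoints F) (hne : charMapInt h (V.charVec b ξ ϖ m κ) κ' ≠ 0) :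
    ∃ r : Rˣ, V.charVec b ξ ϖ m κ' = r • V.charVec b ξ ϖ m κ := by
  obtain ⟨t, ht, u, hu, huK, n, hn, hnI, e, -⟩ := exists_of_charMapInt_ne_zero h hϖ hne
  refine ⟨φ t⁻¹, ?_⟩
  unfold charVec
  rw [← charTmul_delta_mul_of_mem_intPoints h ht]
  set c := heightTorus b ϖ ^ (m + 1) with hc
  -- since `m + 1 > 0`, conjugation by `c ^ (m + 1)` contracts `U ∩ K` into `I`
  have huI : V.torusPoints F c * u * (V.torusPoints F c)⁻¹ ∈ V.iwahori F b :=
    heightTorus_conj_mem_iwahori hϖ hu fun i j => by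
      have h1 := (mem_intPoints_iff.1 huK).1 i j
      refine (mul_le_of_le_one_right' h1).trans_lt ?_
      exact pow_lt_one₀ zero_le hϖ m.succ_ne_zero
  have e1 : V.torusPoints F c * κ' = V.torusPoints F t *
      (V.torusPoints F c * u * (V.torusPoints F c)⁻¹ * n) * (V.torusPoints F t)⁻¹ *
      (V.torusPoints F t * (V.torusPoints F c * κ)) := by
    rw [e]
    have e2 := torusPoints_mul_comm (V := V) c t
    calc _ = V.torusPoints F c * V.torusPoints F t * (u * ((V.torusPoints F c)⁻¹ * n *
            V.torusPoints F c) * κ) := by group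
      _ = _ := by
        rw [e2]
        group
  rw [e1, Hecke.delta_mul_left (conj_mem_iwahori_of_mem_intPoints ht (mul_mem huI hnI))]

lemma charMap_injective_and_free (h : V.IsAttached ξ φ) :
    Function.Injective (charMap h) ∧ Module.Free R (V.CharTensor ξ) := by
  obtain ⟨ϖ, hϖ⟩ := exists_valuation_lt_one F
  obtain ⟨h1, h2⟩ := injective_and_free_of_refining (charMapInt h) (V.charVec b ξ ϖ)
    (fun m κ => by
      rw [charMapInt_charVec_self]
      exact Units.isUnit _)
    (charVec_eq_smul h hϖ) (charVec_mem_span_succ h hϖ) (iSup_span_charVec h hϖ)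
  exact ⟨fun z z' e => h1 (by rw [charMapInt, LinearMap.comp_apply, e, LinearMap.comp_apply]), h2⟩

/-- A function `f` in the induced representation is invariant, for `m` large, under the conjugates
by `κ⁻¹ c⁻ᵐ⁻¹` of `U⁻ ∩ I`, for all `κ ∈ K`. On `K` it is then a combination of the functions
attached to the vectors `charVec m κ`, and `f` is determined by its restriction to `K`. -/
lemma exists_charMap_eq (h : V.IsAttached ξ φ) {f : V.points F → R} (hf : f ∈ V.induced b φ) :
    ∃ z, charMap h z = f := by
  obtain ⟨ϖ, hϖ⟩ := exists_valuation_lt_one F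
  have ev := eventually_conj_mem_of_isOpen (V := V) (b := b) hϖ hf.2 (by simp)
  obtain ⟨m, hm⟩ := ((Filter.tendsto_add_atTop_nat 1).eventually ev).exists
  obtain ⟨z, hz⟩ := exists_eq_of_proportional (charMapInt h) (V.charVec b ξ ϖ m)
    (fun κ => by
      rw [charMapInt_charVec_self]
      exact Units.isUnit _)
    (charVec_eq_smul h hϖ m) (finite_range_charVec m) (g := fun κ => f κ) fun κ κ' hne => by
      obtain ⟨t, ht, u, hu, huK, n, hn, hnI, e, e'⟩ := exists_of_charMapInt_ne_zero h hϖ hne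
      have h1 : f κ' = φ t * f κ := by
        have h2 := hm n hn hnI κ κ.2 (κ : V.points F)
        rw [e, mul_assoc, hf.1 t u hu, ← h2]
        congr 2
        group
      rw [e', charMapInt_charVec_self, h1, Units.val_mul]
      ring
  refine ⟨z, ?_⟩
  funext g
  obtain ⟨t, u, hu, κ, hκ, rfl⟩ := exists_iwasawa (V := V) (F := F) b g
  rw [hf.1 t u hu, (charMap_mem_induced h z).1 t u hu]
  congr 1
  exact congrFun hz ⟨κ, hκ⟩

end ChevalleyLattice

theorem mainTheorem6
    {F : Type*} [Field F] [ValuativeRel F] [TopologicalSpace F] [IsNonarchimedeanLocalField F]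
    {ι X Y : Type*} [Finite ι] [AddCommGroup X] [AddCommGroup Y] [Module.Finite ℤ X]
    [Module.Finite ℤ Y] (P : RootDatum ι X Y) [P.IsReduced] (b : P.Base)
    {J : Type*} [Fintype J] [DecidableEq J] (V : ChevalleyLattice P J)
    {k : Type*} [Field k] {R : Type*} [CommRing R] [Algebra k R]
    (ξ : V.antiAlgebra F b k →ₐ[k] R) (hξ : V.IsRegular ξ) :
    ∃ φ : ChevalleyLattice.Torus X F →* Rˣ,
      V.IsAttached ξ φ ∧ (∀ φ', V.IsAttached ξ φ' → φ' = φ) ∧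
      (∃ Φ : V.CharTensor ξ ≃ₗ[R] V.induced b φ,
        ∀ (g : V.points F) (r : R) (x : V.Universal F b k) (y : V.points F),
          (Φ (V.charTmul ξ r (Hecke.translate k (V.iwahori F b) g x))).1 y =
            (Φ (V.charTmul ξ r x)).1 (y * g)) ∧
      Module.Free R (V.induced b φ) ∧
      Module.Free R (V.CharTensor ξ) := by
  obtain ⟨φ, h⟩ := ChevalleyLattice.exists_isAttached hξ
  obtain ⟨hinj, hfree⟩ := ChevalleyLattice.charMap_injective_and_free h
  let Φ : V.CharTensor ξ ≃ₗ[R] V.induced b φ :=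
    LinearEquiv.ofBijective ((ChevalleyLattice.charMap h).codRestrict _
      (ChevalleyLattice.charMap_mem_induced h)) <| by
      refine ⟨fun z z' e => hinj (congrArg Subtype.val e), fun f => ?_⟩
      obtain ⟨z, hz⟩ := ChevalleyLattice.exists_charMap_eq h f.2
      exact ⟨z, Subtype.ext hz⟩
  have hΦ : ∀ z, (Φ z).1 = ChevalleyLattice.charMap h z := fun _ => rfl
  refine ⟨φ, h, fun φ' h' => h.unique h', ⟨Φ, fun g r x y => ?_⟩, Module.Free.of_equiv Φ, hfree⟩
  rw [hΦ, hΦ, ChevalleyLattice.charMap_charTmul, ChevalleyLattice.charMap_charTmul, Pi.smul_apply,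
    Pi.smul_apply, Hecke.convMap_translate]
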